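/- **Setting.** A three-mirror telescope observing an object at infinity is described by signed distances $d_1,d_2,d_3$ and magnifications $\Omega_1,\Omega_2$. Its curvatures are $$c_1=\frac{1-\Omega_1}{2d_1},\qquad c_2=\frac{1-\Omega_1}{2\Omega_1d_1}+\frac{1-\Omega_2}{2d_2},\qquad c_3=\frac{1-\Omega_2}{2\Omega_2d_2}+\frac{v}{2},$$ with $v=1/d_3$ for a focal and $v=0$ for an afocal telescope (no $d_3$ in the afocal case). Put $\Sigma=-d_1\Omega_1\Omega_2^2+d_2\Omega_2$ and $$g_1=f\Omega_1\Omega_2+d_3,\quad g_2=(1-\Omega_1)^2\Omega_2d_2d_3-(1-\Omega_2)^2\Omega_1d_1d_3-d_1d_2\Omega_1\Omega_2,\quad g_3=-\Sigma-d_3,$$ $$h_1=\Omega_1\Omega_2-G,\quad h_2=(1-\Omega_1)^2\Omega_2d_2-(1-\Omega_2)^2\Omega_1d_1,\quad h_3=(\Omega_1\Omega_2)^2z_0+\Sigma+d_p.$$ Put $Q_1=\Omega_1-1$, $Q_2=\Omega_1(d_1-d_2)+d_2-\Omega_1\Omega_2d_1$, and $Q_3=(1-\Omega_2)d_3+\Omega_2d_2$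 (focal), $Q_3=\Omega_2-1$ (afocal). The admissible sets, with their usual topology, are: * focal, codimension 2, $f=\pm1$: all real $(y,x)$, $y=(d_1,d_2,d_3)$, $x=(\Omega_1,\Omega_2)$, with $g_1=g_2=0$, $d_1<0$, $d_2>0$, $d_3<0$, $Q_1Q_2Q_3\ne0$; * focal, codimension 3, $f=\pm1$: all real $(y,x)$, $y=(d_1,d_2)$, $x=(d_3,\Omega_1,\Omega_2)$, with $g_1=g_2=g_3=0$, $d_1<0$, $d_2>0$, $d_3<0$, $Q_1Q_2Q_3\neq0$; * afocal, codimension 2, $d_1=-1$: all real $(y,x)$, $y=(G,d_2)$, $x=(\Omega_1,\Omega_2)$, with $h_1=h_2=0$, $G\ne0$, $d_2>0$, $Q_1Q_2Q_3\neq0$; * afocal, codimension 3, $d_1=-1$: all real $(y,x)$, $y=(G,z_0,d_p)$, $x=(d_2,\Omega_1,\Omega_2)$, with $h_1=h_2=h_3=0$, $G\ne0$, $d_2>0$, $Q_1Q_2Q_3\neq0$. The signature $\mathcal S$ of a point is the sequence of signs of $\Omega_1,\Omega_2,-c_1,c_2,-c_3$. It is written as a name: a letter $\mathtt P$ (positive)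 or $\mathtt N$ (negative) for each magnification, then a digit $\mathtt 1$ (positive) or $\mathtt 0$ (negative) for each of $-c_1,c_2,-c_3$. **Theorem.** In each case below, let $E$ be the admissible set. Then $\mathcal S$ is constant along continuous paths in $E$, and it is exact: two points of $E$ are joined by a continuous path in $E$ if and only if they have the same signature. The values of $\mathcal S$ on $E$ are exactly the names listed, the number of path components of $E$ is the number stated, and the path components are exactly the sets described, each carrying its name. In cases 1, 2, 3 and 6 put $\varphi=2A_1x_1+B_1$, with $x_1$ the first coordinate of $x$, and for a region $R$ put $$E^{\epsilon}(R)=\{(y,x)\in E: y\in R,\ \epsilon\varphi\ge0\},\qquad\epsilon=\pm1.$$ The component named $\nu$ is $E^{-1}(R_\nu^-)\cup E^{1}(R_\nu^+)$, where a region that is not listed is empty. Moreover $E^{-1}(R^-_\nu)$ and $E^{1}(R^+_\nu)$ are the graphs of continuous functions on $R^-_\nu$ and $R^+_\nu$. In cases 4 and 5 the component named $\nu$ is $\{(y,x)\in E:y\in R_\nu\}$, and it is the graph of a continuous function on $R_\nu$. **1. Focal, codimension 2, $f=1$: 6 components** $\mathtt{PP010},\mathtt{PP110},\mathtt{PP001},\mathtt{PP011},\mathtt{PP100},\mathtt{PP101}$.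 Here, with $f=1$ (and with $f=-1$ in case 2), $$A_1=f(d_1f+d_2d_3),\quad B_1=f(-d_1d_2+2d_1d_3-2d_2d_3),\quad C_1=d_3(d_1d_3+d_2f),\quad A_2=f(d_1d_3+d_2f),$$ and $\Delta=B_1^2-4A_1C_1$, $q_1=(1+d_3)^2-d_2$, $q_2=d_1-d_2+(1+d_3)^2$, $q_3=d_1+(1-d_2+d_3)^2$. All regions are inside $\{d_1<0,\ d_2>0,\ d_3<0\}$. * $R^-_{\mathtt{PP011}}$: $q_2<0$, $q_3>0$, $d_2>1+d_3$. * $R^-_{\mathtt{PP010}}$: ($d_3\le-1$, $q_3<0$) or ($d_3\ge-1$, $(1+d_3)^2<d_2<1+d_3$) or ($d_3\ge-1$, $d_2\ge1+d_3$, $q_3<0$). * $R^-_{\mathtt{PP110}}$: $d_3\ge-1$, $q_1>0$, $q_2<0$. * $R^-_{\mathtt{PP101}}$: $d_3\ge-\frac13$, $\Delta\ge0$, $q_3>0$, $-(1+d_3)^2\le d_1\le-4d_3^2$, $d_2\le1+3d_3$. * $R^-_{\mathtt{PP100}}$: ($d_3\ge-1$, $q_2>0$, $d_1>-4d_3^2$,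 $\Delta\ge0$) or ($d_3\ge-1$, $q_2>0$, $-(1+d_3)^2\le d_1\le-4d_3^2$, $q_3<0$). * $R^-_{\mathtt{PP001}}$: $d_3\le-1$, $\Delta\ge0$, $q_2>0$. * $R^+_{\mathtt{PP101}}$: ($d_3\le-1$, $\Delta\ge0$, $q_1<0$) or ($d_3\ge-1$, $\Delta\ge0$, $q_3<0$) or ($d_3\ge-\frac13$, $\Delta\ge0$, $d_2<1+3d_3$) or ($d_3\ge-1$, $d_2\ge1+d_3$). * $R^+_{\mathtt{PP100}}$: $d_3\ge-1$, $1+3d_3\le d_2\le1+d_3$, $\Delta\ge0$, $q_3>0$. * $R^+_{\mathtt{PP001}}$: $d_3\le-1$, $\Delta\ge0$, $q_1>0$. **2. Focal, codimension 2, $f=-1$: 4 components.** Inside $\{d_1<0,\ d_2>0,\ d_3<0\}$: $R^-_{\mathtt{PN101}}$: $A_2>0$; $R^-_{\mathtt{NP101}}$: $A_2<0$; $R^+_{\mathtt{PN011}}$: $A_1>0$; $R^+_{\mathtt{NP110}}$: $A_1<0$. **3. Afocal, codimension 2: 4 components.** Here $A_1=-Gd_2-1$, $B_1=2G(d_2+1)$,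 $A_2=-G-d_2$. Inside $\{G<0,\ d_2>0\}$: $R^-_{\mathtt{NP101}}$: $A_2>0$; $R^-_{\mathtt{PN101}}$: $A_2<0$; $R^+_{\mathtt{PN011}}$: $A_1>0$; $R^+_{\mathtt{NP110}}$: $A_1<0$. **4. Focal, codimension 3, $f=1$: 5 components.** Put $B_1=(d_1+1)^2+(d_2-1)^2-1$, $q_1=(d_1+1)^2-d_2$, $q_2=-d_1+d_2-1$. Inside $\{d_1<0,\ d_2>0,\ B_1<0\}$: $R_{\mathtt{PP110}}$: $d_1<-1$, $q_1>0$; $R_{\mathtt{PP010}}$: $d_1<-1$, $q_1<0$; $R_{\mathtt{PP011}}$: $d_1>-1$, $q_2>0$; $R_{\mathtt{PP001}}$: $d_1>-1$, $q_2<0$, $q_1<0$; $R_{\mathtt{PP101}}$: $d_1>-1$, $q_1>0$. **5. Focal, codimension 3, $f=-1$: 1 component**, $R_{\mathtt{PN011}}=\{d_1<0,\ d_2>0\}$. **6. Afocal, codimension 3: 4 components.** Here $A_1=G^2$, $A_2=G^2z_0+d_p$, $A_3=-2G^2+2G+A_2$, $B_1=G^3+G+2GA_2$, $\Delta=B_1^2-4G^2(A_2+G)^2$,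 $q=A_2+G$. All regions are inside $\{G<0\}$. * $R^-_{\mathtt{PN011}}$: $A_2<0$, $G<-1$, $\Delta\ge0$. * $R^-_{\mathtt{NP110}}$: ($A_2>0$, $G\le-1$, $q<0$) or ($\Delta\ge0$, $G>-1$, $q<0$). * $R^-_{\mathtt{NP101}}$: $A_3<0$, $q>0$. * $R^-_{\mathtt{PN101}}$: $A_3>0$. * $R^+_{\mathtt{PN011}}$: ($A_2>0$, $G\ge-1$) or ($\Delta\ge0$, $G<-1$). * $R^+_{\mathtt{NP110}}$: $A_2<0$, $G\ge-1$, $\Delta\ge0$. -/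

import Mathlib

noncomputable section

namespace ThreeMirror

/-! ## Path components, invariants, and graphs of branches -/

/-- `S` is constant along every continuous path in `X`. -/
def IsTopologicalInvariant {X ι : Type*} [TopologicalSpace X] (S : X → ι) : Prop :=
  ∀ x x' : X, Joined x x' → S x = S x'

/-- Two points of `X` are linked by a continuous path if and only if `S` agrees on them. -/
def IsExactInvariant {X ι : Type*} [TopologicalSpace X] (S : X → ι) : Prop :=
  ∀ x x' : X, Joined x x' ↔ S x = S x'

/-- The set of the path components of a subset `E`. -/
def pathComponents {Z : Type*} [TopologicalSpace Z] (E : Set Z) : Set (Set Z) :=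
  {C | ∃ p ∈ E, C = pathComponentIn E p}

/-- `P` is the graph over `R` of a continuous function `ξ`. -/
def IsContinuousGraph {Y X : Type*} [TopologicalSpace Y] [TopologicalSpace X]
    (P : Set (Y × X)) (R : Set Y) : Prop :=
  ∃ ξ : Y → X, ContinuousOn ξ R ∧ P = (fun y => (y, ξ y)) '' R

/-- The part of `E` that lies above the region `R`. -/
def partOver {Y X : Type*} (E : Set (Y × X)) (R : Set Y) : Set (Y × X) :=
  {p | p ∈ E ∧ p.1 ∈ R}

/-- The part of `E` that lies above `R` and on the branch `ε` of the pivot equation; `φ` is the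
derivative `2 A₁ x₁ + B₁` of the pivot polynomial `A₁ x₁ ^ 2 + B₁ x₁ + C₁` in its unknown. -/
def branchOver {Y X : Type*} (E : Set (Y × X)) (φ : Y × X → ℝ) (ε : ℝ) (R : Set Y) :
    Set (Y × X) :=
  {p | p ∈ E ∧ p.1 ∈ R ∧ 0 ≤ ε * φ p}

/-! ## Nomenclature -/

/-- Signs of the two magnifications, then of `-c₁`, `c₂`, `-c₃`. -/
abbrev Signature : Type := (SignType × SignType) × (SignType × SignType × SignType)

/-- Names: a letter for each magnification (`P` positive, `N` negative), then a digit for each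
mirror (`1` for convex, `0` for concave). -/
inductive Name : Type
  | PP010 | PP110 | PP001 | PP011 | PP100 | PP101
  | NP101 | NP110 | PN101 | PN011

/-- The signature that a name stands for. -/
def Name.signature : Name → Signature
  | .PP010 => ((1, 1), (-1, 1, -1))
  | .PP110 => ((1, 1), (1, 1, -1))
  | .PP001 => ((1, 1), (-1, -1, 1))
  | .PP011 => ((1, 1), (-1, 1, 1))
  | .PP100 => ((1, 1), (1, -1, -1))
  | .PP101 => ((1, 1), (1, -1, 1))
  | .NP101 => ((-1, 1), (1, -1, 1))
  | .NP110 => ((-1, 1), (1, 1, -1))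
  | .PN101 => ((1, -1), (1, -1, 1))
  | .PN011 => ((1, -1), (-1, 1, 1))

/-- The signature of a three-mirror system observing an object at infinity, with magnifications
`Ω₁`, `Ω₂` and curvatures `c₁`, `c₂`, `c₃`; the number `v` is the inverse of the distance from the
last mirror to the image (`1 / d₃` for a focal system, `0` for an afocal one). -/
def signature (d₁ d₂ v Ω₁ Ω₂ : ℝ) : Signature :=
  let c₁ : ℝ := (1 - Ω₁) / (2 * d₁)
  let c₂ : ℝ := (1 - Ω₁) / (2 * Ω₁ * d₁) + (1 - Ω₂) / (2 * d₂)
  let c₃ : ℝ := (1 - Ω₂) / (2 * Ω₂ * d₂) + v / 2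
  ((SignType.sign Ω₁, SignType.sign Ω₂),
    (-SignType.sign c₁, SignType.sign c₂, -SignType.sign c₃))

/-! ## What a classification asserts -/

/-- The set `E` has exactly `k` path components; they are the sets `C ν`, for `ν` in `names`; the
signature is a topological invariant on `E` that takes the values named by `names`, it has the
value named by `ν` on `C ν`, and it is exact. -/
structure IsClassification {Z : Type*} [TopologicalSpace Z] (E : Set Z) (S : Z → Signature)
    (names : Set Name) (k : ℕ) (C : Name → Set Z) : Prop where
  components : pathComponents E = C '' names
  signature_eq : ∀ ν ∈ names, ∀ p ∈ C ν, S p = ν.signature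
  range_eq : S '' E = Name.signature '' names
  count : Nat.card (ZerothHomotopy E) = k
  invariant : IsTopologicalInvariant (fun p : E => S p)
  exact : IsExactInvariant (fun p : E => S p)

/-- Classification of a set with two branches: the component named `ν` is the union of the parts of
the branches `-1` and `1` above the regions `Rm ν` and `Rp ν`, and each of these parts is the graph
of a continuous function on its region. -/
def TwoBranchClassification {Y X : Type*} [TopologicalSpace Y] [TopologicalSpace X]
    (E : Set (Y × X)) (S : Y × X → Signature) (φ : Y × X → ℝ) (Rm Rp : Name → Set Y)
    (names : Set Name) (k : ℕ) : Prop :=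
  IsClassification E S names k
      (fun ν => branchOver E φ (-1) (Rm ν) ∪ branchOver E φ 1 (Rp ν)) ∧
    ∀ ν ∈ names, IsContinuousGraph (branchOver E φ (-1) (Rm ν)) (Rm ν) ∧
      IsContinuousGraph (branchOver E φ 1 (Rp ν)) (Rp ν)

/-- Classification of a set with one branch: the component named `ν` is the graph of a continuous
function on the region `R ν`. -/
def OneBranchClassification {Y X : Type*} [TopologicalSpace Y] [TopologicalSpace X]
    (E : Set (Y × X)) (S : Y × X → Signature) (R : Name → Set Y)
    (names : Set Name) (k : ℕ) : Prop :=
  IsClassification E S names k (fun ν => partOver E (R ν)) ∧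
    ∀ ν ∈ names, IsContinuousGraph (partOver E (R ν)) (R ν)

/-! ## Focal telescopes: equations and constraints -/

/-- The sum `∑ₗ (-1) ^ l dₗ Ωₗ ∏_{i > l} Ωᵢ ^ 2` for three mirrors. -/
def pupilSum (d₁ d₂ Ω₁ Ω₂ : ℝ) : ℝ := -(d₁ * Ω₁ * Ω₂ ^ 2) + d₂ * Ω₂

/-- Focal condition. -/
def g₁ (f d₃ Ω₁ Ω₂ : ℝ) : ℝ := f * (Ω₁ * Ω₂) + d₃

/-- Petzval condition. -/
def g₂ (d₁ d₂ d₃ Ω₁ Ω₂ : ℝ) : ℝ :=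
  (1 - Ω₁) ^ 2 * Ω₂ * (d₂ * d₃) - (1 - Ω₂) ^ 2 * Ω₁ * (d₁ * d₃) - d₁ * d₂ * (Ω₁ * Ω₂)

/-- Telecentricity condition. -/
def g₃ (d₁ d₂ d₃ Ω₁ Ω₂ : ℝ) : ℝ := -pupilSum d₁ d₂ Ω₁ Ω₂ - d₃

/-- No mirror of the focal system is flat. -/
def FocalNonflat (d₁ d₂ d₃ Ω₁ Ω₂ : ℝ) : Prop :=
  Ω₁ - 1 ≠ 0 ∧
  Ω₁ * (d₁ - d₂) + d₂ - Ω₂ * Ω₁ * d₁ ≠ 0 ∧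
  (1 - Ω₂) * d₃ + Ω₂ * d₂ ≠ 0

/-- Admissible focal systems in codimension 2, as points `((d₁, d₂, d₃), (Ω₁, Ω₂))`. -/
def focalE₂ (f : ℝ) : Set ((ℝ × ℝ × ℝ) × (ℝ × ℝ)) :=
  {p | ∃ d₁ d₂ d₃ Ω₁ Ω₂ : ℝ, p = ((d₁, d₂, d₃), (Ω₁, Ω₂)) ∧
    g₁ f d₃ Ω₁ Ω₂ = 0 ∧ g₂ d₁ d₂ d₃ Ω₁ Ω₂ = 0 ∧
    d₁ < 0 ∧ 0 < d₂ ∧ d₃ < 0 ∧ FocalNonflat d₁ d₂ d₃ Ω₁ Ω₂}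

/-- Signature in the coordinates of `focalE₂`. -/
def focalS₂ (p : (ℝ × ℝ × ℝ) × (ℝ × ℝ)) : Signature :=
  signature p.1.1 p.1.2.1 (1 / p.1.2.2) p.2.1 p.2.2

/-- Admissible focal systems in codimension 3, as points `((d₁, d₂), (d₃, Ω₁, Ω₂))`. -/
def focalE₃ (f : ℝ) : Set ((ℝ × ℝ) × (ℝ × ℝ × ℝ)) :=
  {p | ∃ d₁ d₂ d₃ Ω₁ Ω₂ : ℝ, p = ((d₁, d₂), (d₃, Ω₁, Ω₂)) ∧
    g₁ f d₃ Ω₁ Ω₂ = 0 ∧ g₂ d₁ d₂ d₃ Ω₁ Ω₂ = 0 ∧ g₃ d₁ d₂ d₃ Ω₁ Ω₂ = 0 ∧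
    d₁ < 0 ∧ 0 < d₂ ∧ d₃ < 0 ∧ FocalNonflat d₁ d₂ d₃ Ω₁ Ω₂}

/-- Signature in the coordinates of `focalE₃`. -/
def focalS₃ (p : (ℝ × ℝ) × (ℝ × ℝ × ℝ)) : Signature :=
  signature p.1.1 p.1.2 (1 / p.2.1) p.2.2.1 p.2.2.2

/-! ## Afocal telescopes: equations and constraints -/

/-- Magnification condition. -/
def h₁ (G Ω₁ Ω₂ : ℝ) : ℝ := Ω₁ * Ω₂ - G

/-- Petzval condition. -/
def h₂ (d₁ d₂ Ω₁ Ω₂ : ℝ) : ℝ := (1 - Ω₁) ^ 2 * Ω₂ * d₂ - (1 - Ω₂) ^ 2 * Ω₁ * d₁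

/-- Pupil position condition. -/
def h₃ (z₀ dp d₁ d₂ Ω₁ Ω₂ : ℝ) : ℝ := (Ω₁ * Ω₂) ^ 2 * z₀ + pupilSum d₁ d₂ Ω₁ Ω₂ + dp

/-- No mirror of the afocal system is flat. -/
def AfocalNonflat (d₁ d₂ Ω₁ Ω₂ : ℝ) : Prop :=
  Ω₁ - 1 ≠ 0 ∧ Ω₁ * (d₁ - d₂) + d₂ - Ω₂ * Ω₁ * d₁ ≠ 0 ∧ Ω₂ - 1 ≠ 0

/-- Admissible afocal systems in codimension 2, normalized by `d₁ = -1`, as points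
`((G, d₂), (Ω₁, Ω₂))`. -/
def afocalE₂ : Set ((ℝ × ℝ) × (ℝ × ℝ)) :=
  {p | ∃ G d₂ Ω₁ Ω₂ : ℝ, p = ((G, d₂), (Ω₁, Ω₂)) ∧
    h₁ G Ω₁ Ω₂ = 0 ∧ h₂ (-1) d₂ Ω₁ Ω₂ = 0 ∧
    0 < d₂ ∧ G ≠ 0 ∧ AfocalNonflat (-1) d₂ Ω₁ Ω₂}

/-- Signature in the coordinates of `afocalE₂`. -/
def afocalS₂ (p : (ℝ × ℝ) × (ℝ × ℝ)) : Signature :=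
  signature (-1) p.1.2 0 p.2.1 p.2.2

/-- Admissible afocal systems in codimension 3, normalized by `d₁ = -1`, as points
`((G, z₀, dp), (d₂, Ω₁, Ω₂))`. -/
def afocalE₃ : Set ((ℝ × ℝ × ℝ) × (ℝ × ℝ × ℝ)) :=
  {p | ∃ G z₀ dp d₂ Ω₁ Ω₂ : ℝ, p = ((G, z₀, dp), (d₂, Ω₁, Ω₂)) ∧
    h₁ G Ω₁ Ω₂ = 0 ∧ h₂ (-1) d₂ Ω₁ Ω₂ = 0 ∧ h₃ z₀ dp (-1) d₂ Ω₁ Ω₂ = 0 ∧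
    0 < d₂ ∧ G ≠ 0 ∧ AfocalNonflat (-1) d₂ Ω₁ Ω₂}

/-- Signature in the coordinates of `afocalE₃`. -/
def afocalS₃ (p : (ℝ × ℝ × ℝ) × (ℝ × ℝ × ℝ)) : Signature :=
  signature (-1) p.2.1 0 p.2.2.1 p.2.2.2

/-! ## Regions for focal telescopes in codimension 2

The pivot unknown is `Ω₁`, and the pivot equation is `A₁ Ω₁ ^ 2 + B₁ Ω₁ + C₁ = 0`. -/

namespace Focal₂

def A₁ (f d₁ d₂ d₃ : ℝ) : ℝ := f * (d₁ * f + d₂ * d₃)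
def B₁ (f d₁ d₂ d₃ : ℝ) : ℝ := f * (-(d₁ * d₂) + 2 * d₁ * d₃ - 2 * d₂ * d₃)
def C₁ (f d₁ d₂ d₃ : ℝ) : ℝ := d₃ * (d₁ * d₃ + d₂ * f)
def A₂ (f d₁ d₂ d₃ : ℝ) : ℝ := (d₁ * d₃ + d₂ * f) * f
def Δ (f d₁ d₂ d₃ : ℝ) : ℝ := B₁ f d₁ d₂ d₃ ^ 2 - 4 * A₁ f d₁ d₂ d₃ * C₁ f d₁ d₂ d₃

/-- Derivative of the pivot polynomial. -/
def φ (f : ℝ) (p : (ℝ × ℝ × ℝ) × (ℝ × ℝ)) : ℝ :=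
  2 * A₁ f p.1.1 p.1.2.1 p.1.2.2 * p.2.1 + B₁ f p.1.1 p.1.2.1 p.1.2.2

/-- The polynomials `q₁`, `q₂`, `q₃` for `f = 1`. -/
def q₁ (d₂ d₃ : ℝ) : ℝ := -d₂ + (1 + d₃) ^ 2
def q₂ (d₁ d₂ d₃ : ℝ) : ℝ := d₁ - d₂ + (1 + d₃) ^ 2
def q₃ (d₁ d₂ d₃ : ℝ) : ℝ := d₁ + (1 - d₂ + d₃) ^ 2

/-- Regions for `f = 1` and the branch `-1`. -/
def PosMinus (d₁ d₂ d₃ : ℝ) : Name → Prop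
  | .PP011 => q₂ d₁ d₂ d₃ < 0 ∧ 0 < q₃ d₁ d₂ d₃ ∧ 1 + d₃ < d₂
  | .PP010 =>
      (d₃ ≤ -1 ∧ q₃ d₁ d₂ d₃ < 0) ∨
      (-1 ≤ d₃ ∧ (1 + d₃) ^ 2 < d₂ ∧ d₂ < 1 + d₃) ∨
      (-1 ≤ d₃ ∧ 1 + d₃ ≤ d₂ ∧ q₃ d₁ d₂ d₃ < 0)
  | .PP110 => -1 ≤ d₃ ∧ 0 < q₁ d₂ d₃ ∧ q₂ d₁ d₂ d₃ < 0
  | .PP101 =>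
      -(1 / 3) ≤ d₃ ∧ 0 ≤ Δ 1 d₁ d₂ d₃ ∧ 0 < q₃ d₁ d₂ d₃ ∧
        -(1 + d₃) ^ 2 ≤ d₁ ∧ d₁ ≤ -4 * d₃ ^ 2 ∧ d₂ ≤ 1 + 3 * d₃
  | .PP100 =>
      (-1 ≤ d₃ ∧ 0 < q₂ d₁ d₂ d₃ ∧ -4 * d₃ ^ 2 < d₁ ∧ 0 ≤ Δ 1 d₁ d₂ d₃) ∨
      (-1 ≤ d₃ ∧ 0 < q₂ d₁ d₂ d₃ ∧ -(1 + d₃) ^ 2 ≤ d₁ ∧ d₁ ≤ -4 * d₃ ^ 2 ∧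
        q₃ d₁ d₂ d₃ < 0)
  | .PP001 => d₃ ≤ -1 ∧ 0 ≤ Δ 1 d₁ d₂ d₃ ∧ 0 < q₂ d₁ d₂ d₃
  | _ => False

/-- Regions for `f = 1` and the branch `1`. -/
def PosPlus (d₁ d₂ d₃ : ℝ) : Name → Prop
  | .PP101 =>
      (d₃ ≤ -1 ∧ 0 ≤ Δ 1 d₁ d₂ d₃ ∧ q₁ d₂ d₃ < 0) ∨
      (-1 ≤ d₃ ∧ 0 ≤ Δ 1 d₁ d₂ d₃ ∧ q₃ d₁ d₂ d₃ < 0) ∨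
      (-(1 / 3) ≤ d₃ ∧ 0 ≤ Δ 1 d₁ d₂ d₃ ∧ d₂ < 1 + 3 * d₃) ∨
      (-1 ≤ d₃ ∧ 1 + d₃ ≤ d₂)
  | .PP100 =>
      -1 ≤ d₃ ∧ 1 + 3 * d₃ ≤ d₂ ∧ d₂ ≤ 1 + d₃ ∧ 0 ≤ Δ 1 d₁ d₂ d₃ ∧ 0 < q₃ d₁ d₂ d₃
  | .PP001 => d₃ ≤ -1 ∧ 0 ≤ Δ 1 d₁ d₂ d₃ ∧ 0 < q₁ d₂ d₃
  | _ => False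

/-- Regions for `f = -1` and the branch `-1`. -/
def NegMinus (d₁ d₂ d₃ : ℝ) : Name → Prop
  | .PN101 => 0 < A₂ (-1) d₁ d₂ d₃
  | .NP101 => A₂ (-1) d₁ d₂ d₃ < 0
  | _ => False

/-- Regions for `f = -1` and the branch `1`. -/
def NegPlus (d₁ d₂ d₃ : ℝ) : Name → Prop
  | .PN011 => 0 < A₁ (-1) d₁ d₂ d₃
  | .NP110 => A₁ (-1) d₁ d₂ d₃ < 0
  | _ => False

/-- The region of the octant `d₁ < 0`, `d₂ > 0`, `d₃ < 0` that is cut out by `P`. -/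
def region (P : ℝ → ℝ → ℝ → Name → Prop) (ν : Name) : Set (ℝ × ℝ × ℝ) :=
  {y | y.1 < 0 ∧ 0 < y.2.1 ∧ y.2.2 < 0 ∧ P y.1 y.2.1 y.2.2 ν}

end Focal₂

/-! ## Regions for afocal telescopes in codimension 2

The pivot unknown is `Ω₁`, and the pivot equation is `A₁ Ω₁ ^ 2 + B₁ Ω₁ + G A₂ = 0`. -/

namespace Afocal₂

def A₁ (G d₂ : ℝ) : ℝ := -(G * d₂) - 1
def B₁ (G d₂ : ℝ) : ℝ := 2 * G * (d₂ + 1)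
def A₂ (G d₂ : ℝ) : ℝ := -G - d₂

/-- Derivative of the pivot polynomial. -/
def φ (p : (ℝ × ℝ) × (ℝ × ℝ)) : ℝ := 2 * A₁ p.1.1 p.1.2 * p.2.1 + B₁ p.1.1 p.1.2

/-- Regions for the branch `-1`. -/
def Minus (G d₂ : ℝ) : Name → Prop
  | .NP101 => 0 < A₂ G d₂
  | .PN101 => A₂ G d₂ < 0
  | _ => False

/-- Regions for the branch `1`. -/
def Plus (G d₂ : ℝ) : Name → Prop
  | .PN011 => 0 < A₁ G d₂
  | .NP110 => A₁ G d₂ < 0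
  | _ => False

/-- The region of the quadrant `G < 0`, `d₂ > 0` that is cut out by `P`. -/
def region (P : ℝ → ℝ → Name → Prop) (ν : Name) : Set (ℝ × ℝ) :=
  {y | y.1 < 0 ∧ 0 < y.2 ∧ P y.1 y.2 ν}

end Afocal₂

/-! ## Regions for focal telescopes in codimension 3 -/

namespace Focal₃

def B₁ (f d₁ d₂ : ℝ) : ℝ := f * ((d₁ + f) ^ 2 + (d₂ - f) ^ 2 - f ^ 2)
def q₁ (f d₁ d₂ : ℝ) : ℝ := (d₁ + f) ^ 2 - d₂ * f
def q₂ (f d₁ d₂ : ℝ) : ℝ := -d₁ + d₂ - f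

/-- Regions for `f = 1`. -/
def Pos (d₁ d₂ : ℝ) : Name → Prop
  | .PP110 => d₁ < -1 ∧ B₁ 1 d₁ d₂ < 0 ∧ 0 < q₁ 1 d₁ d₂
  | .PP010 => d₁ < -1 ∧ B₁ 1 d₁ d₂ < 0 ∧ q₁ 1 d₁ d₂ < 0
  | .PP011 => -1 < d₁ ∧ B₁ 1 d₁ d₂ < 0 ∧ 0 < q₂ 1 d₁ d₂
  | .PP001 => -1 < d₁ ∧ B₁ 1 d₁ d₂ < 0 ∧ q₂ 1 d₁ d₂ < 0 ∧ q₁ 1 d₁ d₂ < 0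
  | .PP101 => -1 < d₁ ∧ B₁ 1 d₁ d₂ < 0 ∧ 0 < q₁ 1 d₁ d₂
  | _ => False

/-- Region for `f = -1`: the whole quadrant. -/
def Neg (_d₁ _d₂ : ℝ) : Name → Prop
  | .PN011 => True
  | _ => False

/-- The region of the quadrant `d₁ < 0`, `d₂ > 0` that is cut out by `P`. -/
def region (P : ℝ → ℝ → Name → Prop) (ν : Name) : Set (ℝ × ℝ) :=
  {y | y.1 < 0 ∧ 0 < y.2 ∧ P y.1 y.2 ν}

end Focal₃

/-! ## Regions for afocal telescopes in codimension 3

The pivot unknown is `d₂`, and the pivot equation is `G ^ 2 d₂ ^ 2 + B₁ d₂ + C₁ = 0`. -/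

namespace Afocal₃

def A₂ (G z₀ dp : ℝ) : ℝ := G ^ 2 * z₀ + dp
def A₃ (G z₀ dp : ℝ) : ℝ := -2 * G ^ 2 + 2 * G + A₂ G z₀ dp
def B₁ (G z₀ dp : ℝ) : ℝ := G ^ 3 + G + 2 * G * A₂ G z₀ dp
def C₁ (G z₀ dp : ℝ) : ℝ := (G ^ 2 * z₀ + G + dp) ^ 2
def Δ (G z₀ dp : ℝ) : ℝ := B₁ G z₀ dp ^ 2 - 4 * G ^ 2 * C₁ G z₀ dp
def q (G z₀ dp : ℝ) : ℝ := G ^ 2 * z₀ + dp + G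

/-- Derivative of the pivot polynomial. -/
def φ (p : (ℝ × ℝ × ℝ) × (ℝ × ℝ × ℝ)) : ℝ :=
  2 * p.1.1 ^ 2 * p.2.1 + B₁ p.1.1 p.1.2.1 p.1.2.2

/-- Regions for the branch `-1`. -/
def Minus (G z₀ dp : ℝ) : Name → Prop
  | .PN011 => A₂ G z₀ dp < 0 ∧ G < -1 ∧ 0 ≤ Δ G z₀ dp
  | .NP110 =>
      (0 < A₂ G z₀ dp ∧ G ≤ -1 ∧ q G z₀ dp < 0) ∨
      (0 ≤ Δ G z₀ dp ∧ -1 < G ∧ q G z₀ dp < 0)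
  | .NP101 => A₃ G z₀ dp < 0 ∧ 0 < q G z₀ dp
  | .PN101 => 0 < A₃ G z₀ dp
  | _ => False

/-- Regions for the branch `1`. -/
def Plus (G z₀ dp : ℝ) : Name → Prop
  | .PN011 => (0 < A₂ G z₀ dp ∧ -1 ≤ G) ∨ (0 ≤ Δ G z₀ dp ∧ G < -1)
  | .NP110 => A₂ G z₀ dp < 0 ∧ -1 ≤ G ∧ 0 ≤ Δ G z₀ dp
  | _ => False

/-- The region of the half-space `G < 0` that is cut out by `P`. -/
def region (P : ℝ → ℝ → ℝ → Name → Prop) (ν : Name) : Set (ℝ × ℝ × ℝ) :=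
  {y | y.1 < 0 ∧ P y.1 y.2.1 y.2.2 ν}

end Afocal₃

end ThreeMirror

end

noncomputable section

namespace ThreeMirror

open Set Topology

/-! ## Classification by the level sets of a locally constant signature -/

/-! The five signs in the signature are, up to factors of constant sign, the signs of Ω₁, Ω₂ and the
flatness polynomials. On an admissible set none of these vanishes, so the signature is a continuous
map to a discrete space and is constant along paths. If, moreover, every nonempty level set is path
connected, the level sets are the path components, and the whole classification follows
(`IsClassification.of_levelSets`). What remains is to parametrize the level sets and to recognize,
on each branch, which region of the base carries which signature.

Focal, codimension 2, with d₁ = -a, d₂ = b, d₃ = -c: the focal condition eliminates Ω₂, and the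
Petzval condition becomes a quadratic equation in x = Ω₁ that is linear in a. For f = 1 every root x
is positive, and the signature is the position of x relative to the three flatness roots 1, `flat₂`
and b + c; two of the eight positions are impossible (`exists_posOrder`). The concave pivot
polynomial takes at these three points values proportional to q₁, q₂, q₃, which explains the
regions; its slopes there settle the cases in which the values alone do not locate the root. Solving
for a instead gives coordinates (c, x, b) on a level set, in which each order relation bounds b for
fixed (c, x). The fibres are intervals over a convex base, so the level set is path connected. For f
= -1 the same elimination makes nonflatness automatic for a nonzero root, and the signature only
records the position of x relative to -c, 0, 1.

Afocal systems: with z = (1 - G) / (Ω₁ - 1), the Petzval condition reads -G d₂ = (1 + z)². Hence G <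
0, everything is rational in (G, z), and the signature records the position of z relative to the
walls G - 1 < -1 < 0. The level sets are images of convex sets. In codimension 3 the pupil condition
becomes z (z + 1 + G) = A₂, which is linear in d_p.

Focal, codimension 3: telecentricity is linear in x and gives x = b + a c or x = a c - b; the pivot
equation then leaves only a b c = -B₁. So the set is a graph over (d₁, d₂), and path connectedness
is a question about planar regions cut out by a disc, a parabola and lines.

Each branch is a continuous graph because the chosen root of the quadratic equation is unique and
continuous, even where the leading coefficient vanishes (`continuousOn_quadRoot`). -/

theorem Name.signature_injective : Function.Injective Name.signature := by
  intro μ ν h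
  cases μ <;> cases ν <;> first | rfl | (exact absurd h (by decide))

/-- The target is discrete, so the signature along a path is a locally constant function on the unit
interval, which is preconnected. -/
theorem eq_of_joined {Z : Type*} [TopologicalSpace Z] {E : Set Z} {S : Z → Signature}
    (hS : ContinuousOn S E) {p q : E} (h : Joined p q) : S p = S q := by
  have hc : Continuous fun p : E => S p := hS.domRestrict
  obtain ⟨γ⟩ := h
  have hl : IsLocallyConstant fun t => S (γ t) :=
    (IsLocallyConstant.iff_continuous _).2 (hc.comp γ.continuous)
  simpa using hl.apply_eq_of_isPreconnected isPreconnected_univ (mem_univ 0) (mem_univ 1)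

/-- A path cannot leave a level set, and inside a level set any two points are joined. Level sets
are thus exactly path components, and all clauses of the classification are read off from this. -/
theorem IsClassification.of_levelSets {Z : Type*} [TopologicalSpace Z] {E : Set Z}
    {S : Z → Signature} {names : Set Name} {k : ℕ} {C : Name → Set Z}
    (hS : ContinuousOn S E)
    (hC : ∀ ν ∈ names, C ν = {p | p ∈ E ∧ S p = ν.signature})
    (hcover : ∀ p ∈ E, ∃ ν ∈ names, S p = ν.signature)
    (hconn : ∀ ν ∈ names, IsPathConnected {p | p ∈ E ∧ S p = ν.signature})
    (hk : names.ncard = k) : IsClassification E S names k C := by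
  have hjoin : ∀ p q : E, Joined p q ↔ S p = S q := by
    refine fun p q => ⟨eq_of_joined hS, fun h => ?_⟩
    obtain ⟨ν, hν, hp⟩ := hcover p p.2
    have := ((hconn ν hν).joinedIn p ⟨p.2, hp⟩ q ⟨q.2, h ▸ hp⟩).mono fun _ hz => hz.1
    exact (joinedIn_iff_joined p.2 q.2).1 this
  have hcomp : ∀ ν ∈ names, ∀ p ∈ E, S p = ν.signature → pathComponentIn E p = C ν := by
    intro ν hν p hp hpν
    rw [hC ν hν]
    ext q
    refine ⟨fun h => ?_, fun h => ?_⟩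
    · have hq : q ∈ E := h.target_mem
      refine ⟨hq, ?_⟩
      rw [← hpν]
      exact ((hjoin ⟨p, hp⟩ ⟨q, hq⟩).1 ((joinedIn_iff_joined hp hq).1 h)).symm
    · exact (joinedIn_iff_joined hp h.1).2 ((hjoin ⟨p, hp⟩ ⟨q, h.1⟩).2 (hpν.trans h.2.symm))
  refine ⟨?_, ?_, ?_, ?_, fun p q h => eq_of_joined hS h, hjoin⟩
  · ext D
    constructor
    · rintro ⟨p, hp, rfl⟩
      obtain ⟨ν, hν, hpν⟩ := hcover p hp
      exact ⟨ν, hν, (hcomp ν hν p hp hpν).symm⟩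
    · rintro ⟨ν, hν, rfl⟩
      obtain ⟨p, hp, hpν⟩ := (hconn ν hν).nonempty
      exact ⟨p, hp, (hcomp ν hν p hp hpν).symm⟩
  · intro ν hν p hp
    rw [hC ν hν] at hp
    exact hp.2
  · ext s
    constructor
    · rintro ⟨p, hp, rfl⟩
      obtain ⟨ν, hν, hpν⟩ := hcover p hp
      exact ⟨ν, hν, hpν.symm⟩
    · rintro ⟨ν, hν, rfl⟩
      obtain ⟨p, hp, hpν⟩ := (hconn ν hν).nonempty
      exact ⟨p, hp, hpν⟩
  · rw [← hk, ← Nat.card_coe_set_eq]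
    -- One base point per level set gives a map from names to components: injective because distinct
    -- names have distinct signatures, surjective because the names cover `E`.
    choose pt hpt using fun ν : names => (hconn ν ν.2).nonempty
    let F : names → ZerothHomotopy E := fun ν => Quotient.mk _ (⟨pt ν, (hpt ν).1⟩ : E)
    refine (Nat.card_congr (Equiv.ofBijective F ⟨fun μ ν h => ?_, fun z => ?_⟩)).symm
    · have h' : S (pt μ) = S (pt ν) := (hjoin _ _).1 (Quotient.exact h)
      rw [(hpt μ).2, (hpt ν).2] at h'
      exact Subtype.ext (Name.signature_injective h')
    · obtain ⟨p, rfl⟩ := Quotient.exists_rep z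
      obtain ⟨ν, hν, hpν⟩ := hcover p p.2
      exact ⟨⟨ν, hν⟩, Quotient.sound ((hjoin _ _).2 ((hpt ⟨ν, hν⟩).2.trans hpν.symm))⟩

/-- A selection of points of `E` on a branch that is unique gives a continuous graph. -/
theorem IsContinuousGraph.of_unique {Y X : Type*} [TopologicalSpace Y] [TopologicalSpace X]
    {P : Set (Y × X)} {R : Set Y} (ξ : Y → X) (hξ : ContinuousOn ξ R)
    (hmem : ∀ y ∈ R, (y, ξ y) ∈ P) (huniq : ∀ p ∈ P, p.1 ∈ R ∧ p.2 = ξ p.1) :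
    IsContinuousGraph P R := by
  refine ⟨ξ, hξ, ?_⟩
  ext p
  constructor
  · intro hp
    exact ⟨p.1, (huniq p hp).1, Prod.ext rfl (huniq p hp).2.symm⟩
  · rintro ⟨y, hy, rfl⟩
    exact hmem y hy

/-- `ξ` is, on `R`, the only point of the branch `ε` of `E`, and it depends continuously on the
base point. -/
structure IsBranchSection {Y X : Type*} [TopologicalSpace Y] [TopologicalSpace X]
    (E : Set (Y × X)) (φ : Y × X → ℝ) (ε : ℝ) (R : Set Y) (ξ : Y → X) : Prop where
  continuousOn : ContinuousOn ξ R
  mem : ∀ y ∈ R, (y, ξ y) ∈ E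
  branch : ∀ y ∈ R, 0 ≤ ε * φ (y, ξ y)
  eq : ∀ y ∈ R, ∀ x, (y, x) ∈ E → 0 ≤ ε * φ (y, x) → x = ξ y

theorem IsBranchSection.isContinuousGraph {Y X : Type*} [TopologicalSpace Y] [TopologicalSpace X]
    {E : Set (Y × X)} {φ : Y × X → ℝ} {ε : ℝ} {R : Set Y} {ξ : Y → X}
    (h : IsBranchSection E φ ε R ξ) : IsContinuousGraph (branchOver E φ ε R) R :=
  .of_unique ξ h.continuousOn (fun y hy => ⟨h.mem y hy, hy, h.branch y hy⟩)
    fun p hp => ⟨hp.2.1, h.eq p.1 hp.2.1 p.2 hp.1 hp.2.2⟩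

/-- The halves φ ≤ 0 and φ ≥ 0 cover `E` and overlap where φ = 0, so it suffices that on each closed
half the regions detect the signature. -/
theorem TwoBranchClassification.of_levelSets {Y X : Type*} [TopologicalSpace Y]
    [TopologicalSpace X] {E : Set (Y × X)} {S : Y × X → Signature} {φ : Y × X → ℝ}
    {Rm Rp : Name → Set Y} {names : Set Name} {k : ℕ}
    (hS : ContinuousOn S E)
    (hcover : ∀ p ∈ E, ∃ ν ∈ names, S p = ν.signature)
    (hconn : ∀ ν ∈ names, IsPathConnected {p | p ∈ E ∧ S p = ν.signature})
    (hk : names.ncard = k)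
    (hm : ∀ p ∈ E, φ p ≤ 0 → ∀ ν ∈ names, p.1 ∈ Rm ν ↔ S p = ν.signature)
    (hp : ∀ p ∈ E, 0 ≤ φ p → ∀ ν ∈ names, p.1 ∈ Rp ν ↔ S p = ν.signature)
    (hgm : ∀ ν ∈ names, ∃ ξ, IsBranchSection E φ (-1) (Rm ν) ξ)
    (hgp : ∀ ν ∈ names, ∃ ξ, IsBranchSection E φ 1 (Rp ν) ξ) :
    TwoBranchClassification E S φ Rm Rp names k := by
  refine ⟨.of_levelSets hS (fun ν hν => ?_) hcover hconn hk, fun ν hν =>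
    ⟨(hgm ν hν).elim fun _ h => h.isContinuousGraph,
      (hgp ν hν).elim fun _ h => h.isContinuousGraph⟩⟩
  ext p
  constructor
  · rintro (⟨hE, hR, hb⟩ | ⟨hE, hR, hb⟩)
    · exact ⟨hE, (hm p hE (by linarith) ν hν).1 hR⟩
    · exact ⟨hE, (hp p hE (by linarith) ν hν).1 hR⟩
  · rintro ⟨hE, hs⟩
    rcases le_total (φ p) 0 with h | h
    · exact .inl ⟨hE, (hm p hE h ν hν).2 hs, by linarith⟩
    · exact .inr ⟨hE, (hp p hE h ν hν).2 hs, by linarith⟩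

theorem OneBranchClassification.of_levelSets {Y X : Type*} [TopologicalSpace Y]
    [TopologicalSpace X] {E : Set (Y × X)} {S : Y × X → Signature}
    {R : Name → Set Y} {names : Set Name} {k : ℕ}
    (hS : ContinuousOn S E)
    (hcover : ∀ p ∈ E, ∃ ν ∈ names, S p = ν.signature)
    (hconn : ∀ ν ∈ names, IsPathConnected (R ν))
    (hk : names.ncard = k)
    (hR : ∀ p ∈ E, ∀ ν ∈ names, p.1 ∈ R ν ↔ S p = ν.signature)
    (ξ : Y → X) (hξ : ∀ ν ∈ names, ContinuousOn ξ (R ν))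
    (hmem : ∀ ν ∈ names, ∀ y ∈ R ν, (y, ξ y) ∈ E)
    (heq : ∀ p ∈ E, p.2 = ξ p.1) :
    OneBranchClassification E S R names k := by
  have hlevel : ∀ ν ∈ names, partOver E (R ν) = {p | p ∈ E ∧ S p = ν.signature} := by
    intro ν hν
    ext p
    exact and_congr_right fun hp => hR p hp ν hν
  have hgraph : ∀ ν ∈ names, partOver E (R ν) = (fun y => (y, ξ y)) '' R ν := by
    intro ν hν
    ext p
    constructor
    · rintro ⟨hE, hy⟩
      exact ⟨p.1, hy, Prod.ext rfl (heq p hE).symm⟩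
    · rintro ⟨y, hy, rfl⟩
      exact ⟨hmem ν hν y hy, hy⟩
  refine ⟨.of_levelSets hS hlevel hcover (fun ν hν => ?_) hk, fun ν hν =>
    ⟨ξ, hξ ν hν, hgraph ν hν⟩⟩
  rw [← hlevel ν hν, hgraph ν hν]
  exact (hconn ν hν).image' (continuousOn_id.prodMk (hξ ν hν))

/-- A set whose fibres over a path-connected base are intervals is path connected, if it contains
the graph of a continuous function on the base. -/
theorem isPathConnected_of_section {X : Type*} [TopologicalSpace X] {B : Set X}
    (hB : IsPathConnected B) {K : Set (X × ℝ)} {s : X → ℝ} (hs : ContinuousOn s B)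
    (hbase : ∀ p ∈ K, p.1 ∈ B) (hsec : ∀ x ∈ B, (x, s x) ∈ K)
    (hord : ∀ x u v t, (x, u) ∈ K → (x, v) ∈ K → u ≤ t → t ≤ v → (x, t) ∈ K) :
    IsPathConnected K := by
  obtain ⟨x₀, hx₀, hx⟩ := hB
  refine ⟨(x₀, s x₀), hsec x₀ hx₀, fun {p} hp => ?_⟩
  have h₁ : JoinedIn K (x₀, s x₀) (p.1, s p.1) :=
    (IsPathConnected.image' ⟨x₀, hx₀, hx⟩ (continuousOn_id.prodMk hs)).joinedIn
      _ ⟨x₀, hx₀, rfl⟩ _ ⟨p.1, hbase p hp, rfl⟩ |>.mono (by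
        rintro _ ⟨x, hx, rfl⟩
        exact hsec x hx)
  -- Vertical motion inside the interval fibre brings any point to the section; the section itself
  -- was handled by `h₁`.
  have h₂ : JoinedIn K p (p.1, s p.1) := by
    have hconv : Convex ℝ {t | (p.1, t) ∈ K} :=
      (Set.ordConnected_def.2 fun u hu v hv t ht => hord _ u v t hu hv ht.1 ht.2).convex
    have := (hconv.isPathConnected ⟨p.2, hp⟩).image' (f := fun t => (p.1, t)) (by fun_prop)
    refine (this.joinedIn p ⟨p.2, hp, rfl⟩ _ ⟨s p.1, hsec _ (hbase p hp), rfl⟩).mono ?_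
    rintro _ ⟨t, ht, rfl⟩
    exact ht
  exact h₁.trans h₂.symm

/-! ## Roots of quadratic polynomials -/

/-- The root of `A x ^ 2 + B x + C` at which the derivative has the sign `ε`. -/
def quadRoot (ε A B C : ℝ) : ℝ :=
  if A = 0 then -C / B else (-B + ε * √(B ^ 2 - 4 * A * C)) / (2 * A)

theorem quadRoot_isRoot {ε A B C : ℝ} (hε : ε ^ 2 = 1) (hΔ : 0 ≤ B ^ 2 - 4 * A * C)
    (h0 : A = 0 → B ≠ 0) :
    A * quadRoot ε A B C ^ 2 + B * quadRoot ε A B C + C = 0 := by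
  unfold quadRoot
  have hs := Real.sq_sqrt hΔ
  split_ifs with hA
  · have := h0 hA
    subst hA
    field_simp
    ring
  · generalize √(B ^ 2 - 4 * A * C) = s at hs
    field_simp
    linear_combination s ^ 2 * hε + hs

theorem quadRoot_branch {ε A B C : ℝ} (hε : ε ^ 2 = 1) (h0 : A = 0 → 0 ≤ ε * B) :
    0 ≤ ε * (2 * A * quadRoot ε A B C + B) := by
  unfold quadRoot
  split_ifs with hA
  · simpa [hA] using h0 hA
  · have hs := Real.sqrt_nonneg (B ^ 2 - 4 * A * C)
    generalize √(B ^ 2 - 4 * A * C) = s at hs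
    have : ε * (2 * A * ((-B + ε * s) / (2 * A)) + B) = ε ^ 2 * s := by
      field_simp
      ring
    rw [this, hε, one_mul]
    exact hs

/-- At a root the square of the derivative is the discriminant; the branch condition selects the
sign of the square root. -/
theorem derivative_eq_of_branch {ε A B C x : ℝ} (hε : ε ^ 2 = 1)
    (hx : A * x ^ 2 + B * x + C = 0) (hb : 0 ≤ ε * (2 * A * x + B)) :
    2 * A * x + B = ε * √(B ^ 2 - 4 * A * C) := by
  have h : B ^ 2 - 4 * A * C = (ε * (2 * A * x + B)) ^ 2 := by
    rw [mul_pow, hε]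
    linear_combination -4 * A * hx
  rw [h, Real.sqrt_sq hb]
  linear_combination -(2 * A * x + B) * hε

theorem eq_quadRoot {ε A B C x : ℝ} (hε : ε ^ 2 = 1)
    (hx : A * x ^ 2 + B * x + C = 0) (hb : 0 ≤ ε * (2 * A * x + B)) (h0 : A = 0 → B ≠ 0) :
    x = quadRoot ε A B C := by
  have h := derivative_eq_of_branch hε hx hb
  unfold quadRoot
  split_ifs with hA
  · have := h0 hA
    subst hA
    field_simp
    linarith
  · field_simp
    linarith

/-- As A tends to 0 one root escapes to infinity. The condition εB > 0 at A = 0 says that the chosen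
branch is the one that stays finite. -/
theorem continuousOn_quadRoot {Y : Type*} [TopologicalSpace Y] {R : Set Y} {ε : ℝ}
    {A B C : Y → ℝ} (hε : ε ^ 2 = 1) (hA : ContinuousOn A R) (hB : ContinuousOn B R)
    (hC : ContinuousOn C R) (hΔ : ∀ y ∈ R, 0 ≤ B y ^ 2 - 4 * A y * C y)
    (h0 : ∀ y ∈ R, A y = 0 → 0 < ε * B y) :
    ContinuousOn (fun y => quadRoot ε (A y) (B y) (C y)) R := by
  have hs : ContinuousOn (fun y => √(B y ^ 2 - 4 * A y * C y)) R :=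
    ((hB.pow 2).sub ((continuousOn_const.mul hA).mul hC)).sqrt
  have hB0 : ∀ y ∈ R, A y = 0 → B y ≠ 0 := fun y hy h hb => by
    have := h0 y hy h
    simp [hb] at this
  intro y hy
  by_cases hAy : A y = 0
  -- The rationalized formula for the root has no A in its denominator, so it is continuous across A
  -- = 0. At A = 0 its denominator is B + ε|B|, nonzero because εB > 0.
  · have hd : ∀ z ∈ R, B z + ε * √(B z ^ 2 - 4 * A z * C z) ≠ 0 →
        quadRoot ε (A z) (B z) (C z) =
          -2 * C z / (B z + ε * √(B z ^ 2 - 4 * A z * C z)) := by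
      intro z hz hne
      have h₁ := quadRoot_isRoot hε (hΔ z hz) (hB0 z hz)
      have h₂ := derivative_eq_of_branch hε h₁
        (quadRoot_branch hε fun h => (h0 z hz h).le)
      rw [eq_div_iff hne]
      linear_combination 2 * h₁ - quadRoot ε (A z) (B z) (C z) * h₂
    have hne : B y + ε * √(B y ^ 2 - 4 * A y * C y) ≠ 0 := by
      have := h0 y hy hAy
      rw [hAy]
      simp only [mul_zero, zero_mul, sub_zero, Real.sqrt_sq_eq_abs]
      intro h
      have h' : ε * B y + |B y| = 0 := by linear_combination ε * h - |B y| * hε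
      have := abs_nonneg (B y)
      linarith
    have hden := (hB.add (continuousOn_const (c := ε) |>.mul hs))
    have hev : ∀ᶠ z in 𝓝[R] y, B z + ε * √(B z ^ 2 - 4 * A z * C z) ≠ 0 :=
      (hden y hy).eventually_ne hne
    refine (((continuousOn_const (c := (-2 : ℝ))).mul hC y hy).div (hden y hy)
      hne).congr_of_eventuallyEq
      ?_ (hd y hy hne)
    filter_upwards [hev, self_mem_nhdsWithin] with z hz hzR
    exact hd z hzR hz
  · have hev : ∀ᶠ z in 𝓝[R] y, A z ≠ 0 := (hA y hy).eventually_ne hAy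
    have hnum := (hB.neg.add (continuousOn_const (c := ε) |>.mul hs)) y hy
    have hden := (continuousOn_const (c := (2 : ℝ)) |>.mul hA) y hy
    refine (hnum.div hden (by simpa using hAy)).congr_of_eventuallyEq ?_ (by simp [quadRoot, hAy])
    filter_upwards [hev] with z hz
    simp [quadRoot, hz]

/-! ## Signatures in terms of the flatness polynomials -/

/-- Over a common denominator c₂ is Q₂ times a factor with the sign of Ω₁; one more Ω₁ in numerator
and denominator makes the denominator 2 Ω₁² d₁ d₂, of constant sign. Nonflatness then means that no
sign is zero. -/
theorem signature_eq_of_neg {d₁ d₂ v Ω₁ Ω₂ : ℝ} (h₁ : d₁ < 0) (h₂ : 0 < d₂)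
    (hΩ₁ : Ω₁ ≠ 0) :
    signature d₁ d₂ v Ω₁ Ω₂ = ((SignType.sign Ω₁, SignType.sign Ω₂),
      (SignType.sign (1 - Ω₁), -SignType.sign (Ω₁ * (Ω₁ * (d₁ - d₂) + d₂ - Ω₂ * Ω₁ * d₁)),
        -SignType.sign ((1 - Ω₂) / (2 * Ω₂ * d₂) + v / 2))) := by
  have e₁ : (1 - Ω₁) / (2 * d₁) = (1 - Ω₁) * (1 / (2 * d₁)) := by ring
  have e₂ : (1 - Ω₁) / (2 * Ω₁ * d₁) + (1 - Ω₂) / (2 * d₂) =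
      Ω₁ * (Ω₁ * (d₁ - d₂) + d₂ - Ω₂ * Ω₁ * d₁) * (1 / (2 * Ω₁ ^ 2 * d₁ * d₂)) := by
    have := h₁.ne
    field_simp
    ring
  have s₁ : SignType.sign (1 / (2 * d₁)) = -1 :=
    sign_neg (one_div_neg.2 (by linarith))
  have s₂ : SignType.sign (1 / (2 * Ω₁ ^ 2 * d₁ * d₂)) = -1 := by
    refine sign_neg (one_div_neg.2 ?_)
    have : 0 < Ω₁ ^ 2 := by positivity
    nlinarith [mul_pos this h₂]
  unfold signature
  simp only [e₁, e₂, sign_mul _ (1 / (2 * d₁)), sign_mul _ (1 / (2 * Ω₁ ^ 2 * d₁ * d₂)), s₁, s₂,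
    mul_neg, mul_one, neg_neg]

theorem signature_focal {d₁ d₂ d₃ Ω₁ Ω₂ : ℝ} (h₁ : d₁ < 0) (h₂ : 0 < d₂) (h₃ : d₃ < 0)
    (hΩ₁ : Ω₁ ≠ 0) (hΩ₂ : Ω₂ ≠ 0) :
    signature d₁ d₂ (1 / d₃) Ω₁ Ω₂ = ((SignType.sign Ω₁, SignType.sign Ω₂),
      (SignType.sign (1 - Ω₁), -SignType.sign (Ω₁ * (Ω₁ * (d₁ - d₂) + d₂ - Ω₂ * Ω₁ * d₁)),
        SignType.sign (Ω₂ * ((1 - Ω₂) * d₃ + Ω₂ * d₂)))) := by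
  rw [signature_eq_of_neg h₁ h₂ hΩ₁]
  have e : (1 - Ω₂) / (2 * Ω₂ * d₂) + 1 / d₃ / 2 =
      Ω₂ * ((1 - Ω₂) * d₃ + Ω₂ * d₂) * (1 / (2 * Ω₂ ^ 2 * d₂ * d₃)) := by
    have := h₃.ne
    field_simp
  have s : SignType.sign (1 / (2 * Ω₂ ^ 2 * d₂ * d₃)) = -1 := by
    refine sign_neg (one_div_neg.2 ?_)
    have : 0 < Ω₂ ^ 2 := by positivity
    nlinarith [mul_pos this h₂]
  rw [e, sign_mul _ (1 / (2 * Ω₂ ^ 2 * d₂ * d₃)), s, mul_neg, mul_one, neg_neg]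

theorem signature_afocal {d₁ d₂ Ω₁ Ω₂ : ℝ} (h₁ : d₁ < 0) (h₂ : 0 < d₂)
    (hΩ₁ : Ω₁ ≠ 0) (hΩ₂ : Ω₂ ≠ 0) :
    signature d₁ d₂ 0 Ω₁ Ω₂ = ((SignType.sign Ω₁, SignType.sign Ω₂),
      (SignType.sign (1 - Ω₁), -SignType.sign (Ω₁ * (Ω₁ * (d₁ - d₂) + d₂ - Ω₂ * Ω₁ * d₁)),
        SignType.sign (Ω₂ * (Ω₂ - 1)))) := by
  rw [signature_eq_of_neg h₁ h₂ hΩ₁]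
  have e : (1 - Ω₂) / (2 * Ω₂ * d₂) + 0 / 2 =
      -(Ω₂ * (Ω₂ - 1) * (1 / (2 * Ω₂ ^ 2 * d₂))) := by
    field_simp
    ring
  have s : SignType.sign (1 / (2 * Ω₂ ^ 2 * d₂)) = 1 := sign_pos (by positivity)
  rw [e, Left.sign_neg, sign_mul _ (1 / (2 * Ω₂ ^ 2 * d₂)), s, mul_one, neg_neg]

theorem continuousOn_signs {Z : Type*} [TopologicalSpace Z] {E : Set Z}
    {f₁ f₂ f₃ f₄ f₅ : Z → ℝ} (h₁ : Continuous f₁) (h₂ : Continuous f₂) (h₃ : Continuous f₃)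
    (h₄ : Continuous f₄) (h₅ : Continuous f₅)
    (h : ∀ z ∈ E, f₁ z ≠ 0 ∧ f₂ z ≠ 0 ∧ f₃ z ≠ 0 ∧ f₄ z ≠ 0 ∧ f₅ z ≠ 0) :
    ContinuousOn (fun z => (((SignType.sign (f₁ z), SignType.sign (f₂ z)),
      (SignType.sign (f₃ z), -SignType.sign (f₄ z), SignType.sign (f₅ z))) : Signature)) E := by
  have key : ∀ f : Z → ℝ, Continuous f → (∀ z ∈ E, f z ≠ 0) →
      ContinuousOn (fun z => SignType.sign (f z)) E := fun f hf hne z hz =>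
    ((continuousAt_sign_of_ne_zero (hne z hz)).comp hf.continuousAt).continuousWithinAt
  have k₄ : ContinuousOn (fun z => -SignType.sign (f₄ z)) E :=
    (continuous_of_discreteTopology (f := fun s : SignType => -s)).comp_continuousOn
      (key f₄ h₄ fun z hz => (h z hz).2.2.2.1)
  exact ((key f₁ h₁ fun z hz => (h z hz).1).prodMk (key f₂ h₂ fun z hz => (h z hz).2.1)).prodMk
    ((key f₃ h₃ fun z hz => (h z hz).2.2.1).prodMk
      (k₄.prodMk (key f₅ h₅ fun z hz => (h z hz).2.2.2.2)))

/-! ## Position of a root of a concave quadratic polynomial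

The polynomial is `t ↦ -A (t - x) ^ 2 + φ (t - x)`, with the root `x` and the slope `φ` there. -/

section Concave

variable {A φ x t : ℝ}

theorem neg_of_slope_nonpos (hA : 0 < A) (hφ : φ ≤ 0) (h : x < t) :
    -A * (t - x) ^ 2 + φ * (t - x) < 0 := by
  have h' := sub_pos.2 h
  have := mul_pos hA (pow_pos h' 2)
  have := mul_nonneg (neg_nonneg.2 hφ) h'.le
  linarith

theorem neg_of_slope_nonneg (hA : 0 < A) (hφ : 0 ≤ φ) (h : t < x) :
    -A * (t - x) ^ 2 + φ * (t - x) < 0 := by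
  have := neg_of_slope_nonpos (t := -t) hA (neg_nonpos.2 hφ) (neg_lt_neg h)
  linarith

/-- A concave quadratic is positive only strictly between its roots, and φ ≤ 0 makes `x` the larger
one. -/
theorem lt_root_of_pos (hA : 0 < A) (hφ : φ ≤ 0) (h : 0 < -A * (t - x) ^ 2 + φ * (t - x)) :
    t < x := by
  rcases lt_trichotomy t x with h' | h' | h'
  · exact h'
  · simp [h'] at h
  · exact absurd h (neg_of_slope_nonpos hA hφ h').not_gt

theorem root_lt_of_pos (hA : 0 < A) (hφ : 0 ≤ φ) (h : 0 < -A * (t - x) ^ 2 + φ * (t - x)) :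
    x < t := by
  have := lt_root_of_pos (t := -t) (x := -x) hA (neg_nonpos.2 hφ) (by linarith)
  linarith

/-- The value at `t` is t - x times the mean of the slopes at `x` and at `t`. With both slopes
nonpositive, a negative value forces t > x. -/
theorem root_lt_of_neg (hφ : φ ≤ 0) (hd : φ - 2 * A * (t - x) ≤ 0)
    (h : -A * (t - x) ^ 2 + φ * (t - x) < 0) : x < t := by
  by_contra! h'
  nlinarith [mul_nonneg (sub_nonneg.2 h') (neg_nonneg.2 hφ),
    mul_nonneg (sub_nonneg.2 h') (neg_nonneg.2 hd)]

theorem lt_root_of_neg (hφ : 0 ≤ φ) (hd : 0 ≤ φ - 2 * A * (t - x))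
    (h : -A * (t - x) ^ 2 + φ * (t - x) < 0) : t < x := by
  have := root_lt_of_neg (t := -t) (x := -x) (A := A) (neg_nonpos.2 hφ) (by linarith)
    (by linarith)
  linarith

/-- The slope decreases strictly, so a point with positive slope lies to the left of one with
nonpositive slope. -/
theorem lt_root_of_slope_pos (hA : 0 < A) (hφ : φ ≤ 0) (hd : 0 < φ - 2 * A * (t - x)) :
    t < x := by
  by_contra! h'
  linarith [mul_nonneg hA.le (sub_nonneg.2 h'), hφ]

theorem root_lt_of_slope_neg (hA : 0 < A) (hφ : 0 ≤ φ) (hd : φ - 2 * A * (t - x) < 0) :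
    x < t := by
  by_contra! h'
  linarith [mul_nonneg hA.le (sub_nonneg.2 h'), hφ]

theorem pos_of_lt_root (hA : 0 < A) (hd : φ - 2 * A * (t - x) ≤ 0) (h : t < x) :
    0 < -A * (t - x) ^ 2 + φ * (t - x) := by
  have h' := sub_pos.2 h
  have := mul_pos hA h'
  nlinarith

theorem pos_of_root_lt (hA : 0 < A) (hd : 0 ≤ φ - 2 * A * (t - x)) (h : x < t) :
    0 < -A * (t - x) ^ 2 + φ * (t - x) := by
  have := pos_of_lt_root (t := -t) (x := -x) (φ := -φ) hA (by linarith) (by linarith)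
  linarith

end Concave

namespace Focal₂

/-! ## The pivot polynomial for `f = 1`, with `d₁ = -a`, `d₂ = b`, `d₃ = -c` -/

section Pivot

/-- The root of the second flatness polynomial on the locus `Ω₁ Ω₂ = c`. -/
def flat₂ (a b c : ℝ) : ℝ := (b + a * c) / (a + b)

/-- Derivative at x of the pivot polynomial, whose leading coefficient is -(a + bc). Thus
nonpositive slope means the larger root. -/
def slope (a b c x : ℝ) : ℝ := a * b + 2 * a * c + 2 * b * c - 2 * (a + b * c) * x

variable {a b c x : ℝ}

/-- The left side is the pivot polynomial at 1, expanded around its root x. Its values at the three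
flatness roots are negative multiples of q₁, q₂, q₃: this is where the surfaces bounding the regions
come from. -/
theorem pivot_one (hP : a * (b * x - (x - c) ^ 2) = b * c * (x - 1) ^ 2) :
    -(a + b * c) * (1 - x) ^ 2 + slope a b c x * (1 - x) = -a * ((1 - c) ^ 2 - b) := by
  unfold slope
  linear_combination -hP

theorem pivot_flat₂ (ha : 0 < a) (hb : 0 < b)
    (hP : a * (b * x - (x - c) ^ 2) = b * c * (x - 1) ^ 2) :
    -(a + b * c) * (flat₂ a b c - x) ^ 2 + slope a b c x * (flat₂ a b c - x) =
      -(a * b * (b + a * c) / (a + b) ^ 2) * ((1 - c) ^ 2 - a - b) := by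
  have : a + b ≠ 0 := by positivity
  unfold slope flat₂
  field_simp
  linear_combination -(a + b) ^ 2 * hP

theorem pivot_flat₃ (hP : a * (b * x - (x - c) ^ 2) = b * c * (x - 1) ^ 2) :
    -(a + b * c) * (b + c - x) ^ 2 + slope a b c x * (b + c - x) =
      -(b * c) * ((1 - b - c) ^ 2 - a) := by
  unfold slope
  linear_combination -hP

/-- The sign of the slope at a flatness root tells on which side of the vertex that flatness root
lies, which the value alone does not. -/
theorem slope_one : slope a b c x - 2 * (a + b * c) * (1 - x) = a * (b - 2 * (1 - c)) := by
  unfold slope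
  ring

theorem slope_flat₂ (ha : 0 < a) (hb : 0 < b) :
    slope a b c x - 2 * (a + b * c) * (flat₂ a b c - x) =
      a * b / (a + b) * (a + b - 2 * (1 - c) ^ 2) := by
  have : a + b ≠ 0 := by positivity
  unfold slope flat₂
  field_simp
  ring

theorem slope_flat₃ : slope a b c x - 2 * (a + b * c) * (b + c - x) =
    -b * (a + 2 * c * (b + c - 1)) := by
  unfold slope
  ring

/-- `flat₂` is the mean of 1 and c with weights b and a. -/
theorem flat₂_le_one (ha : 0 < a) (hb : 0 < b) (hc : c ≤ 1) : flat₂ a b c ≤ 1 := by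
  unfold flat₂
  rw [div_le_one (by positivity)]
  nlinarith

theorem one_le_flat₂ (ha : 0 < a) (hb : 0 < b) (hc : 1 ≤ c) : 1 ≤ flat₂ a b c := by
  unfold flat₂
  rw [one_le_div (by positivity)]
  nlinarith

/-- After multiplication by a + b the difference is b (a + b + c - 1). -/
theorem flat₂_le_flat₃ (ha : 0 < a) (hb : 0 < b) (h : 1 ≤ a + b + c) :
    flat₂ a b c ≤ b + c := by
  unfold flat₂
  rw [div_le_iff₀ (by positivity)]
  nlinarith

theorem flat₃_le_flat₂ (ha : 0 < a) (hb : 0 < b) (h : a + b + c ≤ 1) :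
    b + c ≤ flat₂ a b c := by
  unfold flat₂
  rw [le_div_iff₀ (by positivity)]
  nlinarith

theorem flat₂_coeff_pos (ha : 0 < a) (hb : 0 < b) (hc : 0 < c) :
    0 < a * b * (b + a * c) / (a + b) ^ 2 := by positivity

/-- `x` is a positive root of the pivot polynomial over `(-a, b, -c)`. -/
structure PosRoot (a b c x : ℝ) : Prop where
  a_pos : 0 < a
  b_pos : 0 < b
  c_pos : 0 < c
  x_pos : 0 < x
  eq : a * (b * x - (x - c) ^ 2) = b * c * (x - 1) ^ 2

namespace PosRoot

theorem lead (h : PosRoot a b c x) : 0 < a + b * c := by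
  have := mul_pos h.b_pos h.c_pos
  linarith [h.a_pos]

/-! ### The larger root -/

theorem one_lt_of_q₁ (h : PosRoot a b c x) (hφ : slope a b c x ≤ 0) (hq : (1 - c) ^ 2 < b) :
    1 < x := by
  refine lt_root_of_pos h.lead hφ ?_
  rw [pivot_one h.eq]
  nlinarith [h.a_pos]

theorem flat₂_lt_of_q₂ (h : PosRoot a b c x) (hφ : slope a b c x ≤ 0)
    (hq : (1 - c) ^ 2 < a + b) : flat₂ a b c < x := by
  refine lt_root_of_pos h.lead hφ ?_
  rw [pivot_flat₂ h.a_pos h.b_pos h.eq]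
  nlinarith [flat₂_coeff_pos h.a_pos h.b_pos h.c_pos]

theorem flat₃_lt_of_q₃ (h : PosRoot a b c x) (hφ : slope a b c x ≤ 0)
    (hq : (1 - b - c) ^ 2 < a) : b + c < x := by
  refine lt_root_of_pos h.lead hφ ?_
  rw [pivot_flat₃ h.eq]
  nlinarith [mul_pos h.b_pos h.c_pos]

theorem lt_one_of_q₁ (h : PosRoot a b c x) (hφ : slope a b c x ≤ 0) (hq : b < (1 - c) ^ 2)
    (hs : b ≤ 2 * (1 - c)) : x < 1 := by
  refine root_lt_of_neg (A := a + b * c) hφ ?_ ?_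
  · rw [slope_one]
    nlinarith [h.a_pos]
  · rw [pivot_one h.eq]
    nlinarith [h.a_pos]

theorem lt_flat₂_of_q₂ (h : PosRoot a b c x) (hφ : slope a b c x ≤ 0)
    (hq : a + b < (1 - c) ^ 2) : x < flat₂ a b c := by
  refine root_lt_of_neg (A := a + b * c) hφ ?_ ?_
  · rw [slope_flat₂ h.a_pos h.b_pos]
    have : 0 < a * b / (a + b) := by have := h.a_pos; have := h.b_pos; positivity
    nlinarith [sq_nonneg (1 - c)]
  · rw [pivot_flat₂ h.a_pos h.b_pos h.eq]
    nlinarith [flat₂_coeff_pos h.a_pos h.b_pos h.c_pos]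

theorem lt_flat₃_of_q₃ (h : PosRoot a b c x) (hφ : slope a b c x ≤ 0)
    (hq : a < (1 - b - c) ^ 2) (hs : 2 * c * (1 - c - b) ≤ a) : x < b + c := by
  refine root_lt_of_neg (A := a + b * c) hφ ?_ ?_
  · rw [slope_flat₃]
    nlinarith [h.b_pos]
  · rw [pivot_flat₃ h.eq]
    nlinarith [mul_pos h.b_pos h.c_pos]

theorem one_lt_of_slope (h : PosRoot a b c x) (hφ : slope a b c x ≤ 0)
    (hs : 2 * (1 - c) < b) : 1 < x := by
  refine lt_root_of_slope_pos h.lead hφ ?_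
  rw [slope_one]
  nlinarith [h.a_pos]

theorem flat₃_lt_of_slope (h : PosRoot a b c x) (hφ : slope a b c x ≤ 0)
    (hs : a < 2 * c * (1 - c - b)) : b + c < x := by
  refine lt_root_of_slope_pos h.lead hφ ?_
  rw [slope_flat₃]
  nlinarith [h.b_pos]

theorem q₂_of_lt_flat₂ (h : PosRoot a b c x) (hφ : slope a b c x ≤ 0)
    (hx : x < flat₂ a b c) : a + b < (1 - c) ^ 2 := by
  have := neg_of_slope_nonpos h.lead hφ hx
  rw [pivot_flat₂ h.a_pos h.b_pos h.eq] at this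
  nlinarith [flat₂_coeff_pos h.a_pos h.b_pos h.c_pos]

theorem q₃_of_lt_flat₃ (h : PosRoot a b c x) (hφ : slope a b c x ≤ 0) (hx : x < b + c) :
    a < (1 - b - c) ^ 2 := by
  have := neg_of_slope_nonpos h.lead hφ hx
  rw [pivot_flat₃ h.eq] at this
  nlinarith [mul_pos h.b_pos h.c_pos]

theorem q₃_of_flat₃_lt (h : PosRoot a b c x) (hx : b + c < x)
    (hs : 2 * c * (1 - c - b) ≤ a) : (1 - b - c) ^ 2 < a := by
  have := pos_of_lt_root h.lead (by rw [slope_flat₃]; nlinarith [h.b_pos]) hx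
  rw [pivot_flat₃ h.eq] at this
  nlinarith [mul_pos h.b_pos h.c_pos]

/-! ### The smaller root -/

theorem lt_one_of_q₁' (h : PosRoot a b c x) (hφ : 0 ≤ slope a b c x) (hq : (1 - c) ^ 2 < b) :
    x < 1 := by
  refine root_lt_of_pos h.lead hφ ?_
  rw [pivot_one h.eq]
  nlinarith [h.a_pos]

theorem lt_flat₃_of_q₃' (h : PosRoot a b c x) (hφ : 0 ≤ slope a b c x)
    (hq : (1 - b - c) ^ 2 < a) : x < b + c := by
  refine root_lt_of_pos h.lead hφ ?_
  rw [pivot_flat₃ h.eq]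
  nlinarith [mul_pos h.b_pos h.c_pos]

/-- The smaller root is always below the second flatness root. -/
theorem lt_flat₂' (h : PosRoot a b c x) (hφ : 0 ≤ slope a b c x) : x < flat₂ a b c := by
  rcases lt_or_ge ((1 - c) ^ 2) (a + b) with hq | hq
  · refine root_lt_of_pos h.lead hφ ?_
    rw [pivot_flat₂ h.a_pos h.b_pos h.eq]
    nlinarith [flat₂_coeff_pos h.a_pos h.b_pos h.c_pos]
  -- Here the value at `flat₂` is not positive, but a + b ≤ (1 - c)² makes the slope there negative,
  -- so `flat₂` lies to the right of the smaller root.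
  · refine root_lt_of_slope_neg h.lead hφ ?_
    rw [slope_flat₂ h.a_pos h.b_pos]
    have : 0 < a * b / (a + b) := by have := h.a_pos; have := h.b_pos; positivity
    have := h.a_pos
    have := h.b_pos
    nlinarith

theorem one_lt_of_q₁' (h : PosRoot a b c x) (hφ : 0 ≤ slope a b c x) (hq : b < (1 - c) ^ 2)
    (hs : 2 * (1 - c) ≤ b) : 1 < x := by
  refine lt_root_of_neg (A := a + b * c) hφ ?_ ?_
  · rw [slope_one]
    nlinarith [h.a_pos]
  · rw [pivot_one h.eq]
    nlinarith [h.a_pos]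

theorem flat₃_lt_of_q₃' (h : PosRoot a b c x) (hφ : 0 ≤ slope a b c x)
    (hq : a < (1 - b - c) ^ 2) (hs : a ≤ 2 * c * (1 - c - b)) : b + c < x := by
  refine lt_root_of_neg (A := a + b * c) hφ ?_ ?_
  · rw [slope_flat₃]
    nlinarith [h.b_pos]
  · rw [pivot_flat₃ h.eq]
    nlinarith [mul_pos h.b_pos h.c_pos]

theorem lt_one_of_slope' (h : PosRoot a b c x) (hφ : 0 ≤ slope a b c x)
    (hs : b < 2 * (1 - c)) : x < 1 := by
  refine root_lt_of_slope_neg h.lead hφ ?_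
  rw [slope_one]
  nlinarith [h.a_pos]

theorem lt_flat₃_of_slope' (h : PosRoot a b c x) (hφ : 0 ≤ slope a b c x)
    (hs : 2 * c * (1 - c - b) < a) : x < b + c := by
  refine root_lt_of_slope_neg h.lead hφ ?_
  rw [slope_flat₃]
  nlinarith [h.b_pos]

theorem q₁_of_lt_one (h : PosRoot a b c x) (hx : x < 1)
    (hs : 2 * (1 - c) ≤ b) : (1 - c) ^ 2 < b := by
  have := pos_of_root_lt h.lead (by rw [slope_one]; nlinarith [h.a_pos]) hx
  rw [pivot_one h.eq] at this
  nlinarith [h.a_pos]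

theorem q₁_of_one_lt' (h : PosRoot a b c x) (hφ : 0 ≤ slope a b c x) (hx : 1 < x) :
    b < (1 - c) ^ 2 := by
  have := neg_of_slope_nonneg h.lead hφ hx
  rw [pivot_one h.eq] at this
  nlinarith [h.a_pos]

theorem q₃_of_flat₃_lt' (h : PosRoot a b c x) (hφ : 0 ≤ slope a b c x) (hx : b + c < x) :
    a < (1 - b - c) ^ 2 := by
  have := neg_of_slope_nonneg h.lead hφ hx
  rw [pivot_flat₃ h.eq] at this
  nlinarith [mul_pos h.b_pos h.c_pos]

theorem q₃_of_lt_flat₃' (h : PosRoot a b c x) (hx : x < b + c)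
    (hs : a ≤ 2 * c * (1 - c - b)) : (1 - b - c) ^ 2 < a := by
  have := pos_of_root_lt h.lead (by rw [slope_flat₃]; nlinarith [h.b_pos]) hx
  rw [pivot_flat₃ h.eq] at this
  nlinarith [mul_pos h.b_pos h.c_pos]

/-! ### Discriminant and slope as functions of the root -/

/-- This is the coefficient of a in the pivot equation. Its positivity allows solving for a, and
multiplying inequalities by it to eliminate a. -/
theorem fibre_pos (h : PosRoot a b c x) (hx : x ≠ 1) : 0 < b * x - (x - c) ^ 2 := by
  have : 0 < b * c * (x - 1) ^ 2 :=
    mul_pos (mul_pos h.b_pos h.c_pos) (pow_pos (abs_pos.2 (sub_ne_zero.2 hx)) 2 |>.trans_eq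
      (sq_abs _))
  rw [← h.eq] at this
  exact pos_of_mul_pos_right this h.a_pos.le

/-- The discriminant is the square of the slope at a root; the positive factor ab is divided out. -/
theorem discr_nonneg (h : PosRoot a b c x) :
    0 ≤ a * (b + 4 * c) + 4 * c * (b - (1 - c) ^ 2) := by
  have e : slope a b c x ^ 2 =
      a * b * (a * (b + 4 * c) + 4 * c * (b - (1 - c) ^ 2)) := by
    unfold slope
    linear_combination -4 * (a + b * c) * h.eq
  have := mul_pos h.a_pos h.b_pos
  exact nonneg_of_mul_nonneg_right (e ▸ sq_nonneg _) this

/-- The pivot equation removes a from the product, so the sign of the slope becomes a condition on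
b, c, x alone. The same device serves below for `flat₂`, q₂ and q₃. -/
theorem slope_mul (h : PosRoot a b c x) :
    slope a b c x * (b * x - (x - c) ^ 2) =
      b * c * ((x - 1) * (2 * (x - c) * (1 - c) - b * (x + 1))) := by
  unfold slope
  linear_combination (b + 2 * c - 2 * x) * h.eq

theorem slope_nonpos_iff (h : PosRoot a b c x) (hx : x ≠ 1) : slope a b c x ≤ 0 ↔
    (x - 1) * (2 * (x - c) * (1 - c) - b * (x + 1)) ≤ 0 := by
  have hN := h.fibre_pos hx
  have hbc := mul_pos h.b_pos h.c_pos
  rw [← not_lt, ← not_lt, not_iff_not, ← mul_pos_iff_of_pos_right hN, h.slope_mul,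
    mul_pos_iff_of_pos_left hbc]

theorem slope_nonneg_iff (h : PosRoot a b c x) (hx : x ≠ 1) : 0 ≤ slope a b c x ↔
    0 ≤ (x - 1) * (2 * (x - c) * (1 - c) - b * (x + 1)) := by
  have hN := h.fibre_pos hx
  have hbc := mul_pos h.b_pos h.c_pos
  rw [← mul_nonneg_iff_of_pos_right hN, h.slope_mul, mul_nonneg_iff_of_pos_left hbc]

theorem flat₂_sub_mul (h : PosRoot a b c x) :
    (x * (a + b) - (b + a * c)) * (b * x - (x - c) ^ 2) =
      b * x * ((x - 1) * (b - (x - c) * (1 - c))) := by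
  linear_combination (x - c) * h.eq

theorem flat₂_lt_iff (h : PosRoot a b c x) (hx : x ≠ 1) :
    flat₂ a b c < x ↔ 0 < (x - 1) * (b - (x - c) * (1 - c)) := by
  have hN := h.fibre_pos hx
  have hbx := mul_pos h.b_pos h.x_pos
  have : 0 < a + b := add_pos h.a_pos h.b_pos
  rw [flat₂, div_lt_iff₀ this, ← sub_pos, ← mul_pos_iff_of_pos_right hN, h.flat₂_sub_mul,
    mul_pos_iff_of_pos_left hbx]

theorem lt_flat₂_iff (h : PosRoot a b c x) (hx : x ≠ 1) :
    x < flat₂ a b c ↔ (x - 1) * (b - (x - c) * (1 - c)) < 0 := by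
  have hN := h.fibre_pos hx
  have hbx := mul_pos h.b_pos h.x_pos
  have : 0 < a + b := add_pos h.a_pos h.b_pos
  rw [flat₂, lt_div_iff₀ this, ← sub_neg, ← neg_pos, ← mul_pos_iff_of_pos_right hN, neg_mul,
    h.flat₂_sub_mul, ← mul_neg, mul_pos_iff_of_pos_left hbx, neg_pos]

theorem q₂_mul (h : PosRoot a b c x) :
    ((1 - c) ^ 2 - a - b) * (b * x - (x - c) ^ 2) =
      -((b - (x - c) * (1 - c)) * (b * x - (x - c) * (1 - c))) := by
  linear_combination -h.eq

theorem q₃_mul (h : PosRoot a b c x) :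
    ((1 - b - c) ^ 2 - a) * (b * x - (x - c) ^ 2) =
      (b - (x - c)) * (x * (b - (1 - c)) ^ 2 + c * ((x - c) * b - (1 - c) ^ 2)) := by
  linear_combination -h.eq

end PosRoot

/-- Times b + 4c, the gap is at least 2c (1 - 3c - b)(2(1 - c) - b) when the discriminant is
nonnegative. The factor 1 - 3c - b is the source of the wall d₂ = 1 + 3d₃. -/
theorem two_mul_le_of_discr {a b c : ℝ} (hb : 0 < b) (hc : 0 < c)
    (hΔ : 0 ≤ a * (b + 4 * c) + 4 * c * (b - (1 - c) ^ 2)) (h : b ≤ 1 - 3 * c) :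
    2 * c * (1 - c - b) ≤ a := by
  have h₁ : 0 ≤ (a - 2 * c * (1 - c - b)) * (b + 4 * c) := by
    nlinarith [mul_nonneg hc.le (mul_nonneg (sub_nonneg.2 h) (by linarith : 0 ≤ 2 * (1 - c) - b))]
  nlinarith [nonneg_of_mul_nonneg_left h₁ (by linarith)]

theorem two_mul_lt_of_discr {a b c : ℝ} (hb : 0 < b) (hc : 0 < c)
    (hΔ : 0 ≤ a * (b + 4 * c) + 4 * c * (b - (1 - c) ^ 2)) (h : b < 1 - 3 * c) :
    2 * c * (1 - c - b) < a := by
  have h₁ : 0 < (a - 2 * c * (1 - c - b)) * (b + 4 * c) := by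
    nlinarith [mul_pos hc (mul_pos (sub_pos.2 h) (by linarith : 0 < 2 * (1 - c) - b))]
  nlinarith [pos_of_mul_pos_left h₁ (by linarith)]

end Pivot

end Focal₂

/-! ### Regions of the two branches against the order of the flatness roots, for f = 1 -/

namespace Focal₂

/-- The order relations between a positive root and the three flatness roots that `ν` encodes. -/
def PosOrder (a b c x : ℝ) : Name → Prop
  | .PP010 => 1 < x ∧ flat₂ a b c < x ∧ b + c < x
  | .PP110 => x < 1 ∧ flat₂ a b c < x ∧ b + c < x
  | .PP001 => 1 < x ∧ x < flat₂ a b c ∧ x < b + c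
  | .PP011 => 1 < x ∧ flat₂ a b c < x ∧ x < b + c
  | .PP100 => x < 1 ∧ x < flat₂ a b c ∧ b + c < x
  | .PP101 => x < 1 ∧ x < flat₂ a b c ∧ x < b + c
  | _ => False

namespace PosRoot

variable {a b c x : ℝ}

theorem minus_PP011 (h : PosRoot a b c x) (hφ : slope a b c x ≤ 0) :
    (-a - b + (1 + -c) ^ 2 < 0 ∧ 0 < -a + (1 - b + -c) ^ 2 ∧ 1 + -c < b) ↔
      PosOrder a b c x .PP011 := by
  have ha := h.a_pos
  have hb := h.b_pos
  have hc := h.c_pos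
  constructor
  · rintro ⟨h₂, h₃, h₄⟩
    have o₂ := h.flat₂_lt_of_q₂ hφ (by linarith)
    refine ⟨?_, o₂, h.lt_flat₃_of_q₃ hφ (by linarith) (by nlinarith)⟩
    rcases le_total 1 c with h₁ | h₁
    · exact (one_le_flat₂ ha hb h₁).trans_lt o₂
    · exact h.one_lt_of_q₁ hφ (by nlinarith)
  · rintro ⟨o₁, o₂, o₃⟩
    have hN := h.fibre_pos o₁.ne'
    have k₂ := (h.flat₂_lt_iff o₁.ne').1 o₂
    have k : 0 < b - (x - c) * (1 - c) := pos_of_mul_pos_right k₂ (by linarith)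
    refine ⟨?_, by linarith [h.q₃_of_lt_flat₃ hφ o₃], by linarith⟩
    -- Up to sign these are the two factors of q₂ in `q₂_mul`; the second exceeds the first because
    -- x > 1.
    have := mul_pos k (show 0 < b * x - (x - c) * (1 - c) by nlinarith)
    nlinarith [h.q₂_mul]

theorem minus_PP010 (h : PosRoot a b c x) (hφ : slope a b c x ≤ 0) :
    ((-c ≤ -1 ∧ -a + (1 - b + -c) ^ 2 < 0) ∨
      (-1 ≤ -c ∧ (1 + -c) ^ 2 < b ∧ b < 1 + -c) ∨
      (-1 ≤ -c ∧ 1 + -c ≤ b ∧ -a + (1 - b + -c) ^ 2 < 0)) ↔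
      PosOrder a b c x .PP010 := by
  have ha := h.a_pos
  have hb := h.b_pos
  have hc := h.c_pos
  constructor
  · rintro (⟨h₁, h₃⟩ | ⟨h₁, h₂, h₃⟩ | ⟨h₁, h₂, h₃⟩)
    · have o₃ := h.flat₃_lt_of_q₃ hφ (by linarith)
      exact ⟨by linarith, (flat₂_le_flat₃ ha hb (by linarith)).trans_lt o₃, o₃⟩
    · have o₁ := h.one_lt_of_q₁ hφ (by linarith)
      exact ⟨o₁, (flat₂_le_one ha hb (by linarith)).trans_lt o₁, by linarith⟩
    · have o₃ := h.flat₃_lt_of_q₃ hφ (by linarith)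
      exact ⟨by linarith, (flat₂_le_flat₃ ha hb (by linarith)).trans_lt o₃, o₃⟩
  · rintro ⟨o₁, o₂, o₃⟩
    have hN := h.fibre_pos o₁.ne'
    have k₂ := (h.flat₂_lt_iff o₁.ne').1 o₂
    have k : 0 < b - (x - c) * (1 - c) := pos_of_mul_pos_right k₂ (by linarith)
    -- In the factorization `q₃_mul` the first factor b - (x - c) is negative, so the second decides
    -- the sign of q₃.
    have key : 0 < x * (b - (1 - c)) ^ 2 + c * ((x - c) * b - (1 - c) ^ 2) →
        -a + (1 - b + -c) ^ 2 < 0 := by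
      intro hH
      nlinarith [h.q₃_mul, mul_pos (show 0 < x - c - b by linarith) hH]
    rcases le_total 1 c with h₁ | h₁
    · refine .inl ⟨by linarith, key ?_⟩
      have : (1 - c) ^ 2 ≤ (b - (1 - c)) ^ 2 := by nlinarith
      nlinarith [mul_pos (show 0 < x - c by linarith) hb, h.x_pos,
        mul_nonneg (show 0 ≤ x - c by linarith) (sq_nonneg (1 - c)),
        mul_le_mul_of_nonneg_left this h.x_pos.le,
          mul_pos hc (mul_pos (show 0 < x - c by linarith) hb)]
    · rcases lt_or_ge b (1 - c) with h₂ | h₂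
      · refine .inr (.inl ⟨by linarith, ?_, by linarith⟩)
        nlinarith
      · refine .inr (.inr ⟨by linarith, by linarith, key ?_⟩)
        have : (1 - c) ^ 2 ≤ b * b := by nlinarith
        have : b * b < (x - c) * b := by nlinarith
        have := mul_pos hc (show 0 < (x - c) * b - (1 - c) ^ 2 by linarith)
        have := mul_nonneg h.x_pos.le (sq_nonneg (b - (1 - c)))
        linarith

theorem minus_PP110 (h : PosRoot a b c x) (hφ : slope a b c x ≤ 0) :
    (-1 ≤ -c ∧ 0 < -b + (1 + -c) ^ 2 ∧ -a - b + (1 + -c) ^ 2 < 0) ↔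
      PosOrder a b c x .PP110 := by
  have ha := h.a_pos
  have hb := h.b_pos
  have hc := h.c_pos
  constructor
  · rintro ⟨h₁, h₂, h₃⟩
    have o₂ := h.flat₂_lt_of_q₂ hφ (by linarith)
    refine ⟨h.lt_one_of_q₁ hφ (by linarith) (by nlinarith), o₂, ?_⟩
    rcases le_total (a + b + c) 1 with h₄ | h₄
    · exact (flat₃_le_flat₂ ha hb h₄).trans_lt o₂
    -- Now 0 < 1 - b - c < 1 and 1 - b - c ≤ a, hence (1 - b - c)² < a.
    · have : 0 < 1 - c := by nlinarith
      have : b < 1 - c := by nlinarith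
      exact h.flat₃_lt_of_q₃ hφ (by nlinarith)
  · rintro ⟨o₁, o₂, o₃⟩
    have hN := h.fibre_pos o₁.ne
    have k₂ := (h.flat₂_lt_iff o₁.ne).1 o₂
    have k : b - (x - c) * (1 - c) < 0 := by nlinarith
    have q₂ := h.q₂_mul
    have := mul_pos_of_neg_of_neg k (show b * x - (x - c) * (1 - c) < 0 by nlinarith)
    refine ⟨by linarith, by nlinarith, by nlinarith⟩

theorem minus_PP101 (h : PosRoot a b c x) (hφ : slope a b c x ≤ 0) :
    (-(1 / 3) ≤ -c ∧ 0 ≤ a * (b + 4 * c) + 4 * c * (b - (1 - c) ^ 2) ∧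
      0 < -a + (1 - b + -c) ^ 2 ∧ -(1 + -c) ^ 2 ≤ -a ∧ -a ≤ -4 * (-c) ^ 2 ∧ b ≤ 1 + 3 * -c) ↔
      PosOrder a b c x .PP101 := by
  have ha := h.a_pos
  have hb := h.b_pos
  have hc := h.c_pos
  have hx := h.x_pos
  constructor
  · rintro ⟨h₁, hΔ, h₃, -, -, h₅⟩
    have o₃ := h.lt_flat₃_of_q₃ hφ (by linarith) (two_mul_le_of_discr hb hc hΔ (by linarith))
    exact ⟨by linarith, o₃.trans_le (flat₃_le_flat₂ ha hb (by nlinarith)), o₃⟩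
  · rintro ⟨o₁, o₂, o₃⟩
    have hN := h.fibre_pos o₁.ne
    have k₂ := (h.lt_flat₂_iff o₁.ne).1 o₂
    have k : 0 < b - (x - c) * (1 - c) := by nlinarith
    have s : b * (x + 1) ≤ 2 * (x - c) * (1 - c) := by
      have := (h.slope_nonpos_iff o₁.ne).1 hφ
      nlinarith
    have hpos : 0 < (x - c) * (1 - c) := by nlinarith
    -- The factors x - c and 1 - c have a common sign. If both were negative, the slope bound `s`
    -- multiplied by x would contradict (x - c)² < b x.
    have hk : 0 < x - c := by
      by_contra! hk
      have e₁ : 1 - c < 0 := by nlinarith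
      nlinarith [mul_le_mul_of_nonneg_left s hx.le, mul_pos_of_neg_of_neg e₁ e₁]
    have e₁ : 0 < 1 - c := by nlinarith
    have k₁ : x - c < 1 - 3 * c := by
      have : (x - c) * (x + 1) < 2 * (x - c) * (1 - c) := by nlinarith
      nlinarith
    have b₁ : b ≤ 1 - 3 * c := by nlinarith
    -- Multiplied by the fibre denominator, a - 4c² becomes c times the expression below. If the
    -- coefficient of b there is negative, the slope bound on b is inserted.
    have a₁ : 4 * c ^ 2 ≤ a := by
      have : 0 ≤ b * ((x - 1) ^ 2 - 4 * c * x) + 4 * c * (x - c) ^ 2 := by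
        rcases le_or_gt 0 ((x - 1) ^ 2 - 4 * c * x) with hT | hT
        · positivity
        · have e₂ : 0 ≤ (1 + c) * ((1 - x) * (1 - 2 * c - x)) :=
            mul_nonneg (by linarith) (mul_nonneg (by linarith) (by linarith))
          have e₃ := mul_nonneg hk.le e₂
          have e₄ := mul_nonneg (sub_nonneg.2 s) (neg_nonneg.2 hT.le)
          have : 0 ≤ (b * ((x - 1) ^ 2 - 4 * c * x) + 4 * c * (x - c) ^ 2) * (x + 1) := by
            linarith
          exact nonneg_of_mul_nonneg_left this (by linarith)
      have e := h.eq
      have : 0 ≤ (a - 4 * c ^ 2) * (b * x - (x - c) ^ 2) := by nlinarith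
      nlinarith [nonneg_of_mul_nonneg_left this hN]
    have := h.q₂_of_lt_flat₂ hφ o₂
    exact ⟨by linarith, h.discr_nonneg, by linarith [h.q₃_of_lt_flat₃ hφ o₃], by nlinarith,
      by linarith, by linarith⟩

theorem minus_PP100 (h : PosRoot a b c x) (hφ : slope a b c x ≤ 0) :
    ((-1 ≤ -c ∧ 0 < -a - b + (1 + -c) ^ 2 ∧ -4 * (-c) ^ 2 < -a ∧
        0 ≤ a * (b + 4 * c) + 4 * c * (b - (1 - c) ^ 2)) ∨
      (-1 ≤ -c ∧ 0 < -a - b + (1 + -c) ^ 2 ∧ -(1 + -c) ^ 2 ≤ -a ∧ -a ≤ -4 * (-c) ^ 2 ∧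
        -a + (1 - b + -c) ^ 2 < 0)) ↔
      PosOrder a b c x .PP100 := by
  have ha := h.a_pos
  have hb := h.b_pos
  have hc := h.c_pos
  constructor
  · rintro (⟨h₁, h₂, h₃, -⟩ | ⟨h₁, h₂, -, -, h₃⟩)
    · refine ⟨h.lt_one_of_q₁ hφ (by linarith) (by nlinarith), h.lt_flat₂_of_q₂ hφ (by linarith),
        ?_⟩
      rcases lt_or_ge ((1 - b - c) ^ 2) a with h₄ | h₄
      · exact h.flat₃_lt_of_q₃ hφ h₄
      -- With u = 1 - c - b, the failure of the slope bound would give 2cu ≤ a ≤ u², so 2c ≤ u and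
      -- 4c² ≤ 2cu ≤ a, against a < 4c².
      · refine h.flat₃_lt_of_slope hφ ?_
        by_contra! h₅
        have : 0 < 1 - c - b := by nlinarith
        have : 2 * c ≤ 1 - c - b := by nlinarith
        nlinarith
    · exact ⟨h.lt_one_of_q₁ hφ (by linarith) (by nlinarith), h.lt_flat₂_of_q₂ hφ (by linarith),
        h.flat₃_lt_of_q₃ hφ (by linarith)⟩
  · rintro ⟨o₁, o₂, o₃⟩
    have q₂ := h.q₂_of_lt_flat₂ hφ o₂
    rcases lt_or_ge a (4 * c ^ 2) with h₁ | h₁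
    · exact .inl ⟨by linarith, by linarith, by linarith, h.discr_nonneg⟩
    · refine .inr ⟨by linarith, by linarith, by linarith, by linarith, ?_⟩
      have := h.q₃_of_flat₃_lt o₃ (by
        rcases le_total b (1 - 3 * c) with h₂ | h₂
        · exact two_mul_le_of_discr hb hc h.discr_nonneg h₂
        · nlinarith)
      linarith

theorem minus_PP001 (h : PosRoot a b c x) (hφ : slope a b c x ≤ 0) :
    (-c ≤ -1 ∧ 0 ≤ a * (b + 4 * c) + 4 * c * (b - (1 - c) ^ 2) ∧
      0 < -a - b + (1 + -c) ^ 2) ↔ PosOrder a b c x .PP001 := by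
  have ha := h.a_pos
  have hb := h.b_pos
  have hc := h.c_pos
  constructor
  · rintro ⟨h₁, -, h₂⟩
    have o₂ := h.lt_flat₂_of_q₂ hφ (by linarith)
    exact ⟨h.one_lt_of_slope hφ (by linarith), o₂,
      o₂.trans_le (flat₂_le_flat₃ ha hb (by linarith))⟩
  · rintro ⟨o₁, o₂, o₃⟩
    have k₂ := (h.lt_flat₂_iff o₁.ne').1 o₂
    have k : b - (x - c) * (1 - c) < 0 := by nlinarith
    refine ⟨?_, h.discr_nonneg, by linarith [h.q₂_of_lt_flat₂ hφ o₂]⟩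
    by_contra! h₁
    nlinarith

theorem plus_PP101 (h : PosRoot a b c x) (hφ : 0 ≤ slope a b c x) :
    ((-c ≤ -1 ∧ 0 ≤ a * (b + 4 * c) + 4 * c * (b - (1 - c) ^ 2) ∧ -b + (1 + -c) ^ 2 < 0) ∨
      (-1 ≤ -c ∧ 0 ≤ a * (b + 4 * c) + 4 * c * (b - (1 - c) ^ 2) ∧ -a + (1 - b + -c) ^ 2 < 0) ∨
      (-(1 / 3) ≤ -c ∧ 0 ≤ a * (b + 4 * c) + 4 * c * (b - (1 - c) ^ 2) ∧ b < 1 + 3 * -c) ∨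
      (-1 ≤ -c ∧ 1 + -c ≤ b)) ↔ PosOrder a b c x .PP101 := by
  have ha := h.a_pos
  have hb := h.b_pos
  have hc := h.c_pos
  have o₂ := h.lt_flat₂' hφ
  constructor
  · rintro (⟨h₁, -, h₂⟩ | ⟨h₁, -, h₂⟩ | ⟨h₁, hΔ, h₂⟩ | ⟨h₁, h₂⟩)
    · have o₁ := h.lt_one_of_q₁' hφ (by linarith)
      exact ⟨o₁, o₂, by linarith⟩
    · have o₃ := h.lt_flat₃_of_q₃' hφ (by linarith)
      exact ⟨o₂.trans_le (flat₂_le_one ha hb (by linarith)), o₂, o₃⟩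
    · have o₃ := h.lt_flat₃_of_slope' hφ (two_mul_lt_of_discr hb hc hΔ (by linarith))
      exact ⟨by linarith, o₂, o₃⟩
    · have o₁ := o₂.trans_le (flat₂_le_one ha hb (by linarith))
      exact ⟨o₁, o₂, by linarith⟩
  · rintro ⟨o₁, -, o₃⟩
    rcases le_total 1 c with h₁ | h₁
    · exact .inl ⟨by linarith, h.discr_nonneg, by
        linarith [h.q₁_of_lt_one o₁ (by linarith)]⟩
    · rcases le_total (1 - c) b with h₂ | h₂
      · exact .inr (.inr (.inr ⟨by linarith, by linarith⟩))
      · rcases lt_or_ge b (1 - 3 * c) with h₃ | h₃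
        · exact .inr (.inr (.inl ⟨by linarith, h.discr_nonneg, by linarith⟩))
        · refine .inr (.inl ⟨by linarith, h.discr_nonneg, ?_⟩)
          -- In the strip 1 - 3c ≤ b ≤ 1 - c one has (1 - c - b)² ≤ 2c (1 - c - b), so the second
          -- alternative gives q₃ < 0 at once.
          rcases le_or_gt a (2 * c * (1 - c - b)) with h₄ | h₄
          · linarith [h.q₃_of_lt_flat₃' o₃ h₄]
          · nlinarith

theorem plus_PP100 (h : PosRoot a b c x) (hφ : 0 ≤ slope a b c x) :
    (-1 ≤ -c ∧ 1 + 3 * -c ≤ b ∧ b ≤ 1 + -c ∧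
      0 ≤ a * (b + 4 * c) + 4 * c * (b - (1 - c) ^ 2) ∧ 0 < -a + (1 - b + -c) ^ 2) ↔
      PosOrder a b c x .PP100 := by
  have ha := h.a_pos
  have hb := h.b_pos
  have hc := h.c_pos
  have o₂ := h.lt_flat₂' hφ
  constructor
  · rintro ⟨h₁, h₂, h₃, -, h₄⟩
    exact ⟨h.lt_one_of_slope' hφ (by linarith), o₂,
      h.flat₃_lt_of_q₃' hφ (by linarith) (by nlinarith)⟩
  · rintro ⟨o₁, -, o₃⟩
    have s : 2 * (x - c) * (1 - c) ≤ b * (x + 1) := by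
      have := (h.slope_nonneg_iff o₁.ne).1 hφ
      nlinarith
    have := h.x_pos
    -- Inserting b < x - c into the slope bound and cancelling x - c > 0 gives x > 1 - 2c.
    have k : 1 - 3 * c ≤ x - c := by
      by_contra! hk
      nlinarith
    refine ⟨by linarith, by nlinarith, by linarith, h.discr_nonneg, by
      linarith [h.q₃_of_flat₃_lt' hφ o₃]⟩

theorem plus_PP001 (h : PosRoot a b c x) (hφ : 0 ≤ slope a b c x) :
    (-c ≤ -1 ∧ 0 ≤ a * (b + 4 * c) + 4 * c * (b - (1 - c) ^ 2) ∧ 0 < -b + (1 + -c) ^ 2) ↔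
      PosOrder a b c x .PP001 := by
  have ha := h.a_pos
  have hb := h.b_pos
  have hc := h.c_pos
  have o₂ := h.lt_flat₂' hφ
  constructor
  · rintro ⟨h₁, -, h₂⟩
    exact ⟨h.one_lt_of_q₁' hφ (by linarith) (by linarith), o₂,
      o₂.trans_le (flat₂_le_flat₃ ha hb (by linarith))⟩
  · rintro ⟨o₁, o₂, o₃⟩
    have k₂ := (h.lt_flat₂_iff o₁.ne').1 o₂
    have k : b - (x - c) * (1 - c) < 0 := by nlinarith
    refine ⟨?_, h.discr_nonneg, by linarith [h.q₁_of_one_lt' hφ o₁]⟩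
    by_contra! h₁
    nlinarith

end PosRoot

end Focal₂

/-! ## Focal telescopes in codimension 2: facts for both signs of `f` -/

theorem mem_focalE₂ {f d₁ d₂ d₃ x w : ℝ} : ((d₁, d₂, d₃), (x, w)) ∈ focalE₂ f ↔
    g₁ f d₃ x w = 0 ∧ g₂ d₁ d₂ d₃ x w = 0 ∧ d₁ < 0 ∧ 0 < d₂ ∧ d₃ < 0 ∧
      FocalNonflat d₁ d₂ d₃ x w := by
  constructor
  · rintro ⟨_, _, _, _, _, h, h'⟩
    simp only [Prod.mk.injEq] at h
    obtain ⟨⟨rfl, rfl, rfl⟩, rfl, rfl⟩ := h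
    exact h'
  · exact fun h => ⟨_, _, _, _, _, rfl, h⟩

theorem focalS₂_eq {f : ℝ} {p : (ℝ × ℝ × ℝ) × (ℝ × ℝ)} (hp : p ∈ focalE₂ f) :
    p.2.1 ≠ 0 ∧ p.2.2 ≠ 0 ∧
    focalS₂ p = ((SignType.sign p.2.1, SignType.sign p.2.2),
      (SignType.sign (1 - p.2.1),
        -SignType.sign (p.2.1 * (p.2.1 * (p.1.1 - p.1.2.1) + p.1.2.1 - p.2.2 * p.2.1 * p.1.1)),
        SignType.sign (p.2.2 * ((1 - p.2.2) * p.1.2.2 + p.2.2 * p.1.2.1)))) := by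
  obtain ⟨⟨d₁, d₂, d₃⟩, x, w⟩ := p
  obtain ⟨hg₁, -, h₁, h₂, h₃, -⟩ := mem_focalE₂.1 hp
  unfold g₁ at hg₁
  have hx : x ≠ 0 := by
    rintro rfl
    linarith
  have hw : w ≠ 0 := by
    rintro rfl
    linarith
  exact ⟨hx, hw, signature_focal h₁ h₂ h₃ hx hw⟩

theorem continuousOn_focalS₂ (f : ℝ) : ContinuousOn focalS₂ (focalE₂ f) := by
  refine (continuousOn_signs (f₁ := fun p : (ℝ × ℝ × ℝ) × (ℝ × ℝ) => p.2.1)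
    (f₂ := fun p => p.2.2) (f₃ := fun p => 1 - p.2.1)
    (f₄ := fun p => p.2.1 * (p.2.1 * (p.1.1 - p.1.2.1) + p.1.2.1 - p.2.2 * p.2.1 * p.1.1))
    (f₅ := fun p => p.2.2 * ((1 - p.2.2) * p.1.2.2 + p.2.2 * p.1.2.1))
    (by fun_prop) (by fun_prop) (by fun_prop) (by fun_prop) (by fun_prop) ?_).congr
    fun p hp => (focalS₂_eq hp).2.2
  rintro ⟨⟨d₁, d₂, d₃⟩, x, w⟩ hp
  obtain ⟨hx, hw, -⟩ := focalS₂_eq hp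
  obtain ⟨-, -, -, -, -, q₁, q₂, q₃⟩ := mem_focalE₂.1 hp
  exact ⟨hx, hw, fun h => q₁ (by linarith), mul_ne_zero hx q₂, mul_ne_zero hw q₃⟩

namespace Focal₂

/-- The focal condition gives Ω₂, since f² = 1; substituted into the Petzval condition it leaves d₃
times the pivot polynomial, up to sign and a power of x. -/
theorem pivot_of_mem {f d₁ d₂ d₃ x w : ℝ} (hf : f ^ 2 = 1)
    (h : ((d₁, d₂, d₃), (x, w)) ∈ focalE₂ f) :
    A₁ f d₁ d₂ d₃ * x ^ 2 + B₁ f d₁ d₂ d₃ * x + C₁ f d₁ d₂ d₃ = 0 ∧ w = -f * d₃ / x := by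
  have hx : x ≠ 0 := (focalS₂_eq h).1
  obtain ⟨hg₁, hg₂, -, -, h₃, -⟩ := mem_focalE₂.1 h
  unfold g₁ at hg₁
  have hw : w = -f * d₃ / x := by
    rw [eq_div_iff hx]
    linear_combination f * hg₁ - x * w * hf
  refine ⟨?_, hw⟩
  have : d₃ * (A₁ f d₁ d₂ d₃ * x ^ 2 + B₁ f d₁ d₂ d₃ * x + C₁ f d₁ d₂ d₃) = 0 := by
    subst hw
    unfold g₂ at hg₂
    field_simp at hg₂
    unfold A₁ B₁ C₁
    linear_combination -hg₂ + (d₁ * d₃ * x ^ 2 - d₁ * d₃ ^ 3) * hf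
  exact (mul_eq_zero.1 this).resolve_left h₃.ne

/-- The section of a branch that is given by the pivot equation. -/
def branch (f ε : ℝ) (y : ℝ × ℝ × ℝ) : ℝ × ℝ :=
  let x := quadRoot ε (A₁ f y.1 y.2.1 y.2.2) (B₁ f y.1 y.2.1 y.2.2) (C₁ f y.1 y.2.1 y.2.2)
  (x, -f * y.2.2 / x)

theorem isBranchSection {f ε : ℝ} (hf : f ^ 2 = 1) (hε : ε ^ 2 = 1) {R : Set (ℝ × ℝ × ℝ)}
    (hΔ : ∀ y ∈ R, 0 ≤ Δ f y.1 y.2.1 y.2.2)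
    (h0 : ∀ y ∈ R, A₁ f y.1 y.2.1 y.2.2 = 0 → 0 < ε * B₁ f y.1 y.2.1 y.2.2)
    (hmem : ∀ d₁ d₂ d₃ x : ℝ, (d₁, d₂, d₃) ∈ R →
      A₁ f d₁ d₂ d₃ * x ^ 2 + B₁ f d₁ d₂ d₃ * x + C₁ f d₁ d₂ d₃ = 0 →
      0 ≤ ε * (2 * A₁ f d₁ d₂ d₃ * x + B₁ f d₁ d₂ d₃) →
      ((d₁, d₂, d₃), (x, -f * d₃ / x)) ∈ focalE₂ f) :
    IsBranchSection (focalE₂ f) (φ f) ε R (branch f ε) := by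
  have hB0 : ∀ y ∈ R, A₁ f y.1 y.2.1 y.2.2 = 0 → B₁ f y.1 y.2.1 y.2.2 ≠ 0 := fun y hy h hb => by
    have := h0 y hy h
    simp [hb] at this
  have hb : ∀ y ∈ R, 0 ≤ ε * φ f (y, branch f ε y) := fun y hy =>
    quadRoot_branch hε fun h => (h0 y hy h).le
  have hE : ∀ y ∈ R, (y, branch f ε y) ∈ focalE₂ f := fun y hy =>
    hmem _ _ _ _ hy (quadRoot_isRoot hε (hΔ y hy) (hB0 y hy)) (hb y hy)
  have hc : ContinuousOn (fun y : ℝ × ℝ × ℝ => quadRoot ε (A₁ f y.1 y.2.1 y.2.2)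
      (B₁ f y.1 y.2.1 y.2.2) (C₁ f y.1 y.2.1 y.2.2)) R := by
    refine continuousOn_quadRoot hε ?_ ?_ ?_ hΔ h0 <;> simp only [A₁, B₁, C₁] <;> fun_prop
  refine ⟨hc.prodMk (ContinuousOn.div (by fun_prop) hc fun y hy => (focalS₂_eq (hE y hy)).1),
    hE, hb, ?_⟩
  rintro ⟨d₁, d₂, d₃⟩ hy ⟨x, w⟩ hxE hxb
  obtain ⟨hP, rfl⟩ := pivot_of_mem hf hxE
  have := eq_quadRoot hε hP hxb (hB0 _ hy)
  rw [branch]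
  simp only [← this]

/-! ## Focal telescopes in codimension 2 with `f = 1` -/

/-- For x ≤ 0 every term of the pivot polynomial is nonpositive and the constant one is negative. So
both magnifications are positive, and only names starting with PP occur for f = 1. -/
theorem posRoot_of_pivot {a b c x : ℝ} (ha : 0 < a) (hb : 0 < b) (hc : 0 < c)
    (h : A₁ 1 (-a) b (-c) * x ^ 2 + B₁ 1 (-a) b (-c) * x + C₁ 1 (-a) b (-c) = 0) :
    PosRoot a b c x := by
  unfold A₁ B₁ C₁ at h
  refine ⟨ha, hb, hc, ?_, by linear_combination h⟩
  by_contra! hx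
  have := mul_nonneg (show 0 ≤ a * b + 2 * a * c + 2 * b * c by positivity) (neg_nonneg.2 hx)
  have := mul_nonneg (show 0 ≤ a + b * c by positivity) (sq_nonneg x)
  have : 0 < c * (a * c + b) := by positivity
  linarith

theorem φ_one_eq_slope {a b c x w : ℝ} : φ 1 ((-a, b, -c), (x, w)) = slope a b c x := by
  simp only [φ, A₁, B₁, slope]
  ring

theorem mem_focalE₂_one {a b c x : ℝ} (h : PosRoot a b c x) :
    ((-a, b, -c), (x, -1 * -c / x)) ∈ focalE₂ 1 ↔ x ≠ 1 ∧ flat₂ a b c ≠ x ∧ b + c ≠ x := by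
  have ha := h.a_pos
  have hb := h.b_pos
  have hc := h.c_pos
  have hx := h.x_pos
  have e₂ : x * (-a - b) + b - -1 * -c / x * x * -a = (a + b) * (flat₂ a b c - x) := by
    unfold flat₂
    field_simp
    ring
  have e₃ : (1 - -1 * -c / x) * -c + -1 * -c / x * b = c / x * (b + c - x) := by
    field_simp
    ring
  have hg₁ : g₁ 1 (-c) x (-1 * -c / x) = 0 := by
    unfold g₁
    field_simp
    ring
  have hg₂ : g₂ (-a) b (-c) x (-1 * -c / x) = 0 := by
    unfold g₂
    field_simp
    linear_combination c * h.eq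
  rw [mem_focalE₂, FocalNonflat, e₂, e₃, hg₁, hg₂]
  have h₁ : c / x ≠ 0 := by positivity
  have h₂ : a + b ≠ 0 := by positivity
  simp [ha, hb, hc, sub_ne_zero, h₂, hc.ne', hx.ne']

theorem focalS₂_eq_iff {a b c x : ℝ} (h : PosRoot a b c x)
    (hE : ((-a, b, -c), (x, -1 * -c / x)) ∈ focalE₂ 1) (ν : Name) :
    focalS₂ ((-a, b, -c), (x, -1 * -c / x)) = ν.signature ↔ PosOrder a b c x ν := by
  have ha := h.a_pos
  have hb := h.b_pos
  have hc := h.c_pos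
  have hx := h.x_pos
  have e₂ : x * (x * (-a - b) + b - -1 * -c / x * x * -a) =
      -(x * (a + b) * (x - flat₂ a b c)) := by
    unfold flat₂
    field_simp
    ring
  have e₃ : -1 * -c / x * ((1 - -1 * -c / x) * -c + -1 * -c / x * b) =
      (c / x) ^ 2 * (b + c - x) := by
    field_simp
    ring
  have e₁ : -1 * -c / x = c / x := by ring
  rw [(focalS₂_eq hE).2.2]
  simp only [e₂, e₃]
  rw [e₁, Left.sign_neg, neg_neg, sign_mul (x * (a + b)), sign_mul ((c / x) ^ 2), sign_pos hx,
    sign_pos (show 0 < c / x by positivity), sign_pos (show 0 < (c / x) ^ 2 by positivity),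
    sign_pos (show 0 < x * (a + b) by positivity), one_mul, one_mul]
  cases ν <;> simp [Name.signature, PosOrder, sign_eq_one_iff, sign_eq_neg_one_iff]

theorem exists_of_mem_focalE₂_one {p : (ℝ × ℝ × ℝ) × (ℝ × ℝ)} (hp : p ∈ focalE₂ 1) :
    ∃ a b c x : ℝ, PosRoot a b c x ∧ p = ((-a, b, -c), (x, -1 * -c / x)) := by
  obtain ⟨⟨d₁, d₂, d₃⟩, x, w⟩ := p
  obtain ⟨a, rfl⟩ : ∃ a, d₁ = -a := ⟨-d₁, by ring⟩
  obtain ⟨c, rfl⟩ : ∃ c, d₃ = -c := ⟨-d₃, by ring⟩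
  obtain ⟨hP, rfl⟩ := pivot_of_mem (by norm_num) hp
  obtain ⟨-, -, ha, hb, hc, -⟩ := mem_focalE₂.1 hp
  exact ⟨a, d₂, c, x, posRoot_of_pivot (by linarith) hb (by linarith) hP, rfl⟩

/-- Two of the eight positions are excluded: both would force (x - c)² < b x < x (x - c)(1 - c), and
dividing by x - c, whose sign is known, contradicts the side of 1 on which x lies. -/
theorem exists_posOrder {a b c x : ℝ} (h : PosRoot a b c x) (h₁ : x ≠ 1)
    (h₂ : flat₂ a b c ≠ x) (h₃ : b + c ≠ x) :
    ∃ ν ∈ ({.PP010, .PP110, .PP001, .PP011, .PP100, .PP101} : Set Name), PosOrder a b c x ν := by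
  have ha := h.a_pos
  have hb := h.b_pos
  have hc := h.c_pos
  rcases h₁.lt_or_gt with o₁ | o₁ <;> rcases h₂.lt_or_gt with o₂ | o₂ <;>
    rcases h₃.lt_or_gt with o₃ | o₃
  · exact ⟨.PP110, by simp, o₁, o₂, o₃⟩
  · exfalso
    have k₂ := (h.flat₂_lt_iff h₁).1 o₂
    have k : b < (x - c) * (1 - c) := by nlinarith
    have hN := h.fibre_pos h₁
    have hk : x - c < 0 := by
      by_contra! hk
      nlinarith
    nlinarith [mul_lt_mul_of_pos_right k h.x_pos]
  · exact ⟨.PP100, by simp, o₁, o₂, o₃⟩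
  · exact ⟨.PP101, by simp, o₁, o₂, o₃⟩
  · exact ⟨.PP010, by simp, o₁, o₂, o₃⟩
  · exact ⟨.PP011, by simp, o₁, o₂, o₃⟩
  · exfalso
    have k₂ := (h.lt_flat₂_iff h₁).1 o₂
    have k : b < (x - c) * (1 - c) := by nlinarith
    have hN := h.fibre_pos h₁
    have hk : 0 < x - c := by linarith
    nlinarith [mul_lt_mul_of_pos_right k h.x_pos]
  · exact ⟨.PP001, by simp, o₁, o₂, o₃⟩

theorem Δ_one_nonneg_iff {a b c : ℝ} (ha : 0 < a) (hb : 0 < b) :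
    0 ≤ Δ 1 (-a) b (-c) ↔ 0 ≤ a * (b + 4 * c) + 4 * c * (b - (1 - c) ^ 2) := by
  have : Δ 1 (-a) b (-c) = a * b * (a * (b + 4 * c) + 4 * c * (b - (1 - c) ^ 2)) := by
    unfold Δ A₁ B₁ C₁
    ring
  rw [this, mul_nonneg_iff_of_pos_left (by positivity)]

theorem posMinus_iff {a b c x : ℝ} (h : PosRoot a b c x) (hφ : slope a b c x ≤ 0) (ν : Name) :
    PosMinus (-a) b (-c) ν ↔ PosOrder a b c x ν := by
  have hΔ := Δ_one_nonneg_iff (c := c) h.a_pos h.b_pos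
  cases ν <;> simp only [PosMinus, hΔ, q₁, q₂, q₃]
  · exact h.minus_PP010 hφ
  · exact h.minus_PP110 hφ
  · exact h.minus_PP001 hφ
  · exact h.minus_PP011 hφ
  · exact h.minus_PP100 hφ
  · exact h.minus_PP101 hφ
  all_goals rfl

theorem posPlus_iff {a b c x : ℝ} (h : PosRoot a b c x) (hφ : 0 ≤ slope a b c x) (ν : Name) :
    PosPlus (-a) b (-c) ν ↔ PosOrder a b c x ν := by
  have hΔ := Δ_one_nonneg_iff (c := c) h.a_pos h.b_pos
  have o₂ := (h.lt_flat₂' hφ).not_gt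
  cases ν <;> simp only [PosPlus, hΔ, q₁, q₃]
  · exact ⟨False.elim, fun o => o₂ o.2.1⟩
  · exact ⟨False.elim, fun o => o₂ o.2.1⟩
  · exact h.plus_PP001 hφ
  · exact ⟨False.elim, fun o => o₂ o.2.1⟩
  · exact h.plus_PP100 hφ
  · exact h.plus_PP101 hφ
  all_goals rfl

theorem discr_of_q₁ {a b c : ℝ} (ha : 0 < a) (hb : 0 < b) (hc : 0 < c) (h : (1 - c) ^ 2 ≤ b) :
    0 ≤ a * (b + 4 * c) + 4 * c * (b - (1 - c) ^ 2) := by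
  have : 0 ≤ c * (b - (1 - c) ^ 2) := mul_nonneg hc.le (by linarith)
  have : 0 ≤ a * (b + 4 * c) := by positivity
  linarith

theorem discr_of_q₂ {a b c : ℝ} (ha : 0 < a) (hb : 0 < b) (hc : 0 < c)
    (h : (1 - c) ^ 2 ≤ a + b) : 0 ≤ a * (b + 4 * c) + 4 * c * (b - (1 - c) ^ 2) := by
  have : 0 ≤ c * (a + b - (1 - c) ^ 2) := mul_nonneg hc.le (by linarith)
  have : 0 ≤ a * b := by positivity
  linarith

/-- On q₃ = 0 the expression equals b (1 - 3c - b)²: the surfaces q₃ = 0 and Δ = 0 meet along b = 1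
- 3c. It increases with a. -/
theorem discr_of_q₃ {a b c : ℝ} (hb : 0 < b) (hc : 0 < c) (h : (1 - b - c) ^ 2 ≤ a) :
    0 ≤ a * (b + 4 * c) + 4 * c * (b - (1 - c) ^ 2) := by
  have : 0 ≤ (a - (1 - b - c) ^ 2) * (b + 4 * c) := mul_nonneg (by linarith) (by linarith)
  have := mul_nonneg hb.le (sq_nonneg (1 - 3 * c - b))
  linarith

theorem Δ_nonneg_of_posMinus {a b c : ℝ} (ha : 0 < a) (hb : 0 < b) (hc : 0 < c) {ν : Name}
    (h : PosMinus (-a) b (-c) ν) : 0 ≤ Δ 1 (-a) b (-c) := by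
  rw [Δ_one_nonneg_iff ha hb]
  cases ν <;> simp only [PosMinus, Δ_one_nonneg_iff ha hb, q₁, q₂, q₃] at h
  · rcases h with ⟨-, h⟩ | ⟨-, h, -⟩ | ⟨-, -, h⟩
    · exact discr_of_q₃ hb hc (by linarith)
    · exact discr_of_q₁ ha hb hc (by linarith)
    · exact discr_of_q₃ hb hc (by linarith)
  · exact discr_of_q₂ ha hb hc (by linarith [h.2.2])
  · exact h.2.1
  · exact discr_of_q₂ ha hb hc (by linarith [h.1])
  · rcases h with ⟨-, -, -, h⟩ | ⟨-, -, -, -, h⟩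
    · exact h
    · exact discr_of_q₃ hb hc (by linarith)
  · exact h.2.1

theorem Δ_nonneg_of_posPlus {a b c : ℝ} (ha : 0 < a) (hb : 0 < b) (hc : 0 < c) {ν : Name}
    (h : PosPlus (-a) b (-c) ν) : 0 ≤ Δ 1 (-a) b (-c) := by
  rw [Δ_one_nonneg_iff ha hb]
  cases ν <;> simp only [PosPlus, Δ_one_nonneg_iff ha hb, q₁, q₃] at h
  · exact h.2.1
  · exact h.2.2.2.1
  · rcases h with ⟨-, h, -⟩ | ⟨-, h, -⟩ | ⟨-, h, -⟩ | ⟨h, h'⟩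
    · exact h
    · exact h
    · exact h
    · exact discr_of_q₁ ha hb hc (by nlinarith)

/-! ### Path connectedness of the level sets -/

/-- The order relations of `PosOrder` in the coordinates `b`, `c`, `x`. -/
def PosParam (b c x : ℝ) : Name → Prop
  | .PP010 => 1 < x ∧ (x - c) * (1 - c) < b ∧ b < x - c
  | .PP110 => x < 1 ∧ b < (x - c) * (1 - c) ∧ b < x - c
  | .PP001 => 1 < x ∧ b < (x - c) * (1 - c) ∧ x - c < b
  | .PP011 => 1 < x ∧ (x - c) * (1 - c) < b ∧ x - c < b
  | .PP100 => x < 1 ∧ (x - c) * (1 - c) < b ∧ b < x - c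
  | .PP101 => x < 1 ∧ (x - c) * (1 - c) < b ∧ x - c < b
  | _ => False

/-- With a eliminated, every comparison is either x against 1 or a one-sided bound on b depending
only on (c, x). This is what makes the fibres over (c, x) intervals. -/
theorem posOrder_iff {a b c x : ℝ} (h : PosRoot a b c x) (ν : Name) :
    PosOrder a b c x ν ↔ PosParam b c x ν := by
  have key₁ : 1 < x → (flat₂ a b c < x ↔ (x - c) * (1 - c) < b) ∧
      (x < flat₂ a b c ↔ b < (x - c) * (1 - c)) := fun o => by
    rw [h.flat₂_lt_iff o.ne', h.lt_flat₂_iff o.ne', mul_pos_iff_of_pos_left (sub_pos.2 o),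
      ← neg_pos, ← mul_neg, mul_pos_iff_of_pos_left (sub_pos.2 o), neg_sub, sub_pos, sub_pos]
    exact ⟨Iff.rfl, Iff.rfl⟩
  have key₂ : x < 1 → (flat₂ a b c < x ↔ b < (x - c) * (1 - c)) ∧
      (x < flat₂ a b c ↔ (x - c) * (1 - c) < b) := fun o => by
    have e : (x - 1) * (b - (x - c) * (1 - c)) = (1 - x) * ((x - c) * (1 - c) - b) := by ring
    rw [h.flat₂_lt_iff o.ne, h.lt_flat₂_iff o.ne, e, mul_pos_iff_of_pos_left (sub_pos.2 o),
      ← neg_pos, ← mul_neg, mul_pos_iff_of_pos_left (sub_pos.2 o), neg_sub, sub_pos, sub_pos]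
    exact ⟨Iff.rfl, Iff.rfl⟩
  have key₃ : (b + c < x ↔ b < x - c) ∧ (x < b + c ↔ x - c < b) :=
    ⟨lt_sub_iff_add_lt.symm, sub_lt_iff_lt_add.symm⟩
  cases ν <;> simp only [PosOrder, PosParam, key₃.1, key₃.2]
  · exact and_congr_right fun o => by rw [(key₁ o).1]
  · exact and_congr_right fun o => by rw [(key₂ o).1]
  · exact and_congr_right fun o => by rw [(key₁ o).2]
  · exact and_congr_right fun o => by rw [(key₁ o).1]
  · exact and_congr_right fun o => by rw [(key₂ o).2]
  · exact and_congr_right fun o => by rw [(key₂ o).2]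

/-- Parameter domain of a level set of the signature, with the parameters `((c, x), b)`. -/
def posDomain (ν : Name) : Set ((ℝ × ℝ) × ℝ) :=
  {q | 0 < q.1.1 ∧ 0 < q.1.2 ∧ 0 < q.2 ∧ (q.1.2 - q.1.1) ^ 2 < q.2 * q.1.2 ∧
    PosParam q.2 q.1.1 q.1.2 ν}

/-- The first coordinate is -a, with a solved from the pivot equation, which is linear in it. -/
def posMap (q : (ℝ × ℝ) × ℝ) : (ℝ × ℝ × ℝ) × (ℝ × ℝ) :=
  ((-(q.2 * q.1.1 * (q.1.2 - 1) ^ 2 / (q.2 * q.1.2 - (q.1.2 - q.1.1) ^ 2)), q.2, -q.1.1),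
    (q.1.2, -1 * -q.1.1 / q.1.2))

theorem levelSet_one_eq (ν : Name) :
    {p | p ∈ focalE₂ 1 ∧ focalS₂ p = ν.signature} = posMap '' posDomain ν := by
  ext p
  constructor
  · rintro ⟨hp, hs⟩
    obtain ⟨a, b, c, x, h, rfl⟩ := exists_of_mem_focalE₂_one hp
    have hx1 := ((mem_focalE₂_one h).1 hp).1
    have hN := h.fibre_pos hx1
    rw [focalS₂_eq_iff h hp, posOrder_iff h] at hs
    refine ⟨((c, x), b), ⟨h.c_pos, h.x_pos, h.b_pos, sub_pos.1 hN, hs⟩, ?_⟩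
    have : b * c * (x - 1) ^ 2 / (b * x - (x - c) ^ 2) = a := by
      rw [div_eq_iff hN.ne', h.eq]
    simp only [posMap, this]
  · rintro ⟨⟨⟨c, x⟩, b⟩, ⟨hc, hx, hb, hN, hs⟩, rfl⟩
    simp only at hc hx hb hN hs
    have hx1 : x ≠ 1 := by
      rintro rfl
      cases ν <;> simp [PosParam] at hs
    have hN' := sub_pos.2 hN
    have hx2 : 0 < (x - 1) ^ 2 := by
      have := sub_ne_zero.2 hx1
      positivity
    have h : PosRoot (b * c * (x - 1) ^ 2 / (b * x - (x - c) ^ 2)) b c x :=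
      ⟨by positivity, hb, hc, hx, div_mul_cancel₀ _ hN'.ne'⟩
    have ho := (posOrder_iff h ν).2 hs
    have hE : posMap ((c, x), b) ∈ focalE₂ 1 := by
      refine (mem_focalE₂_one h).2 ⟨hx1, ?_, ?_⟩
      · cases ν <;> simp only [PosOrder] at ho <;>
          first | exact ho.2.1.ne | exact ho.2.1.ne'
      · cases ν <;> simp only [PosOrder] at ho <;>
          first | exact ho.2.2.ne | exact ho.2.2.ne'
    exact ⟨hE, (focalS₂_eq_iff h hE ν).2 ho⟩

theorem posDomain_ordConnected (ν : Name) (y : ℝ × ℝ) (u v t : ℝ) (hu : (y, u) ∈ posDomain ν)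
    (hv : (y, v) ∈ posDomain ν) (hut : u ≤ t) (htv : t ≤ v) : (y, t) ∈ posDomain ν := by
  obtain ⟨hc, hx, hb, hN, hs⟩ := hu
  obtain ⟨-, -, -, -, hs'⟩ := hv
  simp only at hc hx hb hN hs hs'
  refine ⟨hc, hx, hb.trans_le hut, hN.trans_le (mul_le_mul_of_nonneg_right hut hx.le), ?_⟩
  cases ν <;> simp only [PosParam] at hs hs' ⊢ <;>
    exact ⟨hs.1, by linarith [hs.2.1, hs'.2.1], by linarith [hs.2.2, hs'.2.2]⟩

theorem isPathConnected_posDomain_of_section {ν : Name} {B : Set (ℝ × ℝ)} (hB : Convex ℝ B)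
    (hne : B.Nonempty) {s : ℝ → ℝ → ℝ}
    (hs : ContinuousOn (fun y : ℝ × ℝ => s y.1 y.2) B)
    (hbase : ∀ c x b, ((c, x), b) ∈ posDomain ν → (c, x) ∈ B)
    (hsec : ∀ c x, (c, x) ∈ B → ((c, x), s c x) ∈ posDomain ν) :
    IsPathConnected (posDomain ν) :=
  isPathConnected_of_section (hB.isPathConnected hne) hs (fun p hp => hbase p.1.1 p.1.2 p.2 hp)
    (fun y hy => hsec y.1 y.2 hy) (posDomain_ordConnected ν)

end Focal₂

theorem add_mul_lt {a b a' b' s t : ℝ} (h : a < b) (h' : a' < b') (hs : 0 ≤ s) (ht : 0 ≤ t)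
    (hst : s + t = 1) : s * a + t * a' < s * b + t * b' := by
  rcases hs.eq_or_lt with rfl | hs
  · obtain rfl : t = 1 := by linarith
    simpa using h'
  · linarith [mul_lt_mul_of_pos_left h hs, mul_le_mul_of_nonneg_left h'.le ht]

namespace Focal₂

/-- A bound that exceeds the three lower bounds on `b` in `posDomain`. -/
theorem lower_lt_bound {c x : ℝ} (hx : 0 < x) :
    let s := 1 + (x - c) ^ 2 / x + (x - c) ^ 2 + ((x - c) * (1 - c)) ^ 2
    0 < s ∧ (x - c) ^ 2 < s * x ∧ (x - c) * (1 - c) < s ∧ x - c < s := by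
  intro s
  have h₁ : 0 ≤ (x - c) ^ 2 / x := by positivity
  have h₂ : (x - c) ^ 2 / x < s := by
    simp only [s]
    nlinarith [sq_nonneg (x - c), sq_nonneg ((x - c) * (1 - c))]
  refine ⟨h₁.trans_lt h₂, (div_lt_iff₀ hx).1 h₂, ?_, ?_⟩ <;> simp only [s] <;>
    nlinarith [sq_nonneg ((x - c) * (1 - c) - 1), sq_nonneg (x - c - 1), sq_nonneg (x - c),
      sq_nonneg ((x - c) * (1 - c))]

/-- The base is convex in every case. If b is bounded above, the section is the midpoint between the
largest lower and the smallest upper bound; otherwise it is an explicit number above all lower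
bounds. -/
theorem isPathConnected_posDomain {ν : Name}
    (hν : ν ∈ ({.PP010, .PP110, .PP001, .PP011, .PP100, .PP101} : Set Name)) :
    IsPathConnected (posDomain ν) := by
  have hcont : ∀ (B : Set (ℝ × ℝ)) (f : ℝ × ℝ → ℝ), Continuous f → (∀ y ∈ B, y.2 ≠ 0) →
      ContinuousOn (fun y : ℝ × ℝ => ((y.2 - y.1) ^ 2 / y.2 + f y) / 2) B := fun B f hf hB =>
    ((ContinuousOn.div (by fun_prop) (by fun_prop) hB).add hf.continuousOn).div_const _
  have hmax : ∀ B : Set (ℝ × ℝ), (∀ y ∈ B, y.2 ≠ 0) → ContinuousOn (fun y : ℝ × ℝ =>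
      1 + (y.2 - y.1) ^ 2 / y.2 + (y.2 - y.1) ^ 2 + ((y.2 - y.1) * (1 - y.1)) ^ 2) B :=
    fun B hB => ((continuousOn_const.add (ContinuousOn.div (by fun_prop) (by fun_prop) hB)).add
      (by fun_prop)).add (by fun_prop)
  simp only [mem_insert_iff, mem_singleton_iff] at hν
  rcases hν with rfl | rfl | rfl | rfl | rfl | rfl
  · refine isPathConnected_posDomain_of_section (B := {y | 0 < y.1 ∧ y.1 < y.2 ∧ 1 < y.2})
      (s := fun c x => ((x - c) ^ 2 / x + (x - c)) / 2) ?_ ⟨(1, 2), by norm_num⟩ ?_ ?_ ?_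
    · rintro ⟨c, x⟩ ⟨h₁, h₂, h₃⟩ ⟨c', x'⟩ ⟨h₁', h₂', h₃'⟩ s t hs ht hst
      have k₁ := add_mul_lt h₁ h₁' hs ht hst
      have k₂ := add_mul_lt h₂ h₂' hs ht hst
      have k₃ := add_mul_lt h₃ h₃' hs ht hst
      exact ⟨by simpa using k₁, by simpa using k₂, by simpa [hst] using k₃⟩
    · exact hcont _ (fun y => y.2 - y.1) (by fun_prop) fun y hy => (hy.1.trans hy.2.1).ne'
    · rintro c x b ⟨hc, hx, hb, hN, o₁, o₂, o₃⟩
      exact ⟨hc, by linarith, o₁⟩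
    · rintro c x ⟨hc, hcx, o₁⟩
      simp only at hc hcx o₁
      have hx : 0 < x := by linarith
      have hk : 0 < x - c := by linarith
      have r₁ : (x - c) ^ 2 / x < x - c := (div_lt_iff₀ hx).2 (by nlinarith)
      -- Since x - c - x (1 - c) = c (x - 1), the side of 1 on which x lies decides which of the two
      -- lower bounds is the active one.
      have r₂ : (x - c) * (1 - c) < (x - c) ^ 2 / x := (lt_div_iff₀ hx).2 (by
        nlinarith [mul_pos hk (mul_pos hc (sub_pos.2 o₁))])
      have r₀ : 0 < (x - c) ^ 2 / x := by positivity
      exact ⟨hc, hx, by linarith, (div_lt_iff₀ hx).1 (by linarith), o₁, by linarith, by linarith⟩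
  · refine isPathConnected_posDomain_of_section (B := {y | 0 < y.1 ∧ y.1 < y.2 ∧ y.2 < 1})
      (s := fun c x => ((x - c) ^ 2 / x + (x - c) * (1 - c)) / 2) ?_
      ⟨(1 / 4, 1 / 2), by norm_num⟩ ?_ ?_ ?_
    · rintro ⟨c, x⟩ ⟨h₁, h₂, h₃⟩ ⟨c', x'⟩ ⟨h₁', h₂', h₃'⟩ s t hs ht hst
      have k₁ := add_mul_lt h₁ h₁' hs ht hst
      have k₂ := add_mul_lt h₂ h₂' hs ht hst
      have k₃ := add_mul_lt h₃ h₃' hs ht hst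
      exact ⟨by simpa using k₁, by simpa using k₂, by simpa [hst] using k₃⟩
    · exact hcont _ (fun y => (y.2 - y.1) * (1 - y.1)) (by fun_prop)
        fun y hy => (hy.1.trans hy.2.1).ne'
    · rintro c x b ⟨hc, hx, hb, hN, o₁, o₂, o₃⟩
      exact ⟨hc, by linarith, o₁⟩
    · rintro c x ⟨hc, hcx, o₁⟩
      simp only at hc hcx o₁
      have hx : 0 < x := by linarith
      have hk : 0 < x - c := by linarith
      have r₂ : (x - c) ^ 2 / x < (x - c) * (1 - c) := (div_lt_iff₀ hx).2 (by
        nlinarith [mul_pos hk (mul_pos hc (sub_pos.2 o₁))])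
      have r₃ : (x - c) * (1 - c) < x - c := by nlinarith
      have r₀ : 0 < (x - c) ^ 2 / x := by positivity
      exact ⟨hc, hx, by linarith, (div_lt_iff₀ hx).1 (by linarith), o₁, by linarith, by linarith⟩
  · refine isPathConnected_posDomain_of_section (B := {y | 1 < y.2 ∧ y.2 < y.1})
      (s := fun c x => ((x - c) ^ 2 / x + (x - c) * (1 - c)) / 2) ?_ ⟨(3, 2), by norm_num⟩ ?_ ?_ ?_
    · rintro ⟨c, x⟩ ⟨h₁, h₂⟩ ⟨c', x'⟩ ⟨h₁', h₂'⟩ s t hs ht hst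
      have k₁ := add_mul_lt h₁ h₁' hs ht hst
      have k₂ := add_mul_lt h₂ h₂' hs ht hst
      exact ⟨by simpa [hst] using k₁, by simpa using k₂⟩
    · exact hcont _ (fun y => (y.2 - y.1) * (1 - y.1)) (by fun_prop)
        fun y hy => (zero_lt_one.trans hy.1).ne'
    · rintro c x b ⟨hc, hx, hb, hN, o₁, o₂, o₃⟩
      simp only at hc hx hb hN o₁ o₂ o₃
      refine ⟨o₁, ?_⟩
      -- If c ≤ x, then b < (x - c)(1 - c) ≤ x - c, against x - c < b.
      by_contra! hcx
      simp only at hcx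
      nlinarith [mul_nonneg (sub_nonneg.2 hcx) hc.le]
    · rintro c x ⟨o₁, hcx⟩
      simp only at hcx o₁
      have hx : 0 < x := by linarith
      have hc : 0 < c := by linarith
      have hk : 0 < c - x := by linarith
      have r₂ : (x - c) ^ 2 / x < (x - c) * (1 - c) := (div_lt_iff₀ hx).2 (by
        nlinarith [mul_pos hk (mul_pos hc (sub_pos.2 o₁))])
      have r₀ : 0 ≤ (x - c) ^ 2 / x := by positivity
      exact ⟨hc, hx, by linarith, (div_lt_iff₀ hx).1 (by linarith), o₁, by linarith, by linarith⟩
  · refine isPathConnected_posDomain_of_section (B := {y | 0 < y.1 ∧ 1 < y.2})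
      (s := fun c x => 1 + (x - c) ^ 2 / x + (x - c) ^ 2 + ((x - c) * (1 - c)) ^ 2) ?_
      ⟨(1, 2), by norm_num⟩ ?_ ?_ ?_
    · rintro ⟨c, x⟩ ⟨h₁, h₂⟩ ⟨c', x'⟩ ⟨h₁', h₂'⟩ s t hs ht hst
      have k₁ := add_mul_lt h₁ h₁' hs ht hst
      have k₂ := add_mul_lt h₂ h₂' hs ht hst
      exact ⟨by simpa using k₁, by simpa [hst] using k₂⟩
    · exact hmax _ fun y hy => (zero_lt_one.trans hy.2).ne'
    · rintro c x b ⟨hc, hx, hb, hN, o₁, o₂, o₃⟩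
      exact ⟨hc, o₁⟩
    · rintro c x ⟨hc, o₁⟩
      have hx := zero_lt_one.trans o₁
      obtain ⟨r₀, r₁, r₂, r₃⟩ := lower_lt_bound (c := c) hx
      exact ⟨hc, hx, r₀, r₁, o₁, r₂, r₃⟩
  · refine isPathConnected_posDomain_of_section (B := {y | 0 < y.1 ∧ y.1 < y.2 ∧ y.2 < 1})
      (s := fun c x => ((x - c) * (1 - c) + (x - c)) / 2) ?_
      ⟨(1 / 4, 1 / 2), by norm_num⟩ (by fun_prop) ?_ ?_
    · rintro ⟨c, x⟩ ⟨h₁, h₂, h₃⟩ ⟨c', x'⟩ ⟨h₁', h₂', h₃'⟩ s t hs ht hst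
      have k₁ := add_mul_lt h₁ h₁' hs ht hst
      have k₂ := add_mul_lt h₂ h₂' hs ht hst
      have k₃ := add_mul_lt h₃ h₃' hs ht hst
      exact ⟨by simpa using k₁, by simpa using k₂, by simpa [hst] using k₃⟩
    · rintro c x b ⟨hc, hx, hb, hN, o₁, o₂, o₃⟩
      exact ⟨hc, by linarith, o₁⟩
    · rintro c x ⟨hc, hcx, o₁⟩
      simp only at hc hcx o₁
      have hx : 0 < x := by linarith
      have hk : 0 < x - c := by linarith
      have r₂ : (x - c) ^ 2 < (x - c) * (1 - c) * x := by
        nlinarith [mul_pos hk (mul_pos hc (sub_pos.2 o₁))]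
      have r₃ : (x - c) * (1 - c) < x - c := by nlinarith
      have r₄ : 0 < (x - c) * (1 - c) := mul_pos hk (by linarith)
      exact ⟨hc, hx, by linarith, r₂.trans (mul_lt_mul_of_pos_right (by linarith) hx), o₁,
        by linarith, by linarith⟩
  · refine isPathConnected_posDomain_of_section (B := {y | 0 < y.1 ∧ 0 < y.2 ∧ y.2 < 1})
      (s := fun c x => 1 + (x - c) ^ 2 / x + (x - c) ^ 2 + ((x - c) * (1 - c)) ^ 2) ?_
      ⟨(1, 1 / 2), by norm_num⟩ ?_ ?_ ?_
    · rintro ⟨c, x⟩ ⟨h₁, h₂, h₃⟩ ⟨c', x'⟩ ⟨h₁', h₂', h₃'⟩ s t hs ht hst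
      have k₁ := add_mul_lt h₁ h₁' hs ht hst
      have k₂ := add_mul_lt h₂ h₂' hs ht hst
      have k₃ := add_mul_lt h₃ h₃' hs ht hst
      exact ⟨by simpa using k₁, by simpa using k₂, by simpa [hst] using k₃⟩
    · exact hmax _ fun y hy => hy.2.1.ne'
    · rintro c x b ⟨hc, hx, hb, hN, o₁, o₂, o₃⟩
      exact ⟨hc, hx, o₁⟩
    · rintro c x ⟨hc, hx, o₁⟩
      obtain ⟨r₀, r₁, r₂, r₃⟩ := lower_lt_bound (c := c) hx
      exact ⟨hc, hx, r₀, r₁, o₁, r₂, r₃⟩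

theorem continuousOn_posMap (ν : Name) : ContinuousOn posMap (posDomain ν) := by
  unfold posMap
  refine ContinuousOn.prodMk (ContinuousOn.prodMk (ContinuousOn.neg (ContinuousOn.div (by fun_prop)
    (by fun_prop) fun q hq => (sub_pos.2 hq.2.2.2.1).ne')) (by fun_prop))
    (ContinuousOn.prodMk (by fun_prop) (ContinuousOn.div (by fun_prop) (by fun_prop)
    fun q hq => hq.2.1.ne'))

/-! ### Branch sections and classification in codimension 2 for f = 1 -/

theorem isBranchSection_one {ε : ℝ} (hε : ε ^ 2 = 1) {P : ℝ → ℝ → ℝ → Name → Prop} (ν : Name)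
    (hν : ν ∈ ({.PP010, .PP110, .PP001, .PP011, .PP100, .PP101} : Set Name))
    (hΔ : ∀ {a b c : ℝ}, 0 < a → 0 < b → 0 < c → P (-a) b (-c) ν → 0 ≤ Δ 1 (-a) b (-c))
    (hP : ∀ {a b c x : ℝ}, PosRoot a b c x → 0 ≤ ε * slope a b c x → P (-a) b (-c) ν →
      PosOrder a b c x ν) :
    IsBranchSection (focalE₂ 1) (φ 1) ε (region P ν) (branch 1 ε) := by
  refine isBranchSection (by norm_num) hε ?_ ?_ ?_
  · rintro ⟨d₁, d₂, d₃⟩ ⟨h₁, h₂, h₃, h⟩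
    simpa using hΔ (a := -d₁) (b := d₂) (c := -d₃) (neg_pos.2 h₁) h₂ (neg_pos.2 h₃)
      (by simpa using h)
  · rintro ⟨d₁, d₂, d₃⟩ ⟨h₁, h₂, h₃, -⟩ h
    -- For f = 1 the leading coefficient d₁ + d₂ d₃ is negative, so the pivot equation never
    -- degenerates.
    simp only [A₁] at h h₁ h₂ h₃
    nlinarith
  · rintro d₁ d₂ d₃ x ⟨h₁, h₂, h₃, h⟩ hx hb
    obtain ⟨a, rfl⟩ : ∃ a, d₁ = -a := ⟨-d₁, by ring⟩
    obtain ⟨c, rfl⟩ : ∃ c, d₃ = -c := ⟨-d₃, by ring⟩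
    simp only [Left.neg_neg_iff] at h₁ h₂ h₃ h
    have hR := posRoot_of_pivot h₁ h₂ h₃ hx
    have ho := hP hR (by
      rw [← φ_one_eq_slope (w := 0)]
      exact hb) h
    simp only [mem_insert_iff, mem_singleton_iff] at hν
    rw [mem_focalE₂_one hR]
    rcases hν with rfl | rfl | rfl | rfl | rfl | rfl
    · exact ⟨ho.1.ne', ho.2.1.ne, ho.2.2.ne⟩
    · exact ⟨ho.1.ne, ho.2.1.ne, ho.2.2.ne⟩
    · exact ⟨ho.1.ne', ho.2.1.ne', ho.2.2.ne'⟩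
    · exact ⟨ho.1.ne', ho.2.1.ne, ho.2.2.ne'⟩
    · exact ⟨ho.1.ne, ho.2.1.ne', ho.2.2.ne⟩
    · exact ⟨ho.1.ne, ho.2.1.ne', ho.2.2.ne'⟩

theorem classification_one :
    TwoBranchClassification (focalE₂ 1) focalS₂ (φ 1) (region PosMinus) (region PosPlus)
      {.PP010, .PP110, .PP001, .PP011, .PP100, .PP101} 6 := by
  refine .of_levelSets (continuousOn_focalS₂ 1) ?_ (fun ν hν => ?_) ?_ ?_ ?_ ?_ ?_
  · intro p hp
    obtain ⟨a, b, c, x, h, rfl⟩ := exists_of_mem_focalE₂_one hp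
    obtain ⟨h₁, h₂, h₃⟩ := (mem_focalE₂_one h).1 hp
    obtain ⟨ν, hν, ho⟩ := exists_posOrder h h₁ h₂ h₃
    exact ⟨ν, hν, (focalS₂_eq_iff h hp ν).2 ho⟩
  · rw [levelSet_one_eq]
    exact (isPathConnected_posDomain hν).image' (continuousOn_posMap ν)
  · iterate 5 rw [ncard_insert_of_notMem (by simp)]
    simp
  · rintro p hp hφ ν -
    obtain ⟨a, b, c, x, h, rfl⟩ := exists_of_mem_focalE₂_one hp
    rw [φ_one_eq_slope] at hφ
    rw [focalS₂_eq_iff h hp, ← posMinus_iff h hφ]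
    simp [region, h.a_pos, h.b_pos, h.c_pos]
  · rintro p hp hφ ν -
    obtain ⟨a, b, c, x, h, rfl⟩ := exists_of_mem_focalE₂_one hp
    rw [φ_one_eq_slope] at hφ
    rw [focalS₂_eq_iff h hp, ← posPlus_iff h hφ]
    simp [region, h.a_pos, h.b_pos, h.c_pos]
  · exact fun ν hν => ⟨_, isBranchSection_one (by norm_num) ν hν
      (fun h₁ h₂ h₃ => Δ_nonneg_of_posMinus h₁ h₂ h₃)
      fun h hb => (posMinus_iff h (by linarith) ν).1⟩
  · exact fun ν hν => ⟨_, isBranchSection_one (by norm_num) ν hν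
      (fun h₁ h₂ h₃ => Δ_nonneg_of_posPlus h₁ h₂ h₃)
      fun h hb => (posPlus_iff h (by linarith) ν).1⟩

end Focal₂

/-- An order relation that covers `E` and forces the signature is equivalent to it. -/
theorem signature_iff_of_cover {s : Signature} {O : Name → Prop} (hcover : ∃ ν, O ν)
    (h : ∀ ν, O ν → s = ν.signature) (ν : Name) : s = ν.signature ↔ O ν := by
  refine ⟨fun hs => ?_, h ν⟩
  obtain ⟨μ, hμ⟩ := hcover
  rwa [← Name.signature_injective ((h μ hμ).symm.trans hs)]

namespace Focal₂

/-! ## Focal telescopes in codimension 2 with `f = -1`, with `d₁ = -a`, `d₂ = b`, `d₃ = -c` -/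

/-- `x` is a nonzero root of the pivot polynomial over `(-a, b, -c)`. -/
structure NegRoot (a b c x : ℝ) : Prop where
  a_pos : 0 < a
  b_pos : 0 < b
  c_pos : 0 < c
  ne_zero : x ≠ 0
  eq : a * ((x + c) ^ 2 + b * x) = b * c * (x - 1) ^ 2

/-- The position of a root that `ν` encodes. -/
def NegOrder (c x : ℝ) : Name → Prop
  | .NP110 => x < -c
  | .NP101 => -c < x ∧ x < 0
  | .PN101 => 0 < x ∧ x < 1
  | .PN011 => 1 < x
  | _ => False

namespace NegRoot

variable {a b c x : ℝ}

theorem ne_one (h : NegRoot a b c x) : x ≠ 1 := by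
  rintro rfl
  have ha := h.a_pos
  have hb := h.b_pos
  have : 0 < a * ((1 + c) ^ 2 + b * 1) := by positivity
  rw [h.eq] at this
  simp at this

theorem ne_neg (h : NegRoot a b c x) : x ≠ -c := by
  rintro rfl
  have ha := h.a_pos
  have hb := h.b_pos
  have hc := h.c_pos
  have h₁ : 0 < a * b * c := by positivity
  have h₂ : 0 ≤ b * c * (-c - 1) ^ 2 := by positivity
  linarith [h.eq]

theorem fibre_pos (h : NegRoot a b c x) : 0 < (x + c) ^ 2 + b * x := by
  have h₁ : 0 < (x - 1) ^ 2 := by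
    have := sub_ne_zero.2 h.ne_one
    positivity
  have : 0 < b * c * (x - 1) ^ 2 := mul_pos (mul_pos h.b_pos h.c_pos) h₁
  rw [← h.eq] at this
  exact pos_of_mul_pos_right this h.a_pos.le

theorem exists_order (h : NegRoot a b c x) :
    ∃ ν ∈ ({.NP101, .PN101, .NP110, .PN011} : Set Name), NegOrder c x ν := by
  rcases h.ne_zero.lt_or_gt with h₁ | h₁
  · rcases h.ne_neg.lt_or_gt with h₂ | h₂
    · exact ⟨.NP110, by simp, h₂⟩
    · exact ⟨.NP101, by simp, h₂, h₁⟩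
  · rcases h.ne_one.lt_or_gt with h₂ | h₂
    · exact ⟨.PN101, by simp, h₁, h₂⟩
    · exact ⟨.PN011, by simp, h₂⟩

/-- If b ≥ -(x + c), then (x + c)² + b x ≤ c (x + c) < 0, against `fibre_pos`. With it, the signs of
Q₂ and Q₃ depend only on where x lies relative to -c, 0, 1. -/
theorem add_neg_of_lt (h : NegRoot a b c x) (hx : x < -c) : x + b + c < 0 := by
  have hc := h.c_pos
  have hN := h.fibre_pos
  by_contra! hk
  nlinarith [mul_nonneg hk (show 0 ≤ -x by linarith)]

theorem flat₂_pos_of_gt (h : NegRoot a b c x) (hx : -c < x) :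
    0 < b + (x + c) * (1 + c) := by
  have hc := h.c_pos
  nlinarith [h.b_pos, mul_pos (show 0 < x + c by linarith) (show 0 < 1 + c by linarith)]

theorem flat₂_neg_of_lt (h : NegRoot a b c x) (hx : x < -c) :
    b + (x + c) * (1 + c) < 0 := by
  have hc := h.c_pos
  nlinarith [h.add_neg_of_lt hx]

theorem flat₂_eq (h : NegRoot a b c x) :
    x * (x * (-a - b) + b - -(-1) * -c / x * x * -a) =
      b * x ^ 2 / ((x + c) ^ 2 + b * x) * ((1 - x) * (b + (x + c) * (1 + c))) := by
  have hN := h.fibre_pos.ne'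
  have hx := h.ne_zero
  have e : x * (-a - b) + b - -(-1) * -c / x * x * -a = -(b * (x - 1) + a * (x + c)) := by
    field_simp
    ring
  rw [e, div_mul_eq_mul_div, eq_div_iff hN]
  linear_combination (-x * (x + c)) * h.eq

theorem flat₃_eq (h : NegRoot a b c x) :
    -(-1) * -c / x * ((1 - -(-1) * -c / x) * -c + -(-1) * -c / x * b) =
      (c / x) ^ 2 * (x + b + c) := by
  have hx := h.ne_zero
  field_simp
  ring

/-- For f = -1 no mirror can be flat: x = 1 and x = -c contradict the pivot equation, and away from
them the other two flatness factors have definite signs. -/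
theorem mem (h : NegRoot a b c x) : ((-a, b, -c), (x, -(-1) * -c / x)) ∈ focalE₂ (-1) := by
  have ha := h.a_pos
  have hb := h.b_pos
  have hc := h.c_pos
  have hx := h.ne_zero
  have hg₁ : g₁ (-1) (-c) x (-(-1) * -c / x) = 0 := by
    unfold g₁
    field_simp
    ring
  have hg₂ : g₂ (-a) b (-c) x (-(-1) * -c / x) = 0 := by
    unfold g₂
    field_simp
    linear_combination -c * h.eq
  refine mem_focalE₂.2 ⟨hg₁, hg₂, by linarith, hb, by linarith, sub_ne_zero.2 h.ne_one, ?_, ?_⟩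
  · have e := h.flat₂_eq
    intro h0
    rw [h0, mul_zero] at e
    have h₁ : b * x ^ 2 / ((x + c) ^ 2 + b * x) ≠ 0 :=
      div_ne_zero (mul_ne_zero hb.ne' (pow_ne_zero 2 hx)) h.fibre_pos.ne'
    have h₂ : b + (x + c) * (1 + c) ≠ 0 := by
      rcases h.ne_neg.lt_or_gt with h' | h'
      · exact (h.flat₂_neg_of_lt h').ne
      · exact (h.flat₂_pos_of_gt h').ne'
    exact mul_ne_zero h₁ (mul_ne_zero (sub_ne_zero.2 h.ne_one.symm) h₂) e.symm
  · have e := h.flat₃_eq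
    intro h0
    rw [h0, mul_zero] at e
    have h₁ : (c / x) ^ 2 ≠ 0 := pow_ne_zero 2 (div_ne_zero hc.ne' hx)
    have h₂ : x + b + c ≠ 0 := by
      rcases h.ne_neg.lt_or_gt with h' | h'
      · exact (h.add_neg_of_lt h').ne
      · linarith
    exact mul_ne_zero h₁ h₂ e.symm

theorem signature_of_order (h : NegRoot a b c x) (ν : Name) (ho : NegOrder c x ν) :
    focalS₂ ((-a, b, -c), (x, -(-1) * -c / x)) = ν.signature := by
  have hb := h.b_pos
  have hc := h.c_pos
  have hx := h.ne_zero
  have hN := h.fibre_pos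
  have e₁ : -(-1) * -c / x = -(c / x) := by ring
  rw [(focalS₂_eq h.mem).2.2]
  simp only [h.flat₂_eq, h.flat₃_eq]
  rw [e₁, sign_mul (b * x ^ 2 / _), sign_mul ((c / x) ^ 2),
    sign_pos (show 0 < b * x ^ 2 / ((x + c) ^ 2 + b * x) by positivity),
    sign_pos (show 0 < (c / x) ^ 2 by positivity), one_mul, one_mul, sign_mul (1 - x)]
  cases ν <;> simp only [NegOrder] at ho
  · have hw : 0 < -(c / x) := neg_pos.2 (div_neg_of_pos_of_neg hc (by linarith))
    rw [sign_neg (by linarith : x < 0), sign_pos hw, sign_pos (by linarith : 0 < 1 - x),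
      sign_pos (h.flat₂_pos_of_gt ho.1), sign_pos (by linarith)]
    rfl
  · have hw : 0 < -(c / x) := neg_pos.2 (div_neg_of_pos_of_neg hc (by linarith))
    rw [sign_neg (by linarith : x < 0), sign_pos hw, sign_pos (by linarith : 0 < 1 - x),
      sign_neg (h.flat₂_neg_of_lt ho), sign_neg (h.add_neg_of_lt ho)]
    rfl
  · have hw : -(c / x) < 0 := neg_neg_of_pos (div_pos hc ho.1)
    rw [sign_pos ho.1, sign_neg hw, sign_pos (by linarith : 0 < 1 - x),
      sign_pos (h.flat₂_pos_of_gt (by linarith)), sign_pos (by linarith)]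
    rfl
  · have hx : 0 < x := by linarith
    have hw : -(c / x) < 0 := neg_neg_of_pos (div_pos hc hx)
    rw [sign_pos hx, sign_neg hw, sign_neg (by linarith : 1 - x < 0),
      sign_pos (h.flat₂_pos_of_gt (by linarith)), sign_pos (by linarith)]
    rfl

theorem signature_iff (h : NegRoot a b c x) (ν : Name) :
    focalS₂ ((-a, b, -c), (x, -(-1) * -c / x)) = ν.signature ↔ NegOrder c x ν :=
  signature_iff_of_cover (h.exists_order.imp fun _ h => h.2) h.signature_of_order ν

/-- The slope of the pivot polynomial at a root. -/
theorem φ_mul (h : NegRoot a b c x) (w : ℝ) :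
    φ (-1) ((-a, b, -c), (x, w)) * ((x + c) ^ 2 + b * x) =
      b * c * ((x - 1) * (b * (x + 1) + 2 * (x + c) * (1 + c))) := by
  simp only [φ, A₁, B₁]
  linear_combination (-(2 * x + b + 2 * c)) * h.eq

theorem φ_neg (h : NegRoot a b c x) (w : ℝ) (h₁ : -c < x) (h₂ : x < 1) :
    φ (-1) ((-a, b, -c), (x, w)) < 0 := by
  have hb := h.b_pos
  have hc := h.c_pos
  have hN := h.fibre_pos
  have hk : 0 < x + c := by linarith
  have hM : 0 < b * (x + 1) + 2 * (x + c) * (1 + c) := by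
    rcases le_or_gt 0 (x + 1) with hx | hx
    · positivity
    · nlinarith
  have := mul_pos (mul_pos hb hc) (mul_pos (sub_pos.2 h₂) hM)
  by_contra! h0
  have := mul_nonneg h0 hN.le
  rw [h.φ_mul] at this
  linarith

theorem φ_pos_of_lt (h : NegRoot a b c x) (w : ℝ) (hx : x < -c) :
    0 < φ (-1) ((-a, b, -c), (x, w)) := by
  have hb := h.b_pos
  have hc := h.c_pos
  have hN := h.fibre_pos
  have hM : b * (x + 1) + 2 * (x + c) * (1 + c) < 0 := by
    have := h.add_neg_of_lt hx
    rcases le_or_gt 0 (x + 1) with hx | hx <;> nlinarith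
  have := mul_pos (mul_pos hb hc) (mul_pos_of_neg_of_neg (show x - 1 < 0 by linarith) hM)
  rw [← h.φ_mul w] at this
  exact pos_of_mul_pos_left this hN.le

theorem φ_pos_of_gt (h : NegRoot a b c x) (w : ℝ) (hx : 1 < x) :
    0 < φ (-1) ((-a, b, -c), (x, w)) := by
  have hb := h.b_pos
  have hc := h.c_pos
  have hN := h.fibre_pos
  have := mul_pos (mul_pos hb hc) (mul_pos (sub_pos.2 hx)
    (show 0 < b * (x + 1) + 2 * (x + c) * (1 + c) by positivity))
  rw [← h.φ_mul w] at this
  exact pos_of_mul_pos_left this hN.le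

theorem A₁_mul (h : NegRoot a b c x) :
    A₁ (-1) (-a) b (-c) * ((x + c) ^ 2 + b * x) =
      b * c * (b * x + (c + 1) * (2 * x + c - 1)) := by
  unfold A₁
  linear_combination -h.eq

theorem A₂_mul (h : NegRoot a b c x) :
    A₂ (-1) (-a) b (-c) * ((x + c) ^ 2 + b * x) =
      b * (x * (b + (1 + c) * (x * (1 - c) + 2 * c))) := by
  unfold A₂
  linear_combination -c * h.eq

theorem A₁_pos (h : NegRoot a b c x) (hx : 1 < x) : 0 < A₁ (-1) (-a) b (-c) := by
  have hb := h.b_pos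
  have hc := h.c_pos
  have : 0 < b * x + (c + 1) * (2 * x + c - 1) := by
    have := mul_pos (show 0 < c + 1 by linarith) (show 0 < 2 * x + c - 1 by linarith)
    nlinarith
  have := mul_pos (mul_pos hb hc) this
  rw [← h.A₁_mul] at this
  exact pos_of_mul_pos_left this h.fibre_pos.le

theorem A₁_neg (h : NegRoot a b c x) (hx : x < -c) : A₁ (-1) (-a) b (-c) < 0 := by
  have hb := h.b_pos
  have hc := h.c_pos
  have : b * x + (c + 1) * (2 * x + c - 1) < 0 := by nlinarith
  have := mul_neg_of_pos_of_neg (mul_pos hb hc) this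
  rw [← h.A₁_mul] at this
  by_contra! h0
  linarith [mul_nonneg h0 h.fibre_pos.le]

theorem A₂_aux (h : NegRoot a b c x) (h₁ : -c < x) (h₂ : x < 1) :
    0 < b + (1 + c) * (x * (1 - c) + 2 * c) := by
  have hb := h.b_pos
  have hc := h.c_pos
  have : 0 < x * (1 - c) + 2 * c := by
    rcases le_or_gt c 1 with h₃ | h₃ <;> nlinarith
  positivity

theorem A₂_pos (h : NegRoot a b c x) (h₁ : 0 < x) (h₂ : x < 1) : 0 < A₂ (-1) (-a) b (-c) := by
  have := mul_pos h.b_pos (mul_pos h₁ (h.A₂_aux (by linarith [h.c_pos]) h₂))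
  rw [← h.A₂_mul] at this
  exact pos_of_mul_pos_left this h.fibre_pos.le

theorem A₂_neg (h : NegRoot a b c x) (h₁ : -c < x) (h₂ : x < 0) : A₂ (-1) (-a) b (-c) < 0 := by
  have := mul_neg_of_pos_of_neg h.b_pos (mul_neg_of_neg_of_pos h₂ (h.A₂_aux h₁ (by linarith)))
  rw [← h.A₂_mul] at this
  by_contra! h0
  linarith [mul_nonneg h0 h.fibre_pos.le]

/-- The slope is negative for -c < x < 1 and positive outside [-c, 1]. So the branch separates the
inner pair of names from the outer pair, and the sign of A₂ or A₁ separates the two names of a pair.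
-/
theorem negMinus_of_order (h : NegRoot a b c x) (w : ℝ)
    (hφ : φ (-1) ((-a, b, -c), (x, w)) ≤ 0) (ν : Name) (ho : NegOrder c x ν) :
    NegMinus (-a) b (-c) ν := by
  cases ν <;> simp only [NegOrder] at ho
  · exact h.A₂_neg ho.1 ho.2
  · exact absurd (h.φ_pos_of_lt w ho) hφ.not_gt
  · exact h.A₂_pos ho.1 ho.2
  · exact absurd (h.φ_pos_of_gt w ho) hφ.not_gt

theorem negPlus_of_order (h : NegRoot a b c x) (w : ℝ)
    (hφ : 0 ≤ φ (-1) ((-a, b, -c), (x, w))) (ν : Name) (ho : NegOrder c x ν) :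
    NegPlus (-a) b (-c) ν := by
  have hc := h.c_pos
  cases ν <;> simp only [NegOrder] at ho
  · exact absurd (h.φ_neg w ho.1 (by linarith)) hφ.not_gt
  · exact h.A₁_neg ho
  · exact absurd (h.φ_neg w (by linarith) ho.2) hφ.not_gt
  · exact h.A₁_pos ho

end NegRoot

/-- Disjointness of the regions turns the implication from order to region into an equivalence. -/
theorem NegMinus.unique {d₁ d₂ d₃ : ℝ} {μ ν : Name} (h : NegMinus d₁ d₂ d₃ μ)
    (h' : NegMinus d₁ d₂ d₃ ν) : μ = ν := by
  cases μ <;> simp only [NegMinus] at h <;> cases ν <;> simp only [NegMinus] at h' <;>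
    first | rfl | linarith

theorem NegPlus.unique {d₁ d₂ d₃ : ℝ} {μ ν : Name} (h : NegPlus d₁ d₂ d₃ μ)
    (h' : NegPlus d₁ d₂ d₃ ν) : μ = ν := by
  cases μ <;> simp only [NegPlus] at h <;> cases ν <;> simp only [NegPlus] at h' <;>
    first | rfl | linarith

theorem negRoot_of_pivot {a b c x : ℝ} (ha : 0 < a) (hb : 0 < b) (hc : 0 < c) (hx : x ≠ 0)
    (h : A₁ (-1) (-a) b (-c) * x ^ 2 + B₁ (-1) (-a) b (-c) * x + C₁ (-1) (-a) b (-c) = 0) :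
    NegRoot a b c x := by
  unfold A₁ B₁ C₁ at h
  exact ⟨ha, hb, hc, hx, by linear_combination -h⟩

theorem exists_of_mem_focalE₂_neg_one {p : (ℝ × ℝ × ℝ) × (ℝ × ℝ)} (hp : p ∈ focalE₂ (-1)) :
    ∃ a b c x : ℝ, NegRoot a b c x ∧ p = ((-a, b, -c), (x, -(-1) * -c / x)) := by
  obtain ⟨⟨d₁, d₂, d₃⟩, x, w⟩ := p
  obtain ⟨a, rfl⟩ : ∃ a, d₁ = -a := ⟨-d₁, by ring⟩
  obtain ⟨c, rfl⟩ : ∃ c, d₃ = -c := ⟨-d₃, by ring⟩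
  obtain ⟨hP, rfl⟩ := pivot_of_mem (by norm_num) hp
  obtain ⟨-, -, ha, hb, hc, -⟩ := mem_focalE₂.1 hp
  exact ⟨a, d₂, c, x, negRoot_of_pivot (by linarith) hb (by linarith) (focalS₂_eq hp).1 hP, rfl⟩

theorem Δ_neg_one_pos {a b c : ℝ} (ha : 0 < a) (hb : 0 < b) (hc : 0 < c) :
    0 < Δ (-1) (-a) b (-c) := by
  have : Δ (-1) (-a) b (-c) = a ^ 2 * b ^ 2 + 4 * a ^ 2 * b * c + 4 * a * b ^ 2 * c +
      8 * a * b * c ^ 2 + 4 * a * b * c ^ 3 + 4 * a * b * c := by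
    unfold Δ A₁ B₁ C₁
    ring
  rw [this]
  positivity

theorem B₁_neg_one_neg {a b c : ℝ} (ha : 0 < a) (hb : 0 < b) (hc : 0 < c) :
    B₁ (-1) (-a) b (-c) < 0 := by
  have : B₁ (-1) (-a) b (-c) = -(a * b + 2 * a * c + 2 * b * c) := by
    unfold B₁
    ring
  rw [this, neg_lt_zero]
  positivity

/-- Two degenerations must be kept off the branch: A₁ = 0, where one root is lost to infinity, and
C₁ = 0, where a root is the inadmissible x = 0, with slope B₁. -/
theorem isBranchSection_neg_one {ε : ℝ} (hε : ε ^ 2 = 1) {P : ℝ → ℝ → ℝ → Name → Prop} (ν : Name)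
    (h0 : ∀ {a b c : ℝ}, 0 < a → 0 < b → 0 < c → P (-a) b (-c) ν → A₁ (-1) (-a) b (-c) = 0 →
      0 < ε * B₁ (-1) (-a) b (-c))
    (hP : ∀ {a b c : ℝ}, 0 < a → 0 < b → 0 < c → P (-a) b (-c) ν → C₁ (-1) (-a) b (-c) = 0 →
      ε * B₁ (-1) (-a) b (-c) < 0) :
    IsBranchSection (focalE₂ (-1)) (φ (-1)) ε (region P ν) (branch (-1) ε) := by
  have hcoord : ∀ d₁ d₂ d₃ : ℝ, (d₁, d₂, d₃) ∈ region P ν → ∃ a c : ℝ, 0 < a ∧ 0 < d₂ ∧ 0 < c ∧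
      d₁ = -a ∧ d₃ = -c ∧ P (-a) d₂ (-c) ν := fun d₁ d₂ d₃ ⟨h₁, h₂, h₃, h⟩ =>
    ⟨-d₁, -d₃, neg_pos.2 h₁, h₂, neg_pos.2 h₃, by ring, by ring, by simpa using h⟩
  refine isBranchSection (by norm_num) hε ?_ ?_ ?_
  · rintro ⟨d₁, d₂, d₃⟩ hy
    obtain ⟨a, c, ha, hb, hc, rfl, rfl, -⟩ := hcoord _ _ _ hy
    exact (Δ_neg_one_pos ha hb hc).le
  · rintro ⟨d₁, d₂, d₃⟩ hy
    obtain ⟨a, c, ha, hb, hc, rfl, rfl, h⟩ := hcoord _ _ _ hy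
    exact h0 ha hb hc h
  · rintro d₁ d₂ d₃ x hy hx hφ
    obtain ⟨a, c, ha, hb, hc, rfl, rfl, h⟩ := hcoord _ _ _ hy
    refine (negRoot_of_pivot ha hb hc ?_ hx).mem
    rintro rfl
    have := hP ha hb hc h (by simpa using hx)
    simp only [mul_zero, zero_add] at hφ
    linarith

/-! ### Path connectedness of the level sets -/

def negDomain (ν : Name) : Set ((ℝ × ℝ) × ℝ) :=
  {q | 0 < q.1.1 ∧ 0 < q.2 ∧ 0 < (q.1.2 + q.1.1) ^ 2 + q.2 * q.1.2 ∧ NegOrder q.1.1 q.1.2 ν}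

def negMap (q : (ℝ × ℝ) × ℝ) : (ℝ × ℝ × ℝ) × (ℝ × ℝ) :=
  ((-(q.2 * q.1.1 * (q.1.2 - 1) ^ 2 / ((q.1.2 + q.1.1) ^ 2 + q.2 * q.1.2)), q.2, -q.1.1),
    (q.1.2, -(-1) * -q.1.1 / q.1.2))

theorem NegOrder.ne {c x : ℝ} {ν : Name} (hc : 0 < c) (h : NegOrder c x ν) : x ≠ 0 ∧ x ≠ 1 := by
  cases ν <;> simp only [NegOrder] at h <;> constructor <;> rintro rfl <;> linarith

theorem levelSet_neg_one_eq (ν : Name) :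
    {p | p ∈ focalE₂ (-1) ∧ focalS₂ p = ν.signature} = negMap '' negDomain ν := by
  ext p
  constructor
  · rintro ⟨hp, hs⟩
    obtain ⟨a, b, c, x, h, rfl⟩ := exists_of_mem_focalE₂_neg_one hp
    refine ⟨((c, x), b), ⟨h.c_pos, h.b_pos, h.fibre_pos, (h.signature_iff ν).1 hs⟩, ?_⟩
    have : b * c * (x - 1) ^ 2 / ((x + c) ^ 2 + b * x) = a := by
      rw [div_eq_iff h.fibre_pos.ne', h.eq]
    simp only [negMap, this]
  · rintro ⟨⟨⟨c, x⟩, b⟩, ⟨hc, hb, hN, ho⟩, rfl⟩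
    simp only at hc hb hN ho
    obtain ⟨hx0, hx1⟩ := ho.ne hc
    have hx2 : 0 < (x - 1) ^ 2 := by
      have := sub_ne_zero.2 hx1
      positivity
    have h : NegRoot (b * c * (x - 1) ^ 2 / ((x + c) ^ 2 + b * x)) b c x :=
      ⟨by positivity, hb, hc, hx0, div_mul_cancel₀ _ hN.ne'⟩
    exact ⟨h.mem, (h.signature_iff ν).2 ho⟩

theorem negDomain_ordConnected (ν : Name) (y : ℝ × ℝ) (u v t : ℝ) (hu : (y, u) ∈ negDomain ν)
    (hv : (y, v) ∈ negDomain ν) (hut : u ≤ t) (htv : t ≤ v) : (y, t) ∈ negDomain ν := by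
  obtain ⟨hc, hu, hN, hs⟩ := hu
  obtain ⟨-, hv, hN', -⟩ := hv
  simp only at hc hu hN hs hv hN'
  refine ⟨hc, hu.trans_le hut, ?_, hs⟩
  -- The constraint is affine in b, increasing or decreasing with the sign of x, so one endpoint
  -- implies it in between.
  rcases le_total 0 y.2 with hx | hx
  · exact hN.trans_le (by nlinarith)
  · exact hN'.trans_le (by nlinarith)

theorem isPathConnected_negDomain_of_section {ν : Name} {s : ℝ → ℝ → ℝ}
    (hB : IsPathConnected {y : ℝ × ℝ | 0 < y.1 ∧ NegOrder y.1 y.2 ν})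
    (hs : ContinuousOn (fun y : ℝ × ℝ => s y.1 y.2) {y : ℝ × ℝ | 0 < y.1 ∧ NegOrder y.1 y.2 ν})
    (hsec : ∀ c x, 0 < c → NegOrder c x ν → 0 < s c x ∧ 0 < (x + c) ^ 2 + s c x * x) :
    IsPathConnected (negDomain ν) :=
  isPathConnected_of_section hB hs (fun _ hp => ⟨hp.1, hp.2.2.2⟩)
    (fun y hy => ⟨hy.1, (hsec y.1 y.2 hy.1 hy.2).1, (hsec y.1 y.2 hy.1 hy.2).2, hy.2⟩)
    (negDomain_ordConnected ν)

theorem isPathConnected_negDomain {ν : Name}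
    (hν : ν ∈ ({.NP101, .PN101, .NP110, .PN011} : Set Name)) :
    IsPathConnected (negDomain ν) := by
  -- For x < 0 the admissible b are those below (x + c)² / (-x); half of this bound serves as
  -- section. For x > 0 every b > 0 works.
  have hhalf : ∀ c x : ℝ, x < 0 → x + c ≠ 0 → 0 < (x + c) ^ 2 / (-2 * x) ∧
      0 < (x + c) ^ 2 + (x + c) ^ 2 / (-2 * x) * x := by
    intro c x hx hk
    have hk2 : 0 < (x + c) ^ 2 := by positivity
    refine ⟨div_pos hk2 (by linarith), ?_⟩
    have : (x + c) ^ 2 / (-2 * x) * x = -((x + c) ^ 2 / 2) := by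
      have := hx.ne
      field_simp
    rw [this]
    linarith
  simp only [mem_insert_iff, mem_singleton_iff] at hν
  rcases hν with rfl | rfl | rfl | rfl
  · refine isPathConnected_negDomain_of_section (s := fun c x => (x + c) ^ 2 / (-2 * x))
      (Convex.isPathConnected ?_ ⟨(2, -1), by norm_num [NegOrder]⟩) ?_ ?_
    · rintro ⟨c, x⟩ ⟨h₁, h₂, h₃⟩ ⟨c', x'⟩ ⟨h₁', h₂', h₃'⟩ s t hs ht hst
      have k₁ := add_mul_lt h₁ h₁' hs ht hst
      have k₂ := add_mul_lt h₂ h₂' hs ht hst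
      have k₃ := add_mul_lt h₃ h₃' hs ht hst
      refine ⟨by simpa using k₁, ?_, by simpa using k₃⟩
      simp only [Prod.smul_mk, smul_eq_mul, Prod.mk_add_mk]
      linarith
    · exact ContinuousOn.div (by fun_prop) (by fun_prop) fun y hy =>
        mul_ne_zero (by norm_num) hy.2.2.ne
    · exact fun c x hc hx => hhalf c x hx.2 (by linarith [hx.1])
  · refine isPathConnected_negDomain_of_section (s := fun _ _ => 1)
      (Convex.isPathConnected ?_ ⟨(1, 1 / 2), by norm_num [NegOrder]⟩) continuousOn_const ?_
    · rintro ⟨c, x⟩ ⟨h₁, h₂, h₃⟩ ⟨c', x'⟩ ⟨h₁', h₂', h₃'⟩ s t hs ht hst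
      have k₁ := add_mul_lt h₁ h₁' hs ht hst
      have k₂ := add_mul_lt h₂ h₂' hs ht hst
      have k₃ := add_mul_lt h₃ h₃' hs ht hst
      exact ⟨by simpa using k₁, by simpa using k₂, by simpa [hst] using k₃⟩
    · intro c x hc hx
      have := hx.1
      exact ⟨one_pos, by positivity⟩
  · refine isPathConnected_negDomain_of_section (s := fun c x => (x + c) ^ 2 / (-2 * x))
      (Convex.isPathConnected ?_ ⟨(1, -2), by norm_num [NegOrder]⟩) ?_ ?_
    · rintro ⟨c, x⟩ ⟨h₁, h₂⟩ ⟨c', x'⟩ ⟨h₁', h₂'⟩ s t hs ht hst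
      have k₁ := add_mul_lt h₁ h₁' hs ht hst
      have k₂ := add_mul_lt h₂ h₂' hs ht hst
      refine ⟨by simpa using k₁, ?_⟩
      simp only [NegOrder, Prod.smul_mk, smul_eq_mul, Prod.mk_add_mk]
      linarith
    · refine ContinuousOn.div (by fun_prop) (by fun_prop) fun y hy =>
        mul_ne_zero (by norm_num) ?_
      have h₁ := hy.1
      have h₂ : y.2 < -y.1 := hy.2
      exact (by linarith : y.2 < 0).ne
    · intro c x hc hx
      have : x < -c := hx
      exact hhalf c x (by linarith) (by linarith)
  · refine isPathConnected_negDomain_of_section (s := fun _ _ => 1)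
      (Convex.isPathConnected ?_ ⟨(1, 2), by norm_num [NegOrder]⟩) continuousOn_const ?_
    · rintro ⟨c, x⟩ ⟨h₁, h₂⟩ ⟨c', x'⟩ ⟨h₁', h₂'⟩ s t hs ht hst
      have k₁ := add_mul_lt h₁ h₁' hs ht hst
      have k₂ := add_mul_lt h₂ h₂' hs ht hst
      exact ⟨by simpa using k₁, by simpa [NegOrder, hst] using k₂⟩
    · intro c x hc hx
      have : 1 < x := hx
      exact ⟨one_pos, by positivity⟩

theorem continuousOn_negMap (ν : Name) : ContinuousOn negMap (negDomain ν) := by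
  unfold negMap
  refine ContinuousOn.prodMk (ContinuousOn.prodMk (ContinuousOn.neg (ContinuousOn.div (by fun_prop)
    (by fun_prop) fun q hq => hq.2.2.1.ne')) (by fun_prop))
    (ContinuousOn.prodMk (by fun_prop) (ContinuousOn.div (by fun_prop) (by fun_prop)
    fun q hq => (hq.2.2.2.ne hq.1).1))

theorem classification_neg_one :
    TwoBranchClassification (focalE₂ (-1)) focalS₂ (φ (-1)) (region NegMinus) (region NegPlus)
      {.NP101, .PN101, .NP110, .PN011} 4 := by
  refine .of_levelSets (continuousOn_focalS₂ (-1)) ?_ (fun ν hν => ?_) ?_ ?_ ?_ ?_ ?_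
  · intro p hp
    obtain ⟨a, b, c, x, h, rfl⟩ := exists_of_mem_focalE₂_neg_one hp
    exact h.exists_order.imp fun ν h' => ⟨h'.1, (h.signature_iff ν).2 h'.2⟩
  · rw [levelSet_neg_one_eq]
    exact (isPathConnected_negDomain hν).image' (continuousOn_negMap ν)
  · iterate 3 rw [ncard_insert_of_notMem (by simp)]
    simp
  · rintro p hp hφ ν -
    obtain ⟨a, b, c, x, h, rfl⟩ := exists_of_mem_focalE₂_neg_one hp
    rw [h.signature_iff]
    constructor
    · rintro ⟨-, -, -, hR⟩
      obtain ⟨μ, -, hμ⟩ := h.exists_order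
      rwa [← (h.negMinus_of_order _ hφ μ hμ).unique hR]
    · exact fun ho => ⟨neg_lt_zero.2 h.a_pos, h.b_pos, neg_lt_zero.2 h.c_pos,
        h.negMinus_of_order _ hφ ν ho⟩
  · rintro p hp hφ ν -
    obtain ⟨a, b, c, x, h, rfl⟩ := exists_of_mem_focalE₂_neg_one hp
    rw [h.signature_iff]
    constructor
    · rintro ⟨-, -, -, hR⟩
      obtain ⟨μ, -, hμ⟩ := h.exists_order
      rwa [← (h.negPlus_of_order _ hφ μ hμ).unique hR]
    · exact fun ho => ⟨neg_lt_zero.2 h.a_pos, h.b_pos, neg_lt_zero.2 h.c_pos,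
        h.negPlus_of_order _ hφ ν ho⟩
  · refine fun ν _ => ⟨_, isBranchSection_neg_one (by norm_num) ν
      (fun ha hb hc _ _ => by linarith [B₁_neg_one_neg ha hb hc]) fun ha hb hc h hC => ?_⟩
    rename_i a b c
    have e : C₁ (-1) (-a) b (-c) = c * A₂ (-1) (-a) b (-c) := by
      unfold C₁ A₂
      ring
    have : A₂ (-1) (-a) b (-c) = 0 := by simpa [e, hc.ne'] using hC
    cases ν <;> simp only [NegMinus] at h <;> linarith
  · refine fun ν _ => ⟨_, isBranchSection_neg_one (by norm_num) ν
      (fun ha hb hc h hA => ?_) fun ha hb hc _ _ => by linarith [B₁_neg_one_neg ha hb hc]⟩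
    cases ν <;> simp only [NegPlus] at h <;> linarith

end Focal₂

/-! ## Afocal telescopes: a rational parametrization by `G` and `z = (1 - G) / (Ω₁ - 1)` -/

namespace Afocal

/-- With G = Ω₁Ω₂, the Petzval condition is -G d₂ = (Ω₁(1 - Ω₂)/(Ω₁ - 1))², and the quantity squared
is 1 + z. The parameter z removes the square root. -/
def Ω₁ (G z : ℝ) : ℝ := (z + 1 - G) / z
def Ω₂ (G z : ℝ) : ℝ := G * z / (z + 1 - G)
def D₂ (G z : ℝ) : ℝ := -(1 + z) ^ 2 / G

/-- The values of the parameters at which no mirror is flat. -/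
structure Regular (G z : ℝ) : Prop where
  neg : G < 0
  ne_zero : z ≠ 0
  ne_neg_one : 1 + z ≠ 0
  ne_sub_one : z + 1 - G ≠ 0

/-- The position of the parameter that `ν` encodes. -/
def Order (G z : ℝ) : Name → Prop
  | .NP110 => -1 < z ∧ z < 0
  | .NP101 => G - 1 < z ∧ z < -1
  | .PN101 => z < G - 1
  | .PN011 => 0 < z
  | _ => False

variable {G z : ℝ}

theorem Order.regular {ν : Name} (hG : G < 0) (h : Order G z ν) : Regular G z := by
  refine ⟨hG, ?_, ?_, ?_⟩ <;> cases ν <;> simp only [Order] at h <;> intro h0 <;> linarith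

namespace Regular

theorem exists_order (h : Regular G z) :
    ∃ ν ∈ ({.NP110, .NP101, .PN101, .PN011} : Set Name), Order G z ν := by
  have hG := h.neg
  rcases h.ne_zero.lt_or_gt with h₁ | h₁
  · rcases h.ne_neg_one.lt_or_gt with h₂ | h₂
    · rcases h.ne_sub_one.lt_or_gt with h₃ | h₃
      · exact ⟨.PN101, by simp, show z < G - 1 by linarith⟩
      · exact ⟨.NP101, by simp, by linarith, by linarith⟩
    · exact ⟨.NP110, by simp, by linarith, h₁⟩
  · exact ⟨.PN011, by simp, h₁⟩

theorem D₂_pos (h : Regular G z) : 0 < D₂ G z := by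
  have : 0 < (1 + z) ^ 2 := by
    have := h.ne_neg_one
    positivity
  exact div_pos_of_neg_of_neg (by linarith) h.neg

theorem h₁_eq (h : Regular G z) : h₁ G (Ω₁ G z) (Ω₂ G z) = 0 := by
  have := h.ne_zero
  have := h.ne_sub_one
  unfold h₁ Ω₁ Ω₂
  field_simp
  ring

theorem h₂_eq (h : Regular G z) : h₂ (-1) (D₂ G z) (Ω₁ G z) (Ω₂ G z) = 0 := by
  have := h.ne_zero
  have := h.ne_sub_one
  have := h.neg.ne
  unfold h₂ Ω₁ Ω₂ D₂
  field_simp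
  ring

theorem Ω₁_sub_one (h : Regular G z) : 1 - Ω₁ G z = (G - 1) / z := by
  have := h.ne_zero
  unfold Ω₁
  field_simp
  ring

theorem Ω₁_ne (h : Regular G z) : Ω₁ G z ≠ 0 := div_ne_zero h.ne_sub_one h.ne_zero

theorem Ω₂_ne (h : Regular G z) : Ω₂ G z ≠ 0 :=
  div_ne_zero (mul_ne_zero h.neg.ne h.ne_zero) h.ne_sub_one

theorem flat₂_eq (h : Regular G z) :
    Ω₁ G z * (Ω₁ G z * (-1 - D₂ G z) + D₂ G z - Ω₂ G z * Ω₁ G z * -1) =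
      -(Ω₁ G z ^ 2 * ((1 - G) / -G) * (1 + z)) := by
  have := h.ne_zero
  have := h.ne_sub_one
  have := h.neg.ne
  unfold Ω₁ Ω₂ D₂
  field_simp
  ring

theorem flat₃_eq (h : Regular G z) :
    Ω₂ G z * (Ω₂ G z - 1) = -G * (1 - G) / (z + 1 - G) ^ 2 * (z * (1 + z)) := by
  have := h.ne_sub_one
  unfold Ω₂
  field_simp
  ring

theorem nonflat (h : Regular G z) : AfocalNonflat (-1) (D₂ G z) (Ω₁ G z) (Ω₂ G z) := by
  have hG := h.neg
  have hz := h.ne_zero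
  have hz1 := h.ne_neg_one
  have h1G : 1 - G ≠ 0 := by linarith
  refine ⟨fun h0 => ?_, fun h0 => ?_, fun h0 => ?_⟩
  · have e := h.Ω₁_sub_one
    rw [show 1 - Ω₁ G z = 0 by linarith] at e
    exact div_ne_zero (by linarith) hz e.symm
  · have e := h.flat₂_eq
    rw [h0, mul_zero] at e
    exact neg_ne_zero.2 (mul_ne_zero (mul_ne_zero (pow_ne_zero 2 h.Ω₁_ne)
      (div_ne_zero h1G (neg_ne_zero.2 hG.ne))) hz1) e.symm
  · have e := h.flat₃_eq
    rw [h0, mul_zero] at e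
    exact mul_ne_zero (div_ne_zero (mul_ne_zero (neg_ne_zero.2 hG.ne) h1G)
      (pow_ne_zero 2 h.ne_sub_one)) (mul_ne_zero hz hz1) e.symm

/-- Up to positive factors the three curvature signs are those of -z, 1 + z and z (1 + z), while the
magnifications can change sign only at 0 and G - 1. -/
theorem signature_of_order (h : Regular G z) (ν : Name) (ho : Order G z ν) :
    signature (-1) (D₂ G z) 0 (Ω₁ G z) (Ω₂ G z) = ν.signature := by
  have hG := h.neg
  have hp₂ : 0 < Ω₁ G z ^ 2 * ((1 - G) / -G) := by
    have := h.Ω₁_ne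
    have : 0 < (1 - G) / -G := div_pos (by linarith) (by linarith)
    positivity
  have hp₃ : 0 < -G * (1 - G) / (z + 1 - G) ^ 2 := by
    have := h.ne_sub_one
    have : 0 < -G * (1 - G) := mul_pos (by linarith) (by linarith)
    positivity
  rw [signature_afocal (by norm_num) h.D₂_pos h.Ω₁_ne h.Ω₂_ne, h.flat₂_eq, h.flat₃_eq,
    h.Ω₁_sub_one, Left.sign_neg, neg_neg, sign_mul (Ω₁ G z ^ 2 * _), sign_mul (-G * _ / _),
    sign_pos hp₂, sign_pos hp₃, one_mul, one_mul, sign_mul z, Ω₁, Ω₂]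
  cases ν <;> simp only [Order] at ho
  · have h₀ : 0 < z + 1 - G := by linarith
    have h₁ : z < 0 := by linarith
    rw [sign_neg (div_neg_of_pos_of_neg h₀ h₁), sign_pos (div_pos (mul_pos_of_neg_of_neg hG h₁) h₀),
      sign_pos (div_pos_of_neg_of_neg (by linarith) h₁), sign_neg (by linarith : 1 + z < 0),
      sign_neg h₁]
    rfl
  · have h₀ : 0 < z + 1 - G := by linarith
    rw [sign_neg (div_neg_of_pos_of_neg h₀ ho.2),
      sign_pos (div_pos (mul_pos_of_neg_of_neg hG ho.2) h₀),
      sign_pos (div_pos_of_neg_of_neg (by linarith) ho.2), sign_pos (by linarith : 0 < 1 + z),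
      sign_neg ho.2]
    rfl
  · have h₀ : z + 1 - G < 0 := by linarith
    have h₁ : z < 0 := by linarith
    rw [sign_pos (div_pos_of_neg_of_neg h₀ h₁),
      sign_neg (div_neg_of_pos_of_neg (mul_pos_of_neg_of_neg hG h₁) h₀),
      sign_pos (div_pos_of_neg_of_neg (by linarith) h₁), sign_neg (by linarith : 1 + z < 0),
      sign_neg h₁]
    rfl
  · have h₀ : 0 < z + 1 - G := by linarith
    rw [sign_pos (div_pos h₀ ho), sign_neg (div_neg_of_neg_of_pos (mul_neg_of_neg_of_pos hG ho) h₀),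
      sign_neg (div_neg_of_neg_of_pos (by linarith) ho), sign_pos (by linarith : 0 < 1 + z),
      sign_pos ho]
    rfl

theorem signature_iff (h : Regular G z) (ν : Name) :
    signature (-1) (D₂ G z) 0 (Ω₁ G z) (Ω₂ G z) = ν.signature ↔ Order G z ν :=
  signature_iff_of_cover (h.exists_order.imp fun _ h => h.2) h.signature_of_order ν

end Regular

theorem exists_regular {G d₂ x w : ℝ} (hg : h₁ G x w = 0) (hp : h₂ (-1) d₂ x w = 0)
    (hd : 0 < d₂) (hG : G ≠ 0) (hn : AfocalNonflat (-1) d₂ x w) :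
    ∃ z, Regular G z ∧ d₂ = D₂ G z ∧ x = Ω₁ G z ∧ w = Ω₂ G z := by
  unfold h₁ at hg
  unfold h₂ at hp
  obtain ⟨hx1, -, hw1⟩ := hn
  obtain rfl : G = x * w := by linarith
  have hx : x ≠ 0 := left_ne_zero_of_mul hG
  have hw : w ≠ 0 := right_ne_zero_of_mul hG
  have hp' : (1 - x) ^ 2 * w ^ 2 * d₂ = (1 - w) ^ 2 * -(x * w) := by linear_combination w * hp
  -- After multiplication by w the left side of the Petzval condition is positive, which forces G =
  -- x w to be negative.
  have hneg : x * w < 0 := by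
    have h₁ : 0 < (1 - x) ^ 2 * w ^ 2 * d₂ := by
      have := sub_ne_zero.2 (sub_ne_zero.1 hx1).symm
      positivity
    rw [hp'] at h₁
    linarith [pos_of_mul_pos_right h₁ (sq_nonneg _)]
  have h1G : 1 - x * w ≠ 0 := by linarith
  have e₁ : (1 - x * w) / (x - 1) + 1 - x * w = x * ((1 - x * w) / (x - 1)) := by
    field_simp
    ring
  have e₂ : 1 + (1 - x * w) / (x - 1) = x * (1 - w) / (x - 1) := by
    field_simp
    ring
  have hz : (1 - x * w) / (x - 1) ≠ 0 := div_ne_zero h1G hx1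
  refine ⟨(1 - x * w) / (x - 1), ⟨hneg, hz, ?_, ?_⟩, ?_, ?_, ?_⟩
  · rw [e₂]
    exact div_ne_zero (mul_ne_zero hx (by intro h; exact hw1 (by linarith))) hx1
  · rw [e₁]
    exact mul_ne_zero hx hz
  · rw [D₂, e₂]
    field_simp
    linear_combination hp
  · rw [Ω₁, e₁, mul_div_cancel_right₀ _ hz]
  · rw [Ω₂, e₁, mul_div_mul_right _ _ hz, mul_div_cancel_left₀ _ hx]

theorem continuousOn_Ω₁ {Y : Type*} [TopologicalSpace Y] {R : Set Y} {g ζ : Y → ℝ}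
    (hg : ContinuousOn g R) (hζ : ContinuousOn ζ R) (h : ∀ y ∈ R, Regular (g y) (ζ y)) :
    ContinuousOn (fun y => Ω₁ (g y) (ζ y)) R :=
  ((hζ.add continuousOn_const).sub hg).div hζ fun y hy => (h y hy).ne_zero

theorem continuousOn_Ω₂ {Y : Type*} [TopologicalSpace Y] {R : Set Y} {g ζ : Y → ℝ}
    (hg : ContinuousOn g R) (hζ : ContinuousOn ζ R) (h : ∀ y ∈ R, Regular (g y) (ζ y)) :
    ContinuousOn (fun y => Ω₂ (g y) (ζ y)) R :=
  (hg.mul hζ).div ((hζ.add continuousOn_const).sub hg) fun y hy => (h y hy).ne_sub_one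

theorem continuousOn_D₂ {Y : Type*} [TopologicalSpace Y] {R : Set Y} {g ζ : Y → ℝ}
    (hg : ContinuousOn g R) (hζ : ContinuousOn ζ R) (h : ∀ y ∈ R, Regular (g y) (ζ y)) :
    ContinuousOn (fun y => D₂ (g y) (ζ y)) R :=
  ((continuousOn_const.add hζ).pow 2).neg.div hg fun y hy => (h y hy).neg.ne

/-- The parameter domain of a level set of the signature. -/
def domain (ν : Name) : Set (ℝ × ℝ) := {y | y.1 < 0 ∧ Order y.1 y.2 ν}

theorem isPathConnected_domain {ν : Name}
    (hν : ν ∈ ({.NP110, .NP101, .PN101, .PN011} : Set Name)) : IsPathConnected (domain ν) := by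
  simp only [mem_insert_iff, mem_singleton_iff] at hν
  rcases hν with rfl | rfl | rfl | rfl
  · refine Convex.isPathConnected ?_ ⟨(-1, -1 / 2), by norm_num, by norm_num, by norm_num⟩
    rintro ⟨c, x⟩ ⟨h₁, h₂, h₃⟩ ⟨c', x'⟩ ⟨h₁', h₂', h₃'⟩ s t hs ht hst
    have k₁ := add_mul_lt h₁ h₁' hs ht hst
    have k₂ := add_mul_lt h₂ h₂' hs ht hst
    have k₃ := add_mul_lt h₃ h₃' hs ht hst
    refine ⟨by simpa using k₁, ?_, by simpa using k₃⟩
    simp only [Prod.smul_mk, smul_eq_mul, Prod.mk_add_mk]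
    linarith
  · refine Convex.isPathConnected ?_ ⟨(-1, -3 / 2), by norm_num, by norm_num, by norm_num⟩
    rintro ⟨c, x⟩ ⟨h₁, h₂, h₃⟩ ⟨c', x'⟩ ⟨h₁', h₂', h₃'⟩ s t hs ht hst
    have k₁ := add_mul_lt h₁ h₁' hs ht hst
    have k₂ := add_mul_lt h₂ h₂' hs ht hst
    have k₃ := add_mul_lt h₃ h₃' hs ht hst
    refine ⟨by simpa using k₁, ?_, ?_⟩ <;>
      simp only [Prod.smul_mk, smul_eq_mul, Prod.mk_add_mk] at * <;> linarith
  · refine Convex.isPathConnected ?_ ⟨(-1, -3), by norm_num, by norm_num [Order]⟩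
    rintro ⟨c, x⟩ ⟨h₁, h₂⟩ ⟨c', x'⟩ ⟨h₁', h₂'⟩ s t hs ht hst
    have k₁ := add_mul_lt h₁ h₁' hs ht hst
    have k₂ := add_mul_lt h₂ h₂' hs ht hst
    refine ⟨by simpa using k₁, ?_⟩
    simp only [Order, Prod.smul_mk, smul_eq_mul, Prod.mk_add_mk] at *
    linarith
  · refine Convex.isPathConnected ?_ ⟨(-1, 1), by norm_num, by norm_num [Order]⟩
    rintro ⟨c, x⟩ ⟨h₁, h₂⟩ ⟨c', x'⟩ ⟨h₁', h₂'⟩ s t hs ht hst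
    have k₁ := add_mul_lt h₁ h₁' hs ht hst
    have k₂ := add_mul_lt h₂ h₂' hs ht hst
    exact ⟨by simpa using k₁, by simpa [Order] using k₂⟩

theorem regular_of_mem_domain {ν : Name} {y : ℝ × ℝ} (hy : y ∈ domain ν) : Regular y.1 y.2 :=
  hy.2.regular hy.1

end Afocal

/-! ## Afocal telescopes in codimension 2 -/

open Afocal

theorem mem_afocalE₂ {G d₂ x w : ℝ} : ((G, d₂), (x, w)) ∈ afocalE₂ ↔
    h₁ G x w = 0 ∧ h₂ (-1) d₂ x w = 0 ∧ 0 < d₂ ∧ G ≠ 0 ∧ AfocalNonflat (-1) d₂ x w := by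
  constructor
  · rintro ⟨_, _, _, _, h, h'⟩
    simp only [Prod.mk.injEq] at h
    obtain ⟨⟨rfl, rfl⟩, rfl, rfl⟩ := h
    exact h'
  · exact fun h => ⟨_, _, _, _, rfl, h⟩

theorem continuousOn_afocal_signature {Z : Type*} [TopologicalSpace Z] {E : Set Z}
    {d₂ x w : Z → ℝ} (hd : Continuous d₂) (hx : Continuous x) (hw : Continuous w)
    (h : ∀ p ∈ E, 0 < d₂ p ∧ x p ≠ 0 ∧ w p ≠ 0 ∧ AfocalNonflat (-1) (d₂ p) (x p) (w p)) :
    ContinuousOn (fun p => signature (-1) (d₂ p) 0 (x p) (w p)) E := by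
  refine (continuousOn_signs (f₁ := x) (f₂ := w) (f₃ := fun p => 1 - x p)
    (f₄ := fun p => x p * (x p * (-1 - d₂ p) + d₂ p - w p * x p * -1))
    (f₅ := fun p => w p * (w p - 1)) hx hw (by fun_prop) (by fun_prop) (by fun_prop)
    fun p hp => ?_).congr fun p hp =>
      signature_afocal (by norm_num) (h p hp).1 (h p hp).2.1 (h p hp).2.2.1
  obtain ⟨-, hx, hw, q₁, q₂, q₃⟩ := h p hp
  exact ⟨hx, hw, fun h => q₁ (by linarith), mul_ne_zero hx q₂, mul_ne_zero hw q₃⟩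

theorem ne_zero_of_h₁ {G x w : ℝ} (h : h₁ G x w = 0) (hG : G ≠ 0) : x ≠ 0 ∧ w ≠ 0 := by
  unfold h₁ at h
  exact mul_ne_zero_iff.1 (by rwa [sub_eq_zero.1 h])

namespace Afocal₂

def point (y : ℝ × ℝ) : (ℝ × ℝ) × (ℝ × ℝ) :=
  ((y.1, D₂ y.1 y.2), (Ω₁ y.1 y.2, Ω₂ y.1 y.2))

theorem point_mem {y : ℝ × ℝ} (h : Regular y.1 y.2) : point y ∈ afocalE₂ :=
  mem_afocalE₂.2 ⟨h.h₁_eq, h.h₂_eq, h.D₂_pos, h.neg.ne, h.nonflat⟩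

theorem exists_of_mem {p : (ℝ × ℝ) × (ℝ × ℝ)} (hp : p ∈ afocalE₂) :
    ∃ G z : ℝ, Regular G z ∧ p = point (G, z) := by
  obtain ⟨⟨G, d₂⟩, x, w⟩ := p
  obtain ⟨hg, hh, hd, hG, hn⟩ := mem_afocalE₂.1 hp
  obtain ⟨z, hz, rfl, rfl, rfl⟩ := exists_regular hg hh hd hG hn
  exact ⟨G, z, hz, rfl⟩

theorem continuousOn_afocalS₂ : ContinuousOn afocalS₂ afocalE₂ := by
  refine continuousOn_afocal_signature (d₂ := fun p : (ℝ × ℝ) × (ℝ × ℝ) => p.1.2) (by fun_prop)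
    (by fun_prop) (by fun_prop) ?_
  rintro ⟨⟨G, d₂⟩, x, w⟩ hp
  obtain ⟨hg, -, hd, hG, hn⟩ := mem_afocalE₂.1 hp
  exact ⟨hd, (ne_zero_of_h₁ hg hG).1, (ne_zero_of_h₁ hg hG).2, hn⟩

/-- As 1 - G > 0, the branch is the sign of 1 + z, which never vanishes: the two branches do not
meet. -/
theorem φ_point {G z : ℝ} (h : Regular G z) : φ (point (G, z)) = 2 * (1 - G) * (1 + z) := by
  have := h.ne_zero
  have := h.neg.ne
  simp only [φ, point, A₁, B₁, D₂, Ω₁]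
  field_simp
  ring

theorem A₁_eq {G d z : ℝ} (hz : (1 + z) ^ 2 = -G * d) : A₁ G d = z * (z + 2) := by
  unfold A₁
  linear_combination -hz

theorem mul_A₂ {G d z : ℝ} (hz : (1 + z) ^ 2 = -G * d) :
    G * A₂ G d = (z + 1 - G) * (z + 1 + G) := by
  unfold A₂
  linear_combination -hz

/-- In the factorization of G A₂ the factor z + 1 + G is negative on this branch, so A₂ vanishes
exactly at the wall z = G - 1. -/
theorem minus_iff {G d z : ℝ} (hG : G < 0) (hz : (1 + z) ^ 2 = -G * d) (hm : 1 + z < 0)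
    (ν : Name) : Minus G d ν ↔ Order G z ν := by
  have e := mul_A₂ hz
  cases ν <;> simp only [Minus, Order]
  · constructor
    · intro h
      have := mul_neg_of_neg_of_pos hG h
      rw [e] at this
      exact ⟨by nlinarith, by linarith⟩
    · rintro ⟨h, -⟩
      have := mul_neg_of_pos_of_neg (show 0 < z + 1 - G by linarith)
        (show z + 1 + G < 0 by linarith)
      rw [← e] at this
      exact pos_of_mul_neg_right this hG.le
  · exact ⟨False.elim, fun h => by linarith⟩
  · constructor
    · intro h
      have := mul_pos_of_neg_of_neg hG h
      rw [e] at this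
      nlinarith
    · intro h
      have := mul_pos_of_neg_of_neg (show z + 1 - G < 0 by linarith)
        (show z + 1 + G < 0 by linarith)
      rw [← e] at this
      exact neg_of_mul_pos_right this hG.le
  · exact ⟨False.elim, fun h => by linarith⟩

theorem plus_iff {G d z : ℝ} (hG : G < 0) (hz : (1 + z) ^ 2 = -G * d) (hp : 0 < 1 + z)
    (ν : Name) : Plus G d ν ↔ Order G z ν := by
  have e := A₁_eq hz
  cases ν <;> simp only [Plus, Order, e]
  · exact ⟨False.elim, fun h => by linarith⟩
  · constructor
    · exact fun h => ⟨by linarith, by nlinarith⟩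
    · exact fun h => mul_neg_of_neg_of_pos h.2 (by linarith)
  · exact ⟨False.elim, fun h => by linarith⟩
  · constructor
    · exact fun h => by nlinarith
    · exact fun h => mul_pos h (by linarith)

/-- The parameter of the point of the branch `ε` over `y`. -/
def param (ε : ℝ) (y : ℝ × ℝ) : ℝ := -1 + ε * √(-y.1 * y.2)

theorem param_sq {ε : ℝ} (hε : ε ^ 2 = 1) {y : ℝ × ℝ} (h₁ : y.1 < 0) (h₂ : 0 < y.2) :
    (1 + param ε y) ^ 2 = -y.1 * y.2 := by
  have := Real.sq_sqrt (mul_nonneg (neg_nonneg.2 h₁.le) h₂.le)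
  unfold param
  linear_combination √(-y.1 * y.2) ^ 2 * hε + this

theorem isBranchSection {ε : ℝ} (hε : ε ^ 2 = 1) {P : ℝ → ℝ → Name → Prop} (ν : Name)
    (hP : ∀ {G d z : ℝ}, G < 0 → (1 + z) ^ 2 = -G * d → 0 < ε * (1 + z) → P G d ν →
      Order G z ν) :
    IsBranchSection afocalE₂ φ ε (region P ν)
      (fun y => (Ω₁ y.1 (param ε y), Ω₂ y.1 (param ε y))) := by
  have hpos : ∀ y ∈ region P ν, 0 < ε * (1 + param ε y) := fun y hy => by
    have := Real.sqrt_pos.2 (mul_pos (neg_pos.2 hy.1) hy.2.1)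
    have e : ε * (1 + param ε y) = √(-y.1 * y.2) := by
      unfold param
      linear_combination √(-y.1 * y.2) * hε
    rwa [e]
  have hreg : ∀ y ∈ region P ν, Regular y.1 (param ε y) := fun y hy =>
    (hP hy.1 (param_sq hε hy.1 hy.2.1) (hpos y hy) hy.2.2).regular hy.1
  have hpt : ∀ y ∈ region P ν,
      (y, (Ω₁ y.1 (param ε y), Ω₂ y.1 (param ε y))) = point (y.1, param ε y) := fun y hy => by
    have : D₂ y.1 (param ε y) = y.2 := by
      rw [D₂, param_sq hε hy.1 hy.2.1, div_eq_iff hy.1.ne]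
      ring
    simp only [point, this]
  have hc : ContinuousOn (param ε) (region P ν) := by
    unfold param
    fun_prop
  refine ⟨(continuousOn_Ω₁ (by fun_prop) hc hreg).prodMk (continuousOn_Ω₂ (by fun_prop) hc hreg),
    fun y hy => ?_, fun y hy => ?_, ?_⟩
  · rw [hpt y hy]
    exact point_mem (hreg y hy)
  · rw [hpt y hy, φ_point (hreg y hy)]
    have h1G : 0 < 1 - y.1 := by linarith [hy.1]
    nlinarith [mul_pos h1G (hpos y hy)]
  · intro y hy x hx hb
    obtain ⟨G, z, hz, he⟩ := exists_of_mem hx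
    rw [he, φ_point hz] at hb
    obtain ⟨rfl, rfl⟩ := Prod.ext_iff.1 he
    have hG := hz.neg
    have hb' : 0 ≤ ε * (1 + z) := by
      by_contra! h0
      nlinarith [mul_neg_of_pos_of_neg (show 0 < 1 - G by linarith) h0]
    have hs : √(-G * D₂ G z) = ε * (1 + z) := by
      have : -G * D₂ G z = (ε * (1 + z)) ^ 2 := by
        have := hG.ne
        rw [mul_pow, hε, D₂]
        field_simp
      rw [this, Real.sqrt_sq hb']
    have : param ε (point (G, z)).1 = z := by
      simp only [param, point, hs]
      linear_combination (1 + z) * hε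
    rw [this]
    rfl

theorem levelSet_eq (ν : Name) :
    {p | p ∈ afocalE₂ ∧ afocalS₂ p = ν.signature} = point '' domain ν := by
  ext p
  constructor
  · rintro ⟨hp, hs⟩
    obtain ⟨G, z, hz, rfl⟩ := exists_of_mem hp
    exact ⟨(G, z), ⟨hz.neg, (hz.signature_iff ν).1 hs⟩, rfl⟩
  · rintro ⟨y, hy, rfl⟩
    have hr := regular_of_mem_domain hy
    exact ⟨point_mem hr, (hr.signature_iff ν).2 hy.2⟩

theorem classification :
    TwoBranchClassification afocalE₂ afocalS₂ φ (region Minus) (region Plus)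
      {.NP110, .NP101, .PN101, .PN011} 4 := by
  have hsq : ∀ {G z : ℝ}, Regular G z → (1 + z) ^ 2 = -G * D₂ G z := fun h => by
    have := h.neg.ne
    unfold D₂
    field_simp
  refine .of_levelSets continuousOn_afocalS₂ ?_ (fun ν hν => ?_) ?_ ?_ ?_ ?_ ?_
  · intro _ hp
    obtain ⟨G, z, hz, rfl⟩ := exists_of_mem hp
    exact hz.exists_order.imp fun ν h => ⟨h.1, hz.signature_of_order ν h.2⟩
  · rw [levelSet_eq]
    refine (isPathConnected_domain hν).image' ?_
    have hr := fun y (hy : y ∈ domain ν) => regular_of_mem_domain hy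
    exact ((by fun_prop : ContinuousOn Prod.fst _).prodMk
      (continuousOn_D₂ (by fun_prop) (by fun_prop) hr)).prodMk
      ((continuousOn_Ω₁ (by fun_prop) (by fun_prop) hr).prodMk
        (continuousOn_Ω₂ (by fun_prop) (by fun_prop) hr))
  · iterate 3 rw [ncard_insert_of_notMem (by simp)]
    simp
  · intro _ hp hφ ν _
    obtain ⟨G, z, hz, rfl⟩ := exists_of_mem hp
    have hG := hz.neg
    rw [φ_point hz] at hφ
    have hm : 1 + z < 0 := lt_of_le_of_ne (by
      by_contra! h0
      nlinarith [mul_pos (show 0 < 1 - G by linarith) h0]) hz.ne_neg_one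
    refine Iff.trans ?_ ((minus_iff hG (hsq hz) hm ν).trans (hz.signature_iff ν).symm)
    exact ⟨fun h => h.2.2, fun h => ⟨hG, hz.D₂_pos, h⟩⟩
  · intro _ hp hφ ν _
    obtain ⟨G, z, hz, rfl⟩ := exists_of_mem hp
    have hG := hz.neg
    rw [φ_point hz] at hφ
    have hm : 0 < 1 + z := lt_of_le_of_ne (by
      by_contra! h0
      nlinarith [mul_neg_of_pos_of_neg (show 0 < 1 - G by linarith) h0]) hz.ne_neg_one.symm
    refine Iff.trans ?_ ((plus_iff hG (hsq hz) hm ν).trans (hz.signature_iff ν).symm)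
    exact ⟨fun h => h.2.2, fun h => ⟨hG, hz.D₂_pos, h⟩⟩
  · exact fun ν _ => ⟨_, isBranchSection (by norm_num) ν
      fun hG hz hb => (minus_iff hG hz (by linarith) ν).1⟩
  · exact fun ν _ => ⟨_, isBranchSection (by norm_num) ν
      fun hG hz hb => (plus_iff hG hz (by linarith) ν).1⟩

end Afocal₂

/-! ## Afocal telescopes in codimension 3 -/

theorem mem_afocalE₃ {G z₀ dp d₂ x w : ℝ} : ((G, z₀, dp), (d₂, x, w)) ∈ afocalE₃ ↔
    h₁ G x w = 0 ∧ h₂ (-1) d₂ x w = 0 ∧ h₃ z₀ dp (-1) d₂ x w = 0 ∧ 0 < d₂ ∧ G ≠ 0 ∧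
      AfocalNonflat (-1) d₂ x w := by
  constructor
  · rintro ⟨_, _, _, _, _, _, h, h'⟩
    simp only [Prod.mk.injEq] at h
    obtain ⟨⟨rfl, rfl, rfl⟩, rfl, rfl, rfl⟩ := h
    exact h'
  · exact fun h => ⟨_, _, _, _, _, _, rfl, h⟩

namespace Afocal₃

/-- The pupil condition is solved for d_p, which leaves G, z and z₀ as free parameters. -/
def point (y : (ℝ × ℝ) × ℝ) : (ℝ × ℝ × ℝ) × (ℝ × ℝ × ℝ) :=
  ((y.1.1, y.2, y.1.2 * (y.1.2 + 1 + y.1.1) - y.1.1 ^ 2 * y.2),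
    (D₂ y.1.1 y.1.2, Ω₁ y.1.1 y.1.2, Ω₂ y.1.1 y.1.2))

theorem pupil_eq {G z : ℝ} (h : Regular G z) :
    pupilSum (-1) (D₂ G z) (Ω₁ G z) (Ω₂ G z) = -(z * (z + 1 + G)) := by
  have := h.ne_zero
  have := h.ne_sub_one
  have := h.neg.ne
  unfold pupilSum D₂ Ω₁ Ω₂
  field_simp
  ring

theorem h₃_eq {G z z₀ dp : ℝ} (h : Regular G z) :
    h₃ z₀ dp (-1) (D₂ G z) (Ω₁ G z) (Ω₂ G z) = A₂ G z₀ dp - z * (z + 1 + G) := by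
  have := h.h₁_eq
  unfold h₁ at this
  rw [h₃, pupil_eq h, sub_eq_zero.1 this, A₂]
  ring

theorem A₂_point (G z z₀ : ℝ) :
    A₂ G z₀ (z * (z + 1 + G) - G ^ 2 * z₀) = z * (z + 1 + G) := by
  unfold A₂
  ring

theorem point_mem {y : (ℝ × ℝ) × ℝ} (h : Regular y.1.1 y.1.2) : point y ∈ afocalE₃ :=
  mem_afocalE₃.2 ⟨h.h₁_eq, h.h₂_eq, by rw [h₃_eq h, A₂_point, sub_self], h.D₂_pos, h.neg.ne,
    h.nonflat⟩

theorem exists_of_mem {p : (ℝ × ℝ × ℝ) × (ℝ × ℝ × ℝ)} (hp : p ∈ afocalE₃) :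
    ∃ G z z₀ : ℝ, Regular G z ∧ p = point ((G, z), z₀) := by
  obtain ⟨⟨G, z₀, dp⟩, d₂, x, w⟩ := p
  obtain ⟨hg, hh, hh', hd, hG, hn⟩ := mem_afocalE₃.1 hp
  obtain ⟨z, hz, rfl, rfl, rfl⟩ := exists_regular hg hh hd hG hn
  refine ⟨G, z, z₀, hz, ?_⟩
  rw [h₃_eq hz, A₂] at hh'
  have : dp = z * (z + 1 + G) - G ^ 2 * z₀ := by linarith
  rw [this]
  rfl

theorem continuousOn_afocalS₃ : ContinuousOn afocalS₃ afocalE₃ := by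
  refine continuousOn_afocal_signature (d₂ := fun p : (ℝ × ℝ × ℝ) × (ℝ × ℝ × ℝ) => p.2.1)
    (by fun_prop) (by fun_prop) (by fun_prop) ?_
  rintro ⟨⟨G, z₀, dp⟩, d₂, x, w⟩ hp
  obtain ⟨hg, -, -, hd, hG, hn⟩ := mem_afocalE₃.1 hp
  exact ⟨hd, (ne_zero_of_h₁ hg hG).1, (ne_zero_of_h₁ hg hG).2, hn⟩

/-- Since G (G - 1) > 0, the branches of the pivot equation in d₂ are those of the simpler equation
z (z + 1 + G) = A₂. -/
theorem φ_point {G z z₀ : ℝ} (h : Regular G z) :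
    φ (point ((G, z), z₀)) = G * (G - 1) * (2 * z + 1 + G) := by
  have := h.neg.ne
  simp only [φ, point, B₁, A₂_point, D₂]
  field_simp
  ring

theorem Δ_eq (G z₀ dp : ℝ) :
    Δ G z₀ dp = (G * (G - 1)) ^ 2 * ((1 + G) ^ 2 + 4 * A₂ G z₀ dp) := by
  unfold Δ B₁ C₁ A₂
  ring

theorem Δ_nonneg_iff {G z₀ dp : ℝ} (hG : G < 0) :
    0 ≤ Δ G z₀ dp ↔ 0 ≤ (1 + G) ^ 2 + 4 * A₂ G z₀ dp := by
  have : 0 < G * (G - 1) := mul_pos_of_neg_of_neg hG (by linarith)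
  rw [Δ_eq, mul_nonneg_iff_of_pos_left (by positivity)]

theorem q_eq (G z₀ dp : ℝ) : q G z₀ dp = A₂ G z₀ dp + G := by
  unfold q A₂
  ring

theorem minus_iff {G z₀ dp z : ℝ} (hG : G < 0) (hz : z * (z + 1 + G) = A₂ G z₀ dp)
    (hm : 2 * z + 1 + G ≤ 0) (ν : Name) : Minus G z₀ dp ν ↔ Order G z ν := by
  have hΔ : 0 ≤ Δ G z₀ dp := by
    rw [Δ_nonneg_iff hG, ← hz]
    nlinarith [sq_nonneg (2 * z + 1 + G)]
  have hq : q G z₀ dp = (z + 1) * (z + G) := by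
    rw [q_eq, ← hz]
    ring
  have hA₃ : A₃ G z₀ dp = (z + 1 - G) * (z + 2 * G) := by
    rw [A₃, ← hz]
    ring
  -- On this branch z + G and z + 2G are negative, so the signs of q and A₃ reduce to those of z + 1
  -- and z + 1 - G.
  have hzG : z + G < 0 := by linarith
  have hz2G : z + 2 * G < 0 := by linarith
  cases ν <;> simp only [Minus, Order, hΔ, hq, hA₃, ← hz, true_and, and_true]
  · constructor
    · rintro ⟨h₁, h₂⟩
      exact ⟨by nlinarith, by nlinarith⟩
    · rintro ⟨h₁, h₂⟩
      exact ⟨mul_neg_of_pos_of_neg (by linarith) hz2G, mul_pos_of_neg_of_neg (by linarith) hzG⟩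
  · constructor
    · rintro (⟨h₁, h₂, h₃⟩ | ⟨h₁, h₂⟩)
      · refine ⟨by nlinarith, ?_⟩
        by_contra! h0
        nlinarith
      · exact ⟨by nlinarith, by linarith⟩
    · rintro ⟨h₁, h₂⟩
      have := mul_neg_of_pos_of_neg (show 0 < z + 1 by linarith) hzG
      rcases le_or_gt G (-1) with h | h
      · exact .inl ⟨mul_pos_of_neg_of_neg h₂ (by linarith), h, this⟩
      · exact .inr ⟨h, this⟩
  · constructor
    · intro h
      nlinarith
    · intro h
      exact mul_pos_of_neg_of_neg (by linarith) hz2G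
  · constructor
    · rintro ⟨h₁, h₂⟩
      by_contra! h0
      nlinarith
    · intro h
      exact ⟨mul_neg_of_pos_of_neg h (by linarith), by linarith⟩

theorem plus_iff {G z₀ dp z : ℝ} (hG : G < 0) (hz : z * (z + 1 + G) = A₂ G z₀ dp)
    (hp : 0 ≤ 2 * z + 1 + G) (ν : Name) : Plus G z₀ dp ν ↔ Order G z ν := by
  have hΔ : 0 ≤ Δ G z₀ dp := by
    rw [Δ_nonneg_iff hG, ← hz]
    nlinarith [sq_nonneg (2 * z + 1 + G)]
  cases ν <;> simp only [Plus, Order, hΔ, ← hz, true_and, and_true]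
  · exact ⟨False.elim, fun h => by linarith⟩
  · constructor
    · rintro ⟨h₁, h₂⟩
      have : z < 0 := by
        by_contra! h0
        nlinarith
      exact ⟨by nlinarith, this⟩
    · rintro ⟨h₁, h₂⟩
      exact ⟨mul_neg_of_neg_of_pos h₂ (by linarith), by linarith⟩
  · exact ⟨False.elim, fun h => by linarith⟩
  · constructor
    · rintro (⟨h₁, h₂⟩ | h₁)
      · by_contra! h0
        nlinarith
      · linarith
    · intro h
      rcases lt_or_ge G (-1) with h' | h'
      · exact .inr h'
      · exact .inl ⟨mul_pos h (by linarith), h'⟩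

/-- Where a region does not impose Δ ≥ 0, its inequalities force A₂ > 0. -/
theorem discr_nonneg_of_minus {G z₀ dp : ℝ} (hG : G < 0) {ν : Name} (h : Minus G z₀ dp ν) :
    0 ≤ (1 + G) ^ 2 + 4 * A₂ G z₀ dp := by
  have := sq_nonneg (1 + G)
  have := sq_nonneg G
  cases ν <;> simp only [Minus, Δ_nonneg_iff hG, q_eq, A₃] at h
  · linarith
  · rcases h with ⟨h, -⟩ | ⟨h, -⟩
    · linarith
    · exact h
  · nlinarith
  · exact h.2.2

theorem discr_nonneg_of_plus {G z₀ dp : ℝ} (hG : G < 0) {ν : Name} (h : Plus G z₀ dp ν) :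
    0 ≤ (1 + G) ^ 2 + 4 * A₂ G z₀ dp := by
  have := sq_nonneg (1 + G)
  cases ν <;> simp only [Plus, Δ_nonneg_iff hG] at h
  · exact h.2.2
  · rcases h with ⟨h, -⟩ | ⟨h, -⟩
    · linarith
    · exact h

/-- The parameter of the point of the branch `ε` over `y`. -/
def param (ε : ℝ) (y : ℝ × ℝ × ℝ) : ℝ :=
  (-(1 + y.1) + ε * √((1 + y.1) ^ 2 + 4 * A₂ y.1 y.2.1 y.2.2)) / 2

theorem isBranchSection {ε : ℝ} (hε : ε ^ 2 = 1) {P : ℝ → ℝ → ℝ → Name → Prop} (ν : Name)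
    (hΔ : ∀ {G z₀ dp : ℝ}, G < 0 → P G z₀ dp ν → 0 ≤ (1 + G) ^ 2 + 4 * A₂ G z₀ dp)
    (hP : ∀ {G z₀ dp z : ℝ}, G < 0 → z * (z + 1 + G) = A₂ G z₀ dp → 0 ≤ ε * (2 * z + 1 + G) →
      P G z₀ dp ν → Order G z ν) :
    IsBranchSection afocalE₃ φ ε (region P ν)
      (fun y => (D₂ y.1 (param ε y), Ω₁ y.1 (param ε y), Ω₂ y.1 (param ε y))) := by
  have hroot : ∀ y ∈ region P ν,
      param ε y * (param ε y + 1 + y.1) = A₂ y.1 y.2.1 y.2.2 := fun y hy => by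
    have hs := Real.sq_sqrt (hΔ hy.1 hy.2)
    unfold param
    linear_combination √((1 + y.1) ^ 2 + 4 * A₂ y.1 y.2.1 y.2.2) ^ 2 / 4 * hε + hs / 4
  have hbr : ∀ y : ℝ × ℝ × ℝ, 0 ≤ ε * (2 * param ε y + 1 + y.1) := fun y => by
    have hs := Real.sqrt_nonneg ((1 + y.1) ^ 2 + 4 * A₂ y.1 y.2.1 y.2.2)
    have e : ε * (2 * param ε y + 1 + y.1) = √((1 + y.1) ^ 2 + 4 * A₂ y.1 y.2.1 y.2.2) := by
      unfold param
      linear_combination √((1 + y.1) ^ 2 + 4 * A₂ y.1 y.2.1 y.2.2) * hε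
    rwa [e]
  have hreg : ∀ y ∈ region P ν, Regular y.1 (param ε y) := fun y hy =>
    (hP hy.1 (hroot y hy) (hbr y) hy.2).regular hy.1
  have hpt : ∀ y ∈ region P ν,
      (y, (D₂ y.1 (param ε y), Ω₁ y.1 (param ε y), Ω₂ y.1 (param ε y))) =
        point ((y.1, param ε y), y.2.1) := fun y hy => by
    have : param ε y * (param ε y + 1 + y.1) - y.1 ^ 2 * y.2.1 = y.2.2 := by
      rw [hroot y hy, A₂]
      ring
    simp only [point, this]
  have hc : ContinuousOn (param ε) (region P ν) := by
    unfold param A₂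
    fun_prop
  refine ⟨(continuousOn_D₂ (by fun_prop) hc hreg).prodMk
    ((continuousOn_Ω₁ (by fun_prop) hc hreg).prodMk (continuousOn_Ω₂ (by fun_prop) hc hreg)),
    fun y hy => ?_, fun y hy => ?_, ?_⟩
  · rw [hpt y hy]
    exact point_mem (hreg y hy)
  · rw [hpt y hy, φ_point (hreg y hy)]
    have : 0 < y.1 * (y.1 - 1) := mul_pos_of_neg_of_neg hy.1 (by linarith [hy.1])
    have := mul_nonneg this.le (hbr y)
    linarith
  · intro y hy x hx hb
    obtain ⟨G, z, z₀, hz, he⟩ := exists_of_mem hx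
    rw [he, φ_point hz] at hb
    obtain ⟨rfl, rfl⟩ := Prod.ext_iff.1 he
    have hG := hz.neg
    have hpos : 0 < G * (G - 1) := mul_pos_of_neg_of_neg hG (by linarith)
    have hb' : 0 ≤ ε * (2 * z + 1 + G) := by
      by_contra! h0
      linarith [mul_neg_of_pos_of_neg hpos h0]
    have hs : √((1 + G) ^ 2 + 4 * (z * (z + 1 + G))) = ε * (2 * z + 1 + G) := by
      have : (1 + G) ^ 2 + 4 * (z * (z + 1 + G)) = (ε * (2 * z + 1 + G)) ^ 2 := by
        rw [mul_pow, hε]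
        ring
      rw [this, Real.sqrt_sq hb']
    have : param ε (point ((G, z), z₀)).1 = z := by
      simp only [param, point, A₂_point, hs]
      linear_combination (2 * z + 1 + G) / 2 * hε
    rw [this]
    rfl

theorem levelSet_eq (ν : Name) :
    {p | p ∈ afocalE₃ ∧ afocalS₃ p = ν.signature} = point '' (domain ν ×ˢ univ) := by
  ext p
  constructor
  · rintro ⟨hp, hs⟩
    obtain ⟨G, z, z₀, hz, rfl⟩ := exists_of_mem hp
    exact ⟨((G, z), z₀), ⟨⟨hz.neg, (hz.signature_iff ν).1 hs⟩, trivial⟩, rfl⟩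
  · rintro ⟨y, hy, rfl⟩
    have hr := regular_of_mem_domain hy.1
    exact ⟨point_mem hr, (hr.signature_iff ν).2 hy.1.2⟩

theorem classification :
    TwoBranchClassification afocalE₃ afocalS₃ φ (region Minus) (region Plus)
      {.NP110, .NP101, .PN101, .PN011} 4 := by
  refine .of_levelSets continuousOn_afocalS₃ ?_ (fun ν hν => ?_) ?_ ?_ ?_ ?_ ?_
  · intro _ hp
    obtain ⟨G, z, z₀, hz, rfl⟩ := exists_of_mem hp
    exact hz.exists_order.imp fun ν h => ⟨h.1, hz.signature_of_order ν h.2⟩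
  · rw [levelSet_eq]
    refine ((isPathConnected_domain hν).prod isPathConnected_univ).image' ?_
    have hr := fun y (hy : y ∈ domain ν ×ˢ (univ : Set ℝ)) => regular_of_mem_domain hy.1
    exact (by fun_prop : ContinuousOn (fun y : (ℝ × ℝ) × ℝ =>
      (y.1.1, y.2, y.1.2 * (y.1.2 + 1 + y.1.1) - y.1.1 ^ 2 * y.2)) _).prodMk
      ((continuousOn_D₂ (by fun_prop) (by fun_prop) hr).prodMk
      ((continuousOn_Ω₁ (by fun_prop) (by fun_prop) hr).prodMk
        (continuousOn_Ω₂ (by fun_prop) (by fun_prop) hr)))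
  · iterate 3 rw [ncard_insert_of_notMem (by simp)]
    simp
  · intro _ hp hφ ν _
    obtain ⟨G, z, z₀, hz, rfl⟩ := exists_of_mem hp
    have hG := hz.neg
    have hpos : 0 < G * (G - 1) := mul_pos_of_neg_of_neg hG (by linarith)
    rw [φ_point hz] at hφ
    have hm : 2 * z + 1 + G ≤ 0 := by
      by_contra! h0
      linarith [mul_pos hpos h0]
    refine Iff.trans ?_ ((minus_iff hG (A₂_point G z z₀).symm hm ν).trans
      (hz.signature_iff ν).symm)
    exact ⟨fun h => h.2, fun h => ⟨hG, h⟩⟩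
  · intro _ hp hφ ν _
    obtain ⟨G, z, z₀, hz, rfl⟩ := exists_of_mem hp
    have hG := hz.neg
    have hpos : 0 < G * (G - 1) := mul_pos_of_neg_of_neg hG (by linarith)
    rw [φ_point hz] at hφ
    have hm : 0 ≤ 2 * z + 1 + G := nonneg_of_mul_nonneg_right hφ hpos
    refine Iff.trans ?_ ((plus_iff hG (A₂_point G z z₀).symm hm ν).trans
      (hz.signature_iff ν).symm)
    exact ⟨fun h => h.2, fun h => ⟨hG, h⟩⟩
  · exact fun ν _ => ⟨_, isBranchSection (by norm_num) ν
      (fun hG h => discr_nonneg_of_minus hG h)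
      fun hG hz hb => (minus_iff hG hz (by linarith) ν).1⟩
  · exact fun ν _ => ⟨_, isBranchSection (by norm_num) ν
      (fun hG h => discr_nonneg_of_plus hG h)
      fun hG hz hb => (plus_iff hG hz (by linarith) ν).1⟩

end Afocal₃

/-! ## Focal telescopes in codimension 3 -/

theorem mem_focalE₃ {f d₁ d₂ d₃ x w : ℝ} : ((d₁, d₂), (d₃, x, w)) ∈ focalE₃ f ↔
    ((d₁, d₂, d₃), (x, w)) ∈ focalE₂ f ∧ g₃ d₁ d₂ d₃ x w = 0 := by
  rw [mem_focalE₂]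
  constructor
  · rintro ⟨_, _, _, _, _, h, h₁, h₂, h₃, h'⟩
    simp only [Prod.mk.injEq] at h
    obtain ⟨⟨rfl, rfl⟩, rfl, rfl, rfl⟩ := h
    exact ⟨⟨h₁, h₂, h'⟩, h₃⟩
  · exact fun ⟨⟨h₁, h₂, h'⟩, h₃⟩ => ⟨_, _, _, _, _, rfl, h₁, h₂, h₃, h'⟩

theorem continuousOn_focalS₃ (f : ℝ) : ContinuousOn focalS₃ (focalE₃ f) := by
  refine (continuousOn_focalS₂ f).comp (f := fun p : (ℝ × ℝ) × (ℝ × ℝ × ℝ) =>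
    (((p.1.1, p.1.2, p.2.1), (p.2.2.1, p.2.2.2)) : (ℝ × ℝ × ℝ) × (ℝ × ℝ))) (by fun_prop) ?_
  rintro ⟨⟨d₁, d₂⟩, d₃, x, w⟩ hp
  exact (mem_focalE₃.1 hp).1

namespace Focal₃

/-- The solution `(d₃, Ω₁, Ω₂)` over `(d₁, d₂)`. -/
def solution (f : ℝ) (y : ℝ × ℝ) : ℝ × ℝ × ℝ :=
  let d₃ := -(B₁ f y.1 y.2 / (y.1 * y.2))
  let x := f * y.2 - B₁ f y.1 y.2 / y.2
  (d₃, x, -f * d₃ / x)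

theorem continuousOn_solution (f : ℝ) {R : Set (ℝ × ℝ)}
    (hR : ∀ y ∈ R, y.1 ≠ 0 ∧ y.2 ≠ 0 ∧ f * y.2 - B₁ f y.1 y.2 / y.2 ≠ 0) :
    ContinuousOn (solution f) R := by
  have hB : Continuous fun y : ℝ × ℝ => B₁ f y.1 y.2 := by
    unfold B₁
    fun_prop
  have h₁ : ContinuousOn (fun y : ℝ × ℝ => -(B₁ f y.1 y.2 / (y.1 * y.2))) R :=
    (hB.continuousOn.div (by fun_prop) fun y hy =>
      mul_ne_zero (hR y hy).1 (hR y hy).2.1).neg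
  have h₂ : ContinuousOn (fun y : ℝ × ℝ => f * y.2 - B₁ f y.1 y.2 / y.2) R :=
    ContinuousOn.sub (by fun_prop) (hB.continuousOn.div (by fun_prop) fun y hy => (hR y hy).2.1)
  exact h₁.prodMk (h₂.prodMk ((continuousOn_const.mul h₁).div h₂ fun y hy => (hR y hy).2.2))

/-! ### The case `f = 1`, with `d₁ = -a`, `d₂ = b`, `d₃ = -c` -/

section Pos

open Focal₂

variable {a b c : ℝ}

/-- The telecentric points over `(-a, b)`. -/
structure Telecentric (a b c : ℝ) : Prop where
  a_pos : 0 < a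
  b_pos : 0 < b
  c_pos : 0 < c
  eq : a * b * c = -B₁ 1 (-a) b

namespace Telecentric

theorem posRoot (h : Telecentric a b c) : PosRoot a b c (b + a * c) := by
  have ha := h.a_pos
  have hb := h.b_pos
  have hc := h.c_pos
  have e := h.eq
  unfold B₁ at e
  exact ⟨ha, hb, hc, by positivity, by linear_combination -c * (a * c + b) * e⟩

/-- At x = b + ac the comparisons with the flatness roots depend only on (a, b), through b - (1 -
a)², a + b - 1 and a - 1: a parabola and two lines. -/
theorem one_lt_iff (h : Telecentric a b c) : (1 < b + a * c ↔ (1 - a) ^ 2 < b) ∧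
    (b + a * c < 1 ↔ b < (1 - a) ^ 2) := by
  have hb := h.b_pos
  have e := h.eq
  unfold B₁ at e
  have e' : b * (b + a * c - 1) = b - (1 - a) ^ 2 := by linear_combination e
  constructor
  · rw [← sub_pos, ← mul_pos_iff_of_pos_left hb, e', sub_pos]
  · rw [← sub_neg, ← neg_pos, ← mul_pos_iff_of_pos_left hb, mul_neg, e', neg_sub, sub_pos]

theorem flat₂_lt_iff (h : Telecentric a b c) : (flat₂ a b c < b + a * c ↔ 1 - a < b) ∧
    (b + a * c < flat₂ a b c ↔ b < 1 - a) := by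
  have hab : 0 < a + b := add_pos h.a_pos h.b_pos
  have hb := h.b_pos
  have hx := h.posRoot.x_pos
  have e := h.eq
  unfold B₁ at e
  have e' : (b + a * c) * (a + b) - (b + a * c) = (b - (1 - a)) * (b + a * c) := by ring
  unfold flat₂
  constructor
  · rw [div_lt_iff₀ hab, ← sub_pos, e', mul_pos_iff_of_pos_right hx, sub_pos]
  · rw [lt_div_iff₀ hab, ← sub_neg, e', ← neg_pos, ← neg_mul, mul_pos_iff_of_pos_right hx,
      neg_sub, sub_pos]

theorem flat₃_lt_iff (h : Telecentric a b c) : (b + c < b + a * c ↔ 1 - a < 0) ∧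
    (b + a * c < b + c ↔ 0 < 1 - a) := by
  have hc := h.c_pos
  constructor <;> constructor <;> intro h' <;> nlinarith

theorem pos_iff (h : Telecentric a b c) (ν : Name) :
    Pos (-a) b ν ↔ PosOrder a b c (b + a * c) ν := by
  have ha := h.a_pos
  have hb := h.b_pos
  have hB : B₁ 1 (-a) b < 0 := by
    have := mul_pos (mul_pos ha hb) h.c_pos
    linarith [h.eq]
  have e₁ : q₁ 1 (-a) b = (1 - a) ^ 2 - b := by
    unfold q₁
    ring
  have e₂ : q₂ 1 (-a) b = b - (1 - a) := by
    unfold q₂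
    ring
  have e₃ : (-a < -1 ↔ 1 - a < 0) ∧ (-1 < -a ↔ 0 < 1 - a) :=
    ⟨by constructor <;> intro <;> linarith, by constructor <;> intro <;> linarith⟩
  cases ν <;> simp only [Pos, PosOrder, h.one_lt_iff.1, h.one_lt_iff.2, h.flat₂_lt_iff.1,
    h.flat₂_lt_iff.2, h.flat₃_lt_iff.1, h.flat₃_lt_iff.2, hB, e₁, e₂, e₃.1, e₃.2, true_and,
    sub_pos, sub_neg]
  · exact ⟨fun ⟨h₁, h₂⟩ => ⟨h₂, by linarith, h₁⟩, fun ⟨h₁, _, h₃⟩ => ⟨h₃, h₁⟩⟩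
  · exact ⟨fun ⟨h₁, h₂⟩ => ⟨h₂, by linarith, h₁⟩, fun ⟨h₁, _, h₃⟩ => ⟨h₃, h₁⟩⟩
  · exact ⟨fun ⟨h₁, h₂, h₃⟩ => ⟨h₃, h₂, h₁⟩, fun ⟨h₁, h₂, h₃⟩ => ⟨h₃, h₂, h₁⟩⟩
  · exact ⟨fun ⟨h₁, h₂⟩ => ⟨by nlinarith, h₂, h₁⟩, fun ⟨_, h₂, h₃⟩ => ⟨h₃, h₂⟩⟩
  -- The name PP100 disappears: it would need a > 1 and 0 < b < 1 - a.
  · exact ⟨False.elim, fun ⟨_, h₂, h₃⟩ => by linarith⟩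
  · exact ⟨fun ⟨h₁, h₂⟩ => ⟨h₂, by nlinarith, h₁⟩, fun ⟨h₁, _, h₃⟩ => ⟨h₃, h₁⟩⟩

theorem solution_eq (h : Telecentric a b c) :
    solution 1 (-a, b) = (-c, b + a * c, -1 * -c / (b + a * c)) := by
  have ha := h.a_pos.ne'
  have hb := h.b_pos.ne'
  have e : B₁ 1 (-a) b = -(a * b * c) := by linarith [h.eq]
  have e₃ : -(-(a * b * c) / (-a * b)) = -c := by field_simp
  have ex : 1 * b - -(a * b * c) / b = b + a * c := by
    field_simp
    ring
  simp only [solution, e, e₃, ex]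

end Telecentric

/-- With Ω₂ = c/x, telecentricity is linear in x and gives x = b + ac. The pivot equation then
factors as c (ac + b)(abc + B₁) = 0 with the first factors positive. -/
theorem exists_of_mem_one {p : (ℝ × ℝ) × (ℝ × ℝ × ℝ)} (hp : p ∈ focalE₃ 1) :
    ∃ a b c : ℝ, Telecentric a b c ∧
      p = ((-a, b), (-c, b + a * c, -1 * -c / (b + a * c))) := by
  obtain ⟨⟨d₁, d₂⟩, d₃, x', w⟩ := p
  obtain ⟨hE, hg⟩ := mem_focalE₃.1 hp
  obtain ⟨a, b, c, x, h, he⟩ := exists_of_mem_focalE₂_one hE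
  simp only [Prod.mk.injEq] at he
  obtain ⟨⟨rfl, rfl, rfl⟩, rfl, rfl⟩ := he
  have ha := h.a_pos
  have hb := h.b_pos
  have hc := h.c_pos
  have hx := h.x_pos
  unfold g₃ pupilSum at hg
  have hx' : x' = d₂ + a * c := by
    field_simp at hg
    nlinarith
  subst hx'
  refine ⟨a, d₂, c, ⟨ha, hb, hc, ?_⟩, rfl⟩
  have e := h.eq
  unfold B₁
  have : (c * (a * c + d₂)) * (a * d₂ * c + ((-a + 1) ^ 2 + (d₂ - 1) ^ 2 - 1)) = 0 := by
    linear_combination -e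
  have := (mul_eq_zero.1 this).resolve_left (by positivity)
  linarith

theorem mem_focalE₃_one (h : Telecentric a b c)
    (hE : ((-a, b, -c), (b + a * c, -1 * -c / (b + a * c))) ∈ focalE₂ 1) :
    ((-a, b), (-c, b + a * c, -1 * -c / (b + a * c))) ∈ focalE₃ 1 := by
  have hx := h.posRoot.x_pos
  refine mem_focalE₃.2 ⟨hE, ?_⟩
  unfold g₃ pupilSum
  field_simp
  ring

theorem telecentric_of_pos {y : ℝ × ℝ} {ν : Name} (hy : y ∈ region Pos ν) :
    ∃ a b c, Telecentric a b c ∧ y = (-a, b) := by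
  obtain ⟨d₁, d₂⟩ := y
  obtain ⟨h₁, h₂, h⟩ := hy
  obtain ⟨a, rfl⟩ : ∃ a, d₁ = -a := ⟨-d₁, by ring⟩
  simp only at h₁ h₂ h
  have ha : 0 < a := by linarith
  have hB : B₁ 1 (-a) d₂ < 0 := by
    cases ν <;> simp only [Pos] at h
    · exact h.2.1
    · exact h.2.1
    · exact h.2.1
    · exact h.2.1
    · exact h.2.1
  refine ⟨a, d₂, -B₁ 1 (-a) d₂ / (a * d₂), ⟨ha, h₂, ?_, ?_⟩, rfl⟩
  · have := neg_pos.2 hB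
    positivity
  · field_simp

theorem ordConnected_aux {T u v t : ℝ} (hu : T ^ 2 + (u - 1) ^ 2 < 1)
    (hv : T ^ 2 + (v - 1) ^ 2 < 1) (hut : u ≤ t) (htv : t ≤ v) : T ^ 2 + (t - 1) ^ 2 < 1 := by
  rcases le_total t 1 with h | h
  · nlinarith
  · nlinarith

theorem B₁_one_neg_iff {d₁ d₂ : ℝ} : B₁ 1 d₁ d₂ < 0 ↔ (d₁ + 1) ^ 2 + (d₂ - 1) ^ 2 < 1 := by
  unfold B₁
  constructor <;> intro h <;> linarith

/-- The part of the disc below the parabola, on one side of its axis. -/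
theorem isPathConnected_below {l r : ℝ} (hl : -2 ≤ l) (hr : r ≤ 0) (hlr : l < r)
    (h1 : r ≤ -1 ∨ -1 ≤ l) : IsPathConnected {y : ℝ × ℝ | l < y.1 ∧ y.1 < r ∧ 0 < y.2 ∧
      (y.1 + 1) ^ 2 + (y.2 - 1) ^ 2 < 1 ∧ y.2 < (y.1 + 1) ^ 2} := by
  have hsq : ∀ x ∈ Ioo l r, 0 < (x + 1) ^ 2 ∧ (x + 1) ^ 2 < 1 := fun x hx => by
    refine ⟨?_, by nlinarith [hx.1, hx.2]⟩
    have : x + 1 ≠ 0 := by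
      intro h0
      rcases h1 with h | h <;> linarith [hx.1, hx.2]
    positivity
  -- This set need not be convex, so vertical fibres are used. With s = (x + 1)², the height s / (2
  -- - s) is a rational choice between the lower arc 1 - √(1 - s) of the disc and the parabola.
  refine isPathConnected_of_section (B := Ioo l r)
    (s := fun x => (x + 1) ^ 2 / (2 - (x + 1) ^ 2))
    ((convex_Ioo l r).isPathConnected (nonempty_Ioo.2 hlr)) ?_ (fun p hp => ⟨hp.1, hp.2.1⟩) ?_ ?_
  · exact ContinuousOn.div (by fun_prop) (by fun_prop) fun x hx => by linarith [(hsq x hx).2]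
  · intro x hx
    obtain ⟨h₁, h₂⟩ := hsq x hx
    set s := (x + 1) ^ 2
    have h₃ : 0 < 2 - s := by linarith
    have e : s + (s / (2 - s) - 1) ^ 2 - 1 = -(s * (1 - s) * s / (2 - s) ^ 2) := by
      field_simp
      ring
    have : 0 < s * (1 - s) * s / (2 - s) ^ 2 := by
      have := sub_pos.2 h₂
      positivity
    exact ⟨hx.1, hx.2, by positivity, by linarith, (div_lt_iff₀ h₃).2 (by nlinarith)⟩
  · rintro x u v t ⟨h₁, h₂, h₃, h₄, -⟩ ⟨-, -, -, h₄', h₅'⟩ hut htv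
    exact ⟨h₁, h₂, h₃.trans_le hut, ordConnected_aux h₄ h₄' hut htv, htv.trans_lt h₅'⟩

theorem sq_add_mul_le (u v s t : ℝ) (hs : 0 ≤ s) (ht : 0 ≤ t) (hst : s + t = 1) :
    (s * u + t * v) ^ 2 ≤ s * u ^ 2 + t * v ^ 2 := by
  obtain rfl : t = 1 - s := by linarith
  nlinarith [mul_nonneg (mul_nonneg hs ht) (sq_nonneg (u - v))]

/-- The disc and the epigraph of the parabola are convex, hence so is the intersection. -/
theorem isPathConnected_above {P : ℝ × ℝ → Prop} (hP : Convex ℝ {y : ℝ × ℝ | P y})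
    (hne : ∃ y : ℝ × ℝ, P y ∧ (y.1 + 1) ^ 2 + (y.2 - 1) ^ 2 < 1 ∧ (y.1 + 1) ^ 2 < y.2) :
    IsPathConnected
      {y : ℝ × ℝ | P y ∧ (y.1 + 1) ^ 2 + (y.2 - 1) ^ 2 < 1 ∧ (y.1 + 1) ^ 2 < y.2} := by
  refine Convex.isPathConnected ?_ hne
  rintro ⟨u, v⟩ ⟨h₁, h₂, h₃⟩ ⟨u', v'⟩ ⟨h₁', h₂', h₃'⟩ s t hs ht hst
  have k₁ := sq_add_mul_le (u + 1) (u' + 1) s t hs ht hst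
  have k₂ := sq_add_mul_le (v - 1) (v' - 1) s t hs ht hst
  have k₃ := add_mul_lt h₂ h₂' hs ht hst
  have k₄ := add_mul_lt h₃ h₃' hs ht hst
  have e₁ : s * u + t * u' + 1 = s * (u + 1) + t * (u' + 1) := by linear_combination -hst
  have e₂ : s * v + t * v' - 1 = s * (v - 1) + t * (v' - 1) := by linear_combination hst
  refine ⟨hP h₁ h₁' hs ht hst, ?_, ?_⟩ <;>
    simp only [Prod.smul_mk, smul_eq_mul, Prod.mk_add_mk, e₁, e₂] at * <;> linarith

theorem isLinearMap_snd_sub_fst : IsLinearMap ℝ fun y : ℝ × ℝ => y.2 - y.1 where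
  map_add x y := by simp only [Prod.fst_add, Prod.snd_add]; ring
  map_smul c x := by simp only [Prod.smul_fst, Prod.smul_snd, smul_eq_mul]; ring

theorem isPathConnected_pos {ν : Name}
    (hν : ν ∈ ({.PP010, .PP110, .PP001, .PP011, .PP101} : Set Name)) :
    IsPathConnected (region Pos ν) := by
  simp only [mem_insert_iff, mem_singleton_iff] at hν
  rcases hν with rfl | rfl | rfl | rfl | rfl
  · convert isPathConnected_above (P := fun y => y.1 < -1) (convex_halfSpace_lt
      (IsLinearMap.mk (by simp) (by simp)) (-1)) ⟨(-3 / 2, 1), by norm_num⟩ using 1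
    ext y
    constructor
    · rintro ⟨h₁, h₂, h₃, h₄, h₅⟩
      exact ⟨h₃, B₁_one_neg_iff.1 h₄, by unfold q₁ at h₅; linarith⟩
    · rintro ⟨h₁, h₂, h₃⟩
      exact ⟨by linarith, by nlinarith, h₁, B₁_one_neg_iff.2 h₂, by unfold q₁; linarith⟩
  · convert isPathConnected_below (l := -2) (r := -1) le_rfl (by norm_num) (by norm_num)
      (.inl le_rfl) using 1
    ext y
    constructor
    · rintro ⟨h₁, h₂, h₃, h₄, h₅⟩
      have h₄' := B₁_one_neg_iff.1 h₄
      exact ⟨by nlinarith, h₃, h₂, h₄', by unfold q₁ at h₅; linarith⟩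
    · rintro ⟨h₁, h₂, h₃, h₄, h₅⟩
      exact ⟨by linarith, h₃, h₂, B₁_one_neg_iff.2 h₄, by unfold q₁; linarith⟩
  -- The condition d₁ > -1 can be dropped here: (d₁ + 1)² < d₂ < 1 + d₁ already implies it.
  · convert isPathConnected_above (P := fun y => y.2 - y.1 < 1)
      (convex_halfSpace_lt isLinearMap_snd_sub_fst 1) ⟨(-2 / 5, 1 / 2), by norm_num⟩ using 1
    ext y
    constructor
    · rintro ⟨h₁, h₂, h₃, h₄, h₅, h₆⟩
      unfold q₂ at h₅
      unfold q₁ at h₆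
      exact ⟨by linarith, B₁_one_neg_iff.1 h₄, by linarith⟩
    · rintro ⟨h₁, h₂, h₃⟩
      exact ⟨by nlinarith, by nlinarith, by nlinarith, B₁_one_neg_iff.2 h₂,
        by unfold q₂; linarith, by unfold q₁; linarith⟩
  · convert isPathConnected_above (P := fun y => -1 < y.1 ∧ 1 < y.2 - y.1)
      ((convex_halfSpace_gt (LinearMap.fst ℝ ℝ ℝ).isLinear (-1)).inter
        (convex_halfSpace_gt isLinearMap_snd_sub_fst 1))
      ⟨(-1 / 2, 1), by norm_num⟩ using 1
    ext y
    constructor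
    · rintro ⟨h₁, h₂, h₃, h₄, h₅⟩
      unfold q₂ at h₅
      exact ⟨⟨by linarith, by linarith⟩, B₁_one_neg_iff.1 h₄, by nlinarith⟩
    · rintro ⟨⟨h₀, h₁⟩, h₂, h₃⟩
      exact ⟨by nlinarith, by nlinarith, by linarith, B₁_one_neg_iff.2 h₂,
        by unfold q₂; linarith⟩
  · convert isPathConnected_below (l := -1) (r := 0) (by norm_num) le_rfl (by norm_num)
      (.inr le_rfl) using 1
    ext y
    constructor
    · rintro ⟨h₁, h₂, h₃, h₄, h₅⟩
      exact ⟨h₃, h₁, h₂, B₁_one_neg_iff.1 h₄, by unfold q₁ at h₅; linarith⟩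
    · rintro ⟨h₁, h₂, h₃, h₄, h₅⟩
      exact ⟨h₂, h₃, h₁, B₁_one_neg_iff.2 h₄, by unfold q₁; linarith⟩

theorem classification_one :
    OneBranchClassification (focalE₃ 1) focalS₃ (region Pos)
      {.PP010, .PP110, .PP001, .PP011, .PP101} 5 := by
  have hS : ∀ {a b c : ℝ}, Telecentric a b c →
      ((-a, b), (-c, b + a * c, -1 * -c / (b + a * c))) ∈ focalE₃ 1 → ∀ ν,
      focalS₃ ((-a, b), (-c, b + a * c, -1 * -c / (b + a * c))) = ν.signature ↔ Pos (-a) b ν :=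
    fun h hE ν => (focalS₂_eq_iff h.posRoot (mem_focalE₃.1 hE).1 ν).trans (h.pos_iff ν).symm
  refine .of_levelSets (continuousOn_focalS₃ 1) ?_ (fun ν => isPathConnected_pos) ?_ ?_
    (solution 1) ?_ ?_ ?_
  · intro _ hp
    obtain ⟨a, b, c, h, rfl⟩ := exists_of_mem_one hp
    obtain ⟨k₁, k₂, k₃⟩ := (mem_focalE₂_one h.posRoot).1 (mem_focalE₃.1 hp).1
    obtain ⟨ν, hν, ho⟩ := exists_posOrder h.posRoot k₁ k₂ k₃
    have ho' := (h.pos_iff ν).2 ho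
    refine ⟨ν, ?_, (hS h hp ν).2 ho'⟩
    cases ν <;> first | exact ho'.elim | simp
  · iterate 4 rw [ncard_insert_of_notMem (by simp)]
    simp
  · intro _ hp ν _
    obtain ⟨a, b, c, h, rfl⟩ := exists_of_mem_one hp
    rw [hS h hp]
    exact ⟨fun h' => h'.2.2, fun h' => ⟨neg_lt_zero.2 h.a_pos, h.b_pos, h'⟩⟩
  · intro ν _
    refine continuousOn_solution 1 fun y hy => ?_
    obtain ⟨a, b, c, h, rfl⟩ := telecentric_of_pos hy
    have e := congrArg (fun s : ℝ × ℝ × ℝ => s.2.1) h.solution_eq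
    simp only [solution] at e
    exact ⟨neg_ne_zero.2 h.a_pos.ne', h.b_pos.ne', e ▸ h.posRoot.x_pos.ne'⟩
  · intro ν hν y hy
    obtain ⟨a, b, c, h, rfl⟩ := telecentric_of_pos hy
    rw [h.solution_eq]
    refine mem_focalE₃_one h ((mem_focalE₂_one h.posRoot).2 ?_)
    have ho := (h.pos_iff ν).1 hy.2.2
    refine ⟨?_, ?_, ?_⟩ <;> cases ν <;> simp only [PosOrder] at ho <;>
      intro h0 <;> rw [h0] at ho <;> simp at ho
  · intro _ hp
    obtain ⟨a, b, c, h, rfl⟩ := exists_of_mem_one hp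
    exact h.solution_eq.symm

end Pos

/-! ### The case `f = -1`, with `d₁ = -a`, `d₂ = b`, `d₃ = -c` -/

section Neg

open Focal₂

variable {a b c : ℝ}

/-- The telecentric points over `(-a, b)`. -/
structure NegTelecentric (a b c : ℝ) : Prop where
  a_pos : 0 < a
  b_pos : 0 < b
  eq : a * b * c = -B₁ (-1) (-a) b

namespace NegTelecentric

theorem c_pos (h : NegTelecentric a b c) : 0 < c := by
  have ha := h.a_pos
  have hb := h.b_pos
  have e : a * b * c = a ^ 2 + 2 * a + (b + 1) ^ 2 := by
    rw [h.eq, B₁]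
    ring
  have : 0 < a * b * c := by
    rw [e]
    positivity
  exact pos_of_mul_pos_right this (by positivity)

/-- The equation gives b (ac - b - 1) = a² + 2a + b + 1 > 0. As x > 1 always, PN011 is the only name
for f = -1. -/
theorem one_lt (h : NegTelecentric a b c) : 1 < a * c - b := by
  have ha := h.a_pos
  have hb := h.b_pos
  have e := h.eq
  unfold B₁ at e
  have : 0 < b * (a * c - b - 1) := by nlinarith
  linarith [pos_of_mul_pos_right this hb.le]

theorem negRoot (h : NegTelecentric a b c) : NegRoot a b c (a * c - b) := by
  have hx := h.one_lt
  have e := h.eq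
  unfold B₁ at e
  exact ⟨h.a_pos, h.b_pos, h.c_pos, by linarith, by linear_combination -c * (a * c - b) * e⟩

theorem solution_eq (h : NegTelecentric a b c) :
    solution (-1) (-a, b) = (-c, a * c - b, -(-1) * -c / (a * c - b)) := by
  have ha := h.a_pos.ne'
  have hb := h.b_pos.ne'
  have e : B₁ (-1) (-a) b = -(a * b * c) := by linarith [h.eq]
  have e₃ : -(-(a * b * c) / (-a * b)) = -c := by field_simp
  have ex : -1 * b - -(a * b * c) / b = a * c - b := by
    field_simp
    ring
  simp only [solution, e, e₃, ex]

theorem mem (h : NegTelecentric a b c) :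
    ((-a, b), (-c, a * c - b, -(-1) * -c / (a * c - b))) ∈ focalE₃ (-1) := by
  have hx : a * c - b ≠ 0 := h.negRoot.ne_zero
  refine mem_focalE₃.2 ⟨h.negRoot.mem, ?_⟩
  unfold g₃ pupilSum
  field_simp
  ring

theorem signature_eq (h : NegTelecentric a b c) :
    focalS₃ ((-a, b), (-c, a * c - b, -(-1) * -c / (a * c - b))) = Name.PN011.signature :=
  h.negRoot.signature_of_order .PN011 h.one_lt

end NegTelecentric

theorem exists_of_mem_neg_one {p : (ℝ × ℝ) × (ℝ × ℝ × ℝ)} (hp : p ∈ focalE₃ (-1)) :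
    ∃ a b c : ℝ, NegTelecentric a b c ∧
      p = ((-a, b), (-c, a * c - b, -(-1) * -c / (a * c - b))) := by
  obtain ⟨⟨d₁, d₂⟩, d₃, x', w⟩ := p
  obtain ⟨hE, hg⟩ := mem_focalE₃.1 hp
  obtain ⟨a, b, c, x, h, he⟩ := exists_of_mem_focalE₂_neg_one hE
  simp only [Prod.mk.injEq] at he
  obtain ⟨⟨rfl, rfl, rfl⟩, rfl, rfl⟩ := he
  have hc := h.c_pos
  have hx := h.ne_zero
  unfold g₃ pupilSum at hg
  have hx' : x' = a * c - d₂ := by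
    field_simp at hg
    have : c * (x' - (a * c - d₂)) = 0 := by linear_combination hg
    linarith [(mul_eq_zero.1 this).resolve_left hc.ne']
  subst hx'
  refine ⟨a, d₂, c, ⟨h.a_pos, h.b_pos, ?_⟩, rfl⟩
  have e := h.eq
  unfold B₁
  have : (c * (a * c - d₂)) * (a * d₂ * c - ((a + 1) ^ 2 + (d₂ + 1) ^ 2 - 1)) = 0 := by
    linear_combination -e
  have := (mul_eq_zero.1 this).resolve_left (mul_ne_zero hc.ne' hx)
  linarith

theorem negTelecentric_of_mem {y : ℝ × ℝ} {ν : Name} (hy : y ∈ region Neg ν) :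
    ∃ a b c, NegTelecentric a b c ∧ y = (-a, b) := by
  obtain ⟨d₁, d₂⟩ := y
  obtain ⟨h₁, h₂, -⟩ := hy
  obtain ⟨a, rfl⟩ : ∃ a, d₁ = -a := ⟨-d₁, by ring⟩
  simp only at h₁ h₂
  have ha : 0 < a := by linarith
  exact ⟨a, d₂, -B₁ (-1) (-a) d₂ / (a * d₂), ⟨ha, h₂, by field_simp⟩, rfl⟩

theorem isPathConnected_neg : IsPathConnected (region Neg .PN011) := by
  refine Convex.isPathConnected ?_ ⟨(-1, 1), by norm_num, by norm_num, trivial⟩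
  rintro ⟨u, v⟩ ⟨h₁, h₂, -⟩ ⟨u', v'⟩ ⟨h₁', h₂', -⟩ s t hs ht hst
  have k₁ := add_mul_lt h₁ h₁' hs ht hst
  have k₂ := add_mul_lt h₂ h₂' hs ht hst
  exact ⟨by simpa using k₁, by simpa using k₂, trivial⟩

theorem classification_neg_one :
    OneBranchClassification (focalE₃ (-1)) focalS₃ (region Neg) {.PN011} 1 := by
  refine .of_levelSets (continuousOn_focalS₃ (-1)) ?_ ?_ (by simp) ?_ (solution (-1)) ?_ ?_ ?_
  · intro _ hp
    obtain ⟨a, b, c, h, rfl⟩ := exists_of_mem_neg_one hp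
    exact ⟨.PN011, rfl, h.signature_eq⟩
  · rintro _ rfl
    exact isPathConnected_neg
  · rintro _ hp _ rfl
    obtain ⟨a, b, c, h, rfl⟩ := exists_of_mem_neg_one hp
    exact ⟨fun _ => h.signature_eq, fun _ => ⟨neg_lt_zero.2 h.a_pos, h.b_pos, trivial⟩⟩
  · intro ν _
    refine continuousOn_solution (-1) fun y hy => ?_
    obtain ⟨a, b, c, h, rfl⟩ := negTelecentric_of_mem hy
    have e := congrArg (fun s : ℝ × ℝ × ℝ => s.2.1) h.solution_eq
    simp only [solution] at e
    exact ⟨neg_ne_zero.2 h.a_pos.ne', h.b_pos.ne', e ▸ h.negRoot.ne_zero⟩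
  · intro ν _ y hy
    obtain ⟨a, b, c, h, rfl⟩ := negTelecentric_of_mem hy
    rw [h.solution_eq]
    exact h.mem
  · intro _ hp
    obtain ⟨a, b, c, h, rfl⟩ := exists_of_mem_neg_one hp
    exact h.solution_eq.symm

end Neg

end Focal₃

end ThreeMirror

end

theorem mainTheorem1 :
    -- Focal systems in codimension 2, `f = 1`
    ThreeMirror.TwoBranchClassification
      (ThreeMirror.focalE₂ 1) ThreeMirror.focalS₂ (ThreeMirror.Focal₂.φ 1)
      (ThreeMirror.Focal₂.region ThreeMirror.Focal₂.PosMinus)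
      (ThreeMirror.Focal₂.region ThreeMirror.Focal₂.PosPlus)
      {.PP010, .PP110, .PP001, .PP011, .PP100, .PP101} 6 ∧
    -- Focal systems in codimension 2, `f = -1`
    ThreeMirror.TwoBranchClassification
      (ThreeMirror.focalE₂ (-1)) ThreeMirror.focalS₂ (ThreeMirror.Focal₂.φ (-1))
      (ThreeMirror.Focal₂.region ThreeMirror.Focal₂.NegMinus)
      (ThreeMirror.Focal₂.region ThreeMirror.Focal₂.NegPlus)
      {.NP101, .PN101, .NP110, .PN011} 4 ∧
    -- Afocal systems in codimension 2
    ThreeMirror.TwoBranchClassification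
      ThreeMirror.afocalE₂ ThreeMirror.afocalS₂ ThreeMirror.Afocal₂.φ
      (ThreeMirror.Afocal₂.region ThreeMirror.Afocal₂.Minus)
      (ThreeMirror.Afocal₂.region ThreeMirror.Afocal₂.Plus)
      {.NP110, .NP101, .PN101, .PN011} 4 ∧
    -- Focal systems in codimension 3, `f = 1`
    ThreeMirror.OneBranchClassification
      (ThreeMirror.focalE₃ 1) ThreeMirror.focalS₃
      (ThreeMirror.Focal₃.region ThreeMirror.Focal₃.Pos)
      {.PP010, .PP110, .PP001, .PP011, .PP101} 5 ∧
    -- Focal systems in codimension 3, `f = -1`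
    ThreeMirror.OneBranchClassification
      (ThreeMirror.focalE₃ (-1)) ThreeMirror.focalS₃
      (ThreeMirror.Focal₃.region ThreeMirror.Focal₃.Neg)
      {.PN011} 1 ∧
    -- Afocal systems in codimension 3
    ThreeMirror.TwoBranchClassification
      ThreeMirror.afocalE₃ ThreeMirror.afocalS₃ ThreeMirror.Afocal₃.φ
      (ThreeMirror.Afocal₃.region ThreeMirror.Afocal₃.Minus)
      (ThreeMirror.Afocal₃.region ThreeMirror.Afocal₃.Plus)
      {.NP110, .NP101, .PN101, .PN011} 4 :=
  ⟨ThreeMirror.Focal₂.classification_one, ThreeMirror.Focal₂.classification_neg_one,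
    ThreeMirror.Afocal₂.classification, ThreeMirror.Focal₃.classification_one,
    ThreeMirror.Focal₃.classification_neg_one, ThreeMirror.Afocal₃.classification⟩
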